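/- **Theorem.** There is an algorithm which, given a finite alphabet $\Sigma$ and a straight-line formula $\varphi$ of the string constraint language $\mathrm{STR}$ over $\Sigma$, decides whether $\varphi$ is satisfiable. (Equivalently, the set of all pairs of an alphabet size and the code of a satisfiable straight-line formula over an alphabet of this size is computable.) **Regular expressions.** $e ::= \emptyset \mid \varepsilon \mid a \mid (e) \mid [e+e] \mid [e\cdot e] \mid [e^{?}] \mid [e^{??}] \mid [e^{*}] \mid [e^{*?}] \mid [e^{+}] \mid [e^{+?}] \mid [e^{\{m_1,m_2\}}] \mid [e^{\{m_1,m_2\}?}]$ with $a\in\Sigma$ and $m_1\le m_2$ in $\mathbb N$. Parentheses are capturing groups, numbered from $1$ in the order of their opening parentheses; the variants with an additional $?$ are lazy, the others greedy. $\mathscr L(e)$ is the usual regular language of $e$. **Formulas.** $\varphi ::= x=y \mid z=x\cdot y \mid y=\mathsf{extract}_{i,e}(x)\mid y=\mathsf{replace}_{p,r}(x)\mid y=\mathsf{replaceAll}_{p,r}(x)\mid x\in e\mid\varphi\wedge\varphi\mid\varphi\vee\varphi\mid\neg\varphi$, where $i\in\mathbb N$, $e$ and $p$ are regular expressions, and $r$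 is a finite sequence of letters, references $\$i$ $(i\in\mathbb N)$ and the references $\$^{\leftarrow}$, $\$^{\rightarrow}$. Variables range over $\Sigma^*$; $x\in e$ means $x\in\mathscr L(e)$, and an equation holds if its right-hand side is defined and equal to the left-hand side. $\varphi$ is *satisfiable* if some assignment of strings to the variables makes it true. $\varphi$ is *straight-line* if it contains neither negation nor disjunction and its equations can be ordered into a sequence $x_1=t_1,\dots,x_n=t_n$ such that the $x_i$ are mutually distinct and $x_i$ does not occur in $t_1,\dots,t_i$. **Transducers.** A prioritized streaming string transducer (PSST) has finitely many states and string variables, an initial state, ordered lists $\delta(q,a)$ of $a$-successors of $q$, two ordered lists $\tau(q)=(P_1;P_2)$ of $\varepsilon$-successors (of higher, resp. lower priority than the letter transitions; all these lists are without repetition and $P_1\cap P_2=\emptyset$), for each transition an assignment of words over variables, letters and a symbol $\mathsf{null}\notin\Sigma$ to the variables, and two sets $F_1,F_2$ of final states. In a run, no $\varepsilon$-transition may occur twice without a letter transition in between. A run has higher priority than another run on the same word if it properly extends it, or if at the first difference it takes the transition of higher priority. The accepting run is the run of highest priority among those that end in $F_1\cup F_2$. All variables start with the value $\mathsf{null}$.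 **Matching.** The match of $e$ to $w$ is given by the accepting run on $w$ of the following PSST $T_e$, which has a variable $x_{e'}$ for each subexpression occurrence $e'$; $T_e$ accepts the empty word in $F_1$ and the other words in $F_2$. Each $x_e$ is set to $\varepsilon$ by the transitions out of the initial state of $T_e$, and all other transitions of $T_e$ append their label to $x_e$; for $e=(e_1)$ one has $T_e=T_{e_1}$ with $x_e$ a copy of $x_{e_1}$. Variables that are not mentioned keep their values. - $\emptyset$: a single state; $\varepsilon$: one $\varepsilon$-transition into $F_1$; $a$: an $\varepsilon$-transition, then an $a$-transition into $F_2$. - $T\cdot T'$ consists of $T$ and two copies of $T'$; there are $\varepsilon$-transitions from $F_1(T)$ to the start of the first copy and from $F_2(T)$ to the start of the second copy, which set all variables of $T'$ to $\mathsf{null}$. $F_1$ consists of the $F_1$-states of the first copy, and $F_2$ of the other final states of the copies. - In the following cases a fresh initial state with $\varepsilon$-transitions is added. $[e_1+e_2]$: to $T_{e_1}$ and, with lower priority, to $T_{e_2}$. $[e_1\cdot e_2]$: to $T_{e_1}\cdot T_{e_2}$. $[e_1^?]$: to $T_{e_1}$ and, with lower priority, to a fresh state $f$; $F_1=\{f\}$,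 $F_2=F_2(T_{e_1})$. $[e_1^*]$: to $T_{e_1}$ and, with lower priority, to a fresh state $f_1$; further $\varepsilon$-transitions lead from $F_1(T_{e_1})$ to the start of $T_{e_1}$, and from $F_2(T_{e_1})$ to the start of $T_{e_1}$ and, with lower priority, to a fresh state $f_2$; those to the start of $T_{e_1}$ set the variables of $T_{e_1}$ to $\mathsf{null}$; $F_1=\{f_1\}$, $F_2=\{f_2\}$. $[e_1^+]$: to $T_{e_1}\cdot T^-$, where $T^-$ is the PSST of $[e_1^*]$ without the variable of that expression. $[e_1^{\{m_1,m_2\}}]$: to $T_{e_1}^{m_1}\cdot U_{m_2-m_1}$, where $T_{e_1}^{m}$ is the $m$-fold concatenation with the same variables (the factor $T_{e_1}^{0}$ or $U_0$ is omitted; if $m_1=m_2=0$, the PSST of $\varepsilon$ is taken), and $U_n$ consists of $n$ copies of $T_{e_1}$, started in the first one, with $\varepsilon$-transitions of lowest priority from the start of the first copy to a fresh state $f_0$, from the $F_2$-states of each copy but the last to the start of the next copy (setting the variables of $T_{e_1}$ to $\mathsf{null}$) and, with lower priority, to a fresh state $f_1$, and from the $F_2$-states of the last copy to $f_1$; $F_1=\{f_0\}$,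 $F_2=\{f_1\}$. - For the lazy variants the priorities of these new $\varepsilon$-transitions, between entering $T_{e_1}$ and leaving, are swapped. **String functions.** $\mathsf{extract}_{i,e}(x)$ is undefined if $e$ does not match $x$. Otherwise it is $x$ for $i=0$, and for $i>0$ the final value of the variable of the $i$-th group, undefined if this value is $\mathsf{null}$ or there is no such group. The first match of $p$ in $x$, together with its groups and the text before it, is read off from the match of $[[([\Sigma^{*?}])\cdot(p)]\cdot[\Sigma^*]]$ to $x$. $\mathsf{replace}_{p,r}(x)$ replaces the first match of $p$ in $x$ (if any) by $r$, where $\$0$ stands for the match, $\$i$ for the match of its $i$-th group (the empty string if there is none), and $\$^{\leftarrow}$, $\$^{\rightarrow}$ for the text of $x$ before and after the match. $\mathsf{replaceAll}_{p,r}(x)$ does this repeatedly, each time with the first match in the remaining suffix behind the last match (behind the next letter, which is copied, if the last match was empty), where $\$^{\leftarrow}$ and $\$^{\rightarrow}$ always refer to the original string $x$. -/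

import Mathlib

namespace StrSL

/-! ## Syntax

The alphabet is `Fin k`, strings are `List (Fin k)`, string variables are natural numbers. -/

/-- Real-world regular expressions. The flag of the quantifiers is `true` for the greedy
variant and `false` for the lazy one. `group e` is the capturing group `(e)`, and
`rep g m d e` is the bounded repetition of `e` between `m` and `m + d` times. -/
inductive Regex (k : ℕ) : Type
  | empty : Regex k
  | eps : Regex k
  | letter (a : Fin k) : Regex k
  | group (e : Regex k) : Regex k
  | alt (e₁ e₂ : Regex k) : Regex k
  | seq (e₁ e₂ : Regex k) : Regex k
  | opt (greedy : Bool) (e : Regex k) : Regex k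
  | star (greedy : Bool) (e : Regex k) : Regex k
  | plus (greedy : Bool) (e : Regex k) : Regex k
  | rep (greedy : Bool) (m d : ℕ) (e : Regex k) : Regex k

/-- Symbols of a replacement string: letters, references `$i` (with `$0` the whole match), and
the references to the text before and after the match. -/
inductive RepSym (k : ℕ) : Type
  | letter (a : Fin k) : RepSym k
  | ref (i : ℕ) : RepSym k
  | before : RepSym k
  | after : RepSym k

/-- Right-hand sides of equations. -/
inductive Term (k : ℕ) : Type
  | var (y : ℕ) : Term k
  | concat (y z : ℕ) : Term k
  | extract (i : ℕ) (e : Regex k) (y : ℕ) : Term k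
  | replace (pat : Regex k) (rep : List (RepSym k)) (y : ℕ) : Term k
  | replaceAll (pat : Regex k) (rep : List (RepSym k)) (y : ℕ) : Term k

/-- Formulas of the string constraint language. -/
inductive Formula (k : ℕ) : Type
  | eqn (x : ℕ) (t : Term k) : Formula k
  | mem (x : ℕ) (e : Regex k) : Formula k
  | and (φ ψ : Formula k) : Formula k
  | or (φ ψ : Formula k) : Formula k
  | not (φ : Formula k) : Formula k

/-- The language of a regular expression (laziness and capturing groups do not matter). -/
def Regex.lang {k : ℕ} : Regex k → Language (Fin k)
  | .empty => 0
  | .eps => 1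
  | .letter a => {[a]}
  | .group e => e.lang
  | .alt e₁ e₂ => e₁.lang + e₂.lang
  | .seq e₁ e₂ => e₁.lang * e₂.lang
  | .opt _ e => e.lang + 1
  | .star _ e => KStar.kstar e.lang
  | .plus _ e => e.lang * KStar.kstar e.lang
  | .rep _ m d e => {w | ∃ n, m ≤ n ∧ n ≤ m + d ∧ w ∈ e.lang ^ n}

/-- The number of (occurrences of) subexpressions. -/
def Regex.size {k : ℕ} : Regex k → ℕ
  | .empty => 1
  | .eps => 1
  | .letter _ => 1
  | .group e => e.size + 1
  | .alt e₁ e₂ => e₁.size + e₂.size + 1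
  | .seq e₁ e₂ => e₁.size + e₂.size + 1
  | .opt _ e => e.size + 1
  | .star _ e => e.size + 1
  | .plus _ e => e.size + 1
  | .rep _ _ _ e => e.size + 1

/-- Subexpression occurrences are numbered in preorder, starting with `n` for the expression
itself. This lists the numbers of the capturing groups, in the order of their opening
parentheses. -/
def Regex.groups {k : ℕ} : Regex k → ℕ → List ℕ
  | .empty, _ => []
  | .eps, _ => []
  | .letter _, _ => []
  | .group e, n => n :: e.groups (n + 1)
  | .alt e₁ e₂, n => e₁.groups (n + 1) ++ e₂.groups (n + 1 + e₁.size)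
  | .seq e₁ e₂, n => e₁.groups (n + 1) ++ e₂.groups (n + 1 + e₁.size)
  | .opt _ e, n => e.groups (n + 1)
  | .star _ e, n => e.groups (n + 1)
  | .plus _ e, n => e.groups (n + 1)
  | .rep _ _ _ e, n => e.groups (n + 1)

/-! ## Prioritized streaming string transducers -/

/-- The values of the string variables of a transducer: words over the alphabet extended by
the symbol `none`, which stands for the special symbol `null`. -/
abbrev Val (k : ℕ) : Type := List (Option (Fin k))

/-- Assignments of the string variables (which are numbers). Each variable is mapped to a word
of variables, letters, and the symbol `null` (that is, `Sum.inr none`). -/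
abbrev Asg (k : ℕ) : Type := ℕ → List (ℕ ⊕ Option (Fin k))

/-- Every variable keeps its value. -/
def Asg.keep (k : ℕ) : Asg k := fun y => [Sum.inl y]

/-- The variables `y` with `lo ≤ y < hi` are set to `null`, the others keep their values. -/
def Asg.nullify (k lo hi : ℕ) : Asg k := fun y =>
  if lo ≤ y ∧ y < hi then [Sum.inr none] else [Sum.inl y]

/-- Prioritized streaming string transducers with two sets of final states, for accepting the
empty word and the nonempty words. `δ` gives the letter transitions, `τ` the `ε`-transitions
of higher and of lower priority than the letter transitions, each list from the highest to the
lowest priority. In `E q a q'` the label `a = none` stands for `ε`; the values of `E` outside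
the transitions are irrelevant. -/
structure PSST (k : ℕ) where
  Q : Type
  [decQ : DecidableEq Q]
  [finQ : Finite Q]
  δ : Q → Fin k → List Q
  τ : Q → List Q × List Q
  E : Q → Option (Fin k) → Q → Asg k
  start : Q
  fin1 : Q → Bool
  fin2 : Q → Bool
  δ_nodup : ∀ q a, (δ q a).Nodup
  τ_nodup : ∀ q, ((τ q).1 ++ (τ q).2).Nodup

attribute [instance] PSST.decQ PSST.finQ

namespace PSST

variable {k : ℕ}

/-- There is a transition from `q` to `q'` labelled by `a` (`none` is `ε`). -/
def Edge (T : PSST k) (q : T.Q) : Option (Fin k) → T.Q → Prop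
  | some a, q' => q' ∈ T.δ q a
  | none, q' => q' ∈ (T.τ q).1 ∨ q' ∈ (T.τ q).2

/-- A sequence of labels and target states is a path of transitions from `q`. -/
def Path (T : PSST k) : T.Q → List (Option (Fin k) × T.Q) → Prop
  | _, [] => True
  | q, (a, q') :: r => T.Edge q a q' ∧ T.Path q' r

/-- The last state of a path from `q`. -/
def last (T : PSST k) : T.Q → List (Option (Fin k) × T.Q) → T.Q
  | q, [] => q
  | _, (_, q') :: r => T.last q' r

/-- The list of the transitions (source, label, target) of a path from `q`. -/
def trans (T : PSST k) : T.Q → List (Option (Fin k) × T.Q) → List (T.Q × Option (Fin k) × T.Q)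
  | _, [] => []
  | q, (a, q') :: r => (q, a, q') :: T.trans q' r

/-- Runs on `w`: paths from the initial state that read `w`, such that in every contiguous
sequence of `ε`-transitions each transition occurs at most once. -/
def IsRun (T : PSST k) (w : List (Fin k)) (r : List (Option (Fin k) × T.Q)) : Prop :=
  T.Path T.start r ∧ r.filterMap Prod.fst = w ∧
    ∀ s, s <:+: T.trans T.start r → (∀ t ∈ s, t.2.1 = none) → s.Nodup

/-- Out of state `u`, the first transition has higher priority than the second one. -/
def Prior (T : PSST k) (u : T.Q) : Option (Fin k) × T.Q → Option (Fin k) × T.Q → Prop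
  | (some a, q), (some b, q') => a = b ∧ q ≠ q' ∧ [q, q'].Sublist (T.δ u a)
  | (none, q), (none, q') => q ≠ q' ∧ ([q, q'].Sublist (T.τ u).1 ∨ [q, q'].Sublist (T.τ u).2 ∨
      (q ∈ (T.τ u).1 ∧ q' ∈ (T.τ u).2))
  | (none, q), (some b, q') => q ∈ (T.τ u).1 ∧ q' ∈ T.δ u b
  | (some a, q), (none, q') => q ∈ T.δ u a ∧ q' ∈ (T.τ u).2

/-- The run `r` is of higher priority than the run `r'`. -/
def Higher (T : PSST k) (r r' : List (Option (Fin k) × T.Q)) : Prop :=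
  (r' <+: r ∧ r' ≠ r) ∨
    ∃ p t t' s s', r = p ++ t :: s ∧ r' = p ++ t' :: s' ∧ T.Prior (T.last T.start p) t t'

/-- The run `r` ends in a final state. -/
def Final (T : PSST k) (r : List (Option (Fin k) × T.Q)) : Prop :=
  T.fin1 (T.last T.start r) = true ∨ T.fin2 (T.last T.start r) = true

/-- The accepting run: the run on `w` of the highest priority among those that end in a final
state. -/
def Accepting (T : PSST k) (w : List (Fin k)) (r : List (Option (Fin k) × T.Q)) : Prop :=
  T.IsRun w r ∧ T.Final r ∧ ∀ r', T.IsRun w r' → T.Final r' → r' ≠ r → T.Higher r r'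

/-- The valuation of the variables after the path `r` from `q`, starting with `η`. -/
def eval (T : PSST k) (η : ℕ → Val k) : T.Q → List (Option (Fin k) × T.Q) → ℕ → Val k
  | _, [] => η
  | q, (a, q') :: r =>
      T.eval (fun x => (T.E q a q' x).flatMap (Sum.elim η (fun c => [c]))) q' r

end PSST

/-! ## The transducer of a regular expression

The string variable of a subexpression occurrence is its number in preorder. The variables that
belong to an expression numbered `n` are thus those in `[n, n + size)`. -/

/-- `ε`-transitions to `p` and to `q`, where `p` has the higher priority iff `g = true`. -/
def order {α : Type} (g : Bool) (p q : α) : List α := if g then [p, q] else [q, p]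

lemma order_nodup {α : Type} (g : Bool) {p q : α} (h : p ≠ q) : (order g p q).Nodup := by
  cases g <;> simp [order, h, h.symm]

lemma nodup_map_append {α β : Type} {f : α → β} (hf : Function.Injective f) {l : List α × List α}
    (h : (l.1 ++ l.2).Nodup) : (l.1.map f ++ l.2.map f).Nodup := by
  rw [← List.map_append]; exact h.map hf

namespace PSST

variable {k : ℕ}

/-- Record in the variable `n` the word read: it is set to the empty word by the transitions
out of the initial state, and every other transition appends its label. -/
def track (T : PSST k) (n : ℕ) : PSST k :=
  { T with
    E := fun q a q' y =>
      if y = n then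
        (if q = T.start then [] else Sum.inl n :: a.toList.map (fun b => Sum.inr (some b)))
      else T.E q a q' y }

/-- The variable `n` of a capturing group copies the variable `n + 1` of its body. -/
def copyVar (T : PSST k) (n : ℕ) : PSST k :=
  { T with E := fun q a q' y => if y = n then T.E q a q' (n + 1) else T.E q a q' y }

/-- No word is accepted. -/
def emptyCore (k : ℕ) : PSST k where
  Q := Unit
  δ _ _ := []
  τ _ := ([], [])
  E _ _ _ := Asg.keep k
  start := ()
  fin1 _ := false
  fin2 _ := false
  δ_nodup := by simp
  τ_nodup := by simp

/-- One `ε`-transition from the initial state `false` to the final state `true`. -/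
def epsCore (k : ℕ) : PSST k where
  Q := Bool
  δ _ _ := []
  τ q := if q then ([], []) else ([true], [])
  E _ _ _ := Asg.keep k
  start := false
  fin1 q := q
  fin2 _ := false
  δ_nodup := by simp
  τ_nodup := by intro q; cases q <;> simp

/-- An `ε`-transition from state `0` to state `1`, then a transition reading `a` to state `2`. -/
def letterCore (a : Fin k) : PSST k where
  Q := Fin 3
  δ q b := if q = 1 ∧ b = a then [2] else []
  τ q := if q = 0 then ([1], []) else ([], [])
  E _ _ _ := Asg.keep k
  start := 0
  fin1 _ := false
  fin2 q := decide (q = 2)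
  δ_nodup := by intro q b; split_ifs <;> simp
  τ_nodup := by intro q; split_ifs <;> simp

/-- Alternative: a fresh initial state with `ε`-transitions to `T₁` and, with lower priority,
to `T₂`. -/
def altCore (T₁ T₂ : PSST k) : PSST k where
  Q := Option (T₁.Q ⊕ T₂.Q)
  δ
    | none, _ => []
    | some (.inl q), a => (T₁.δ q a).map (fun p => some (.inl p))
    | some (.inr q), a => (T₂.δ q a).map (fun p => some (.inr p))
  τ
    | none => ([some (.inl T₁.start)], [some (.inr T₂.start)])
    | some (.inl q) =>
        ((T₁.τ q).1.map (fun p => some (.inl p)), (T₁.τ q).2.map (fun p => some (.inl p)))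
    | some (.inr q) =>
        ((T₂.τ q).1.map (fun p => some (.inr p)), (T₂.τ q).2.map (fun p => some (.inr p)))
  E
    | some (.inl q), a, some (.inl q') => T₁.E q a q'
    | some (.inr q), a, some (.inr q') => T₂.E q a q'
    | _, _, _ => Asg.keep k
  start := none
  fin1
    | none => false
    | some (.inl q) => T₁.fin1 q
    | some (.inr q) => T₂.fin1 q
  fin2
    | none => false
    | some (.inl q) => T₁.fin2 q
    | some (.inr q) => T₂.fin2 q
  δ_nodup := by
    rintro (_ | q | q) a
    · simp
    · exact (T₁.δ_nodup q a).map (fun x y h => by simpa using h)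
    · exact (T₂.δ_nodup q a).map (fun x y h => by simpa using h)
  τ_nodup := by
    rintro (_ | q | q)
    · simp
    · exact nodup_map_append (fun x y h => by simpa using h) (T₁.τ_nodup q)
    · exact nodup_map_append (fun x y h => by simpa using h) (T₂.τ_nodup q)

/-- Concatenation of `T₁` with two copies of `T₂`, one to be entered after `T₁` has read the
empty word and one to be entered after it has read a nonempty word. The variables of `T₂`, which
are those in `[lo, hi)`, are set to `null` on entering a copy of `T₂`. -/
def concat (T₁ T₂ : PSST k) (lo hi : ℕ) : PSST k where
  Q := T₁.Q ⊕ (T₂.Q ⊕ T₂.Q)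
  δ
    | .inl q, a => (T₁.δ q a).map .inl
    | .inr (.inl q), a => (T₂.δ q a).map (fun p => .inr (.inl p))
    | .inr (.inr q), a => (T₂.δ q a).map (fun p => .inr (.inr p))
  τ
    | .inl q =>
        if T₁.fin1 q then ([.inr (.inl T₂.start)], [])
        else if T₁.fin2 q then ([.inr (.inr T₂.start)], [])
        else ((T₁.τ q).1.map .inl, (T₁.τ q).2.map .inl)
    | .inr (.inl q) =>
        ((T₂.τ q).1.map (fun p => .inr (.inl p)), (T₂.τ q).2.map (fun p => .inr (.inl p)))
    | .inr (.inr q) =>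
        ((T₂.τ q).1.map (fun p => .inr (.inr p)), (T₂.τ q).2.map (fun p => .inr (.inr p)))
  E
    | .inl q, a, .inl q' => T₁.E q a q'
    | .inr (.inl q), a, .inr (.inl q') => T₂.E q a q'
    | .inr (.inr q), a, .inr (.inr q') => T₂.E q a q'
    | .inl _, _, .inr _ => Asg.nullify k lo hi
    | _, _, _ => Asg.keep k
  start := .inl T₁.start
  fin1
    | .inr (.inl q) => T₂.fin1 q
    | _ => false
  fin2
    | .inl _ => false
    | .inr (.inl q) => T₂.fin2 q
    | .inr (.inr q) => T₂.fin1 q || T₂.fin2 q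
  δ_nodup := by
    rintro (q | q | q) a
    · exact (T₁.δ_nodup q a).map Sum.inl_injective
    · exact (T₂.δ_nodup q a).map (fun x y h => by simpa using h)
    · exact (T₂.δ_nodup q a).map (fun x y h => by simpa using h)
  τ_nodup := by
    rintro (q | q | q)
    · dsimp only
      split_ifs
      · simp
      · simp
      · exact nodup_map_append Sum.inl_injective (T₁.τ_nodup q)
    · exact nodup_map_append (fun x y h => by simpa using h) (T₂.τ_nodup q)
    · exact nodup_map_append (fun x y h => by simpa using h) (T₂.τ_nodup q)

/-- A fresh initial state with an `ε`-transition to the old one. -/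
def initCore (T : PSST k) : PSST k where
  Q := Option T.Q
  δ
    | none, _ => []
    | some q, a => (T.δ q a).map some
  τ
    | none => ([some T.start], [])
    | some q => ((T.τ q).1.map some, (T.τ q).2.map some)
  E
    | some q, a, some q' => T.E q a q'
    | _, _, _ => Asg.keep k
  start := none
  fin1
    | none => false
    | some q => T.fin1 q
  fin2
    | none => false
    | some q => T.fin2 q
  δ_nodup := by
    rintro (_ | q) a
    · simp
    · exact (T.δ_nodup q a).map (Option.some_injective _)
  τ_nodup := by
    rintro (_ | q)
    · simp
    · exact nodup_map_append (Option.some_injective _) (T.τ_nodup q)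

/-- Optional: a fresh initial state `inr false` with `ε`-transitions to `T` and to the fresh
final state `inr true`. The final states of `T` for the empty word are no longer final. -/
def optCore (g : Bool) (T : PSST k) : PSST k where
  Q := T.Q ⊕ Bool
  δ
    | .inl q, a => (T.δ q a).map .inl
    | .inr _, _ => []
  τ
    | .inl q => ((T.τ q).1.map .inl, (T.τ q).2.map .inl)
    | .inr false => (order g (.inl T.start) (.inr true), [])
    | .inr true => ([], [])
  E
    | .inl q, a, .inl q' => T.E q a q'
    | _, _, _ => Asg.keep k
  start := .inr false
  fin1
    | .inl _ => false
    | .inr b => b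
  fin2
    | .inl q => T.fin2 q
    | .inr _ => false
  δ_nodup := by
    rintro (q | q) a
    · exact (T.δ_nodup q a).map Sum.inl_injective
    · simp
  τ_nodup := by
    rintro (q | (_ | _))
    · exact nodup_map_append Sum.inl_injective (T.τ_nodup q)
    · simpa using order_nodup g (by simp)
    · simp

/-- Kleene star: a fresh initial state `inr 0` and fresh final states `inr 1` (no iteration) and
`inr 2` (at least one iteration, the last one having read a nonempty word). The variables of
`T`, which are those in `[lo, hi)`, are set to `null` when a further iteration starts. -/
def starCore (g : Bool) (T : PSST k) (lo hi : ℕ) : PSST k where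
  Q := T.Q ⊕ Fin 3
  δ
    | .inl q, a => (T.δ q a).map .inl
    | .inr _, _ => []
  τ
    | .inl q =>
        if T.fin1 q then ([.inl T.start], [])
        else if T.fin2 q then (order g (.inl T.start) (.inr 2), [])
        else ((T.τ q).1.map .inl, (T.τ q).2.map .inl)
    | .inr i => if i = 0 then (order g (.inl T.start) (.inr 1), []) else ([], [])
  E
    | .inl q, a, .inl q' =>
        if T.fin1 q || T.fin2 q then Asg.nullify k lo hi else T.E q a q'
    | _, _, _ => Asg.keep k
  start := .inr 0
  fin1
    | .inl _ => false
    | .inr i => decide (i = 1)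
  fin2
    | .inl _ => false
    | .inr i => decide (i = 2)
  δ_nodup := by
    rintro (q | q) a
    · exact (T.δ_nodup q a).map Sum.inl_injective
    · simp
  τ_nodup := by
    rintro (q | i)
    · dsimp only
      split_ifs
      · simp
      · simpa using order_nodup g (by simp)
      · exact nodup_map_append Sum.inl_injective (T.τ_nodup q)
    · dsimp only
      split_ifs
      · simpa using order_nodup g (by simp)
      · simp

/-- The concatenation of `n + 1` copies of `T`. -/
def pow (T : PSST k) (lo hi : ℕ) : ℕ → PSST k
  | 0 => T
  | n + 1 => concat (T.pow lo hi n) T lo hi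

/-- At most `n + 1` iterations of `T`, each reading a nonempty word. There are `n + 1` copies of
`T`, and two fresh final states, `inr false` for no iteration (reached from the initial state of
the first copy) and `inr true` for at least one iteration. The variables of `T`, which are those
in `[lo, hi)`, are set to `null` when a further iteration starts. -/
def upTo (g : Bool) (T : PSST k) (lo hi n : ℕ) : PSST k where
  Q := (Fin (n + 1) × T.Q) ⊕ Bool
  δ
    | .inl (i, q), a => (T.δ q a).map (fun p => .inl (i, p))
    | .inr _, _ => []
  τ
    | .inl (i, q) =>
        if T.fin2 q then
          (if h : i.1 + 1 < n + 1 then order g (.inl (⟨i.1 + 1, h⟩, T.start)) (.inr true)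
            else [.inr true], [])
        else if i = 0 ∧ q = T.start then
          (if g then ((T.τ q).1.map (fun p => .inl (i, p)),
              (T.τ q).2.map (fun p => .inl (i, p)) ++ [.inr false])
            else (.inr false :: (T.τ q).1.map (fun p => .inl (i, p)),
              (T.τ q).2.map (fun p => .inl (i, p))))
        else ((T.τ q).1.map (fun p => .inl (i, p)), (T.τ q).2.map (fun p => .inl (i, p)))
    | .inr _ => ([], [])
  E
    | .inl (i, q), a, .inl (j, q') => if i = j then T.E q a q' else Asg.nullify k lo hi
    | _, _, _ => Asg.keep k
  start := .inl (0, T.start)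
  fin1
    | .inl _ => false
    | .inr b => !b
  fin2
    | .inl _ => false
    | .inr b => b
  δ_nodup := by
    rintro (⟨i, q⟩ | q) a
    · exact (T.δ_nodup q a).map (fun x y h => by simpa using h)
    · simp
  τ_nodup := by
    rintro (⟨i, q⟩ | q)
    · have hm : ((T.τ q).1.map (fun p => (Sum.inl (i, p) : (Fin (n + 1) × T.Q) ⊕ Bool)) ++
          (T.τ q).2.map (fun p => Sum.inl (i, p))).Nodup :=
        nodup_map_append (fun x y h => by simpa using h) (T.τ_nodup q)
      dsimp only
      split_ifs
      · simpa using order_nodup g (by simp)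
      · simp
      · rw [← List.append_assoc]
        exact hm.append (by simp) (by simp)
      · rw [List.cons_append]
        exact List.nodup_cons.2 ⟨by simp, hm⟩
      · exact hm
    · simp

/-- Between `m` and `m + d` iterations of `T`, the first `m` of which may read the empty word. -/
def repCore (g : Bool) (T : PSST k) (lo hi : ℕ) : ℕ → ℕ → PSST k
  | 0, 0 => epsCore k
  | 0, d + 1 => upTo g T lo hi d
  | m + 1, 0 => T.pow lo hi m
  | m + 1, d + 1 => concat (T.pow lo hi m) (upTo g T lo hi d) lo hi

end PSST

open PSST in
/-- The transducer of the expression `e` numbered `n`. -/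
def Regex.toPSST {k : ℕ} : Regex k → ℕ → PSST k
  | .empty, n => (emptyCore k).track n
  | .eps, n => (epsCore k).track n
  | .letter a, n => (letterCore a).track n
  | .group e, n => (e.toPSST (n + 1)).copyVar n
  | .alt e₁ e₂, n =>
      (altCore (e₁.toPSST (n + 1)) (e₂.toPSST (n + 1 + e₁.size))).track n
  | .seq e₁ e₂, n =>
      (initCore (concat (e₁.toPSST (n + 1)) (e₂.toPSST (n + 1 + e₁.size))
        (n + 1 + e₁.size) (n + 1 + e₁.size + e₂.size))).track n
  | .opt g e, n => (optCore g (e.toPSST (n + 1))).track n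
  | .star g e, n => (starCore g (e.toPSST (n + 1)) (n + 1) (n + 1 + e.size)).track n
  | .plus g e, n =>
      (initCore (concat (e.toPSST (n + 1))
        (starCore g (e.toPSST (n + 1)) (n + 1) (n + 1 + e.size))
        (n + 1) (n + 1 + e.size))).track n
  | .rep g m d e, n =>
      (initCore (repCore g (e.toPSST (n + 1)) (n + 1) (n + 1 + e.size) m d)).track n

/-! ## Semantics -/

variable {k : ℕ}

/-- A value that contains the symbol `null` is undefined. -/
def Val.toWord : Val k → Option (List (Fin k))
  | [] => some []
  | none :: _ => none
  | some a :: l => (Val.toWord l).map (a :: ·)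

/-- The successful match of `e` to the whole word `w`, which is determined by the accepting run
of the transducer of `e`. The captures `c` are `c 0 = w`, and `c i` for `i > 0` is the match of
the `i`-th capturing group (`none` if this group is not matched or if there is no such group).
The initial value of all variables is `null`. -/
def Regex.Matches (e : Regex k) (w : List (Fin k)) (c : ℕ → Option (List (Fin k))) : Prop :=
  ∃ r, (e.toPSST 0).Accepting w r ∧ c 0 = some w ∧
    ∀ i, c (i + 1) = (e.groups 0)[i]?.bind (fun x =>
      Val.toWord ((e.toPSST 0).eval (fun _ => [none]) (e.toPSST 0).start r x))

/-- The expression `[[⋯[a₁ + a₂] + ⋯] + aₖ]` for the whole alphabet. -/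
def Regex.any (k : ℕ) : Regex k :=
  match List.finRange k with
  | [] => .empty
  | a :: l => l.foldl (fun e b => .alt e (.letter b)) (.letter a)

/-- The expression `[[([Σ*?]) · (pat)] · [Σ*]]`. -/
def Regex.search (pat : Regex k) : Regex k :=
  .seq (.seq (.group (.star false (Regex.any k))) (.group pat)) (.star true (Regex.any k))

/-- The first match of `pat` in `x` is `v`, with captures `c`, and `x = pre ++ v ++ post`. -/
def Regex.FirstMatch (pat : Regex k) (x pre v post : List (Fin k))
    (c : ℕ → Option (List (Fin k))) : Prop :=
  ∃ d, pat.search.Matches x d ∧ d 1 = some pre ∧ d 2 = some v ∧ x = pre ++ v ++ post ∧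
    c = fun i => d (i + 2)

/-- No infix of `x` matches `pat`. -/
def Regex.NoMatch (pat : Regex k) (x : List (Fin k)) : Prop :=
  ¬ ∃ pre v post c, pat.FirstMatch x pre v post c

/-- The word denoted by a replacement symbol, for a match with captures `c` between the words
`pre` and `post`. References to unmatched groups contribute nothing. -/
def RepSym.value (c : ℕ → Option (List (Fin k))) (pre post : List (Fin k)) :
    RepSym k → List (Fin k)
  | .letter a => [a]
  | .ref i => (c i).getD []
  | .before => pre
  | .after => post

/-- The instance of a replacement string. -/
def instRep (rep : List (RepSym k)) (c : ℕ → Option (List (Fin k))) (pre post : List (Fin k)) :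
    List (Fin k) :=
  rep.flatMap (RepSym.value c pre post)

/-- The graph of `extract`: `y` is the match of the `i`-th capturing group in the match of `e`
to `x`. -/
def Extract (i : ℕ) (e : Regex k) (x y : List (Fin k)) : Prop :=
  ∃ c, e.Matches x c ∧ c i = some y

/-- The graph of `replace`: the first match is replaced, if there is one. -/
def Replace (pat : Regex k) (rep : List (RepSym k)) (x y : List (Fin k)) : Prop :=
  (∃ pre v post c, pat.FirstMatch x pre v post c ∧ y = pre ++ instRep rep c pre post ++ post) ∨
    (pat.NoMatch x ∧ y = x)

/-- `ReplaceFrom pat rep u x y`: replacing all matches in the suffix `x` of the input `u ++ x`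
turns this suffix into `y`. The search is continued behind the first match; after an empty match,
it is continued behind the next letter, which is copied. -/
inductive ReplaceFrom (pat : Regex k) (rep : List (RepSym k)) :
    List (Fin k) → List (Fin k) → List (Fin k) → Prop
  | done (u x : List (Fin k)) : pat.NoMatch x → ReplaceFrom pat rep u x x
  | nonempty (u x pre v post y : List (Fin k)) (c : ℕ → Option (List (Fin k))) :
      pat.FirstMatch x pre v post c → v ≠ [] → ReplaceFrom pat rep (u ++ pre ++ v) post y →
      ReplaceFrom pat rep u x (pre ++ instRep rep c (u ++ pre) post ++ y)
  | empty (u x pre post y : List (Fin k)) (a : Fin k) (c : ℕ → Option (List (Fin k))) :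
      pat.FirstMatch x pre [] (a :: post) c → ReplaceFrom pat rep (u ++ pre ++ [a]) post y →
      ReplaceFrom pat rep u x (pre ++ instRep rep c (u ++ pre) (a :: post) ++ a :: y)
  | emptyEnd (u x pre : List (Fin k)) (c : ℕ → Option (List (Fin k))) :
      pat.FirstMatch x pre [] [] c →
      ReplaceFrom pat rep u x (pre ++ instRep rep c (u ++ pre) [])

/-- The graph of `replaceAll`. -/
def ReplaceAll (pat : Regex k) (rep : List (RepSym k)) (x y : List (Fin k)) : Prop :=
  ReplaceFrom pat rep [] x y

/-- `t.Eval σ w`: the term `t` has a defined value under the assignment `σ`, namely `w`. -/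
def Term.Eval (σ : ℕ → List (Fin k)) : Term k → List (Fin k) → Prop
  | .var y, w => w = σ y
  | .concat y z, w => w = σ y ++ σ z
  | .extract i e y, w => Extract i e (σ y) w
  | .replace pat rep y, w => Replace pat rep (σ y) w
  | .replaceAll pat rep y, w => ReplaceAll pat rep (σ y) w

/-- The assignment `σ` satisfies the formula. -/
def Formula.Holds (σ : ℕ → List (Fin k)) : Formula k → Prop
  | .eqn x t => t.Eval σ (σ x)
  | .mem x e => σ x ∈ e.lang
  | .and φ ψ => φ.Holds σ ∧ ψ.Holds σ
  | .or φ ψ => φ.Holds σ ∨ ψ.Holds σ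
  | .not φ => ¬ φ.Holds σ

def Formula.Satisfiable (φ : Formula k) : Prop := ∃ σ : ℕ → List (Fin k), φ.Holds σ

/-! ## The straight-line fragment -/

/-- The variables that occur in a term. -/
def Term.vars : Term k → List ℕ
  | .var y => [y]
  | .concat y z => [y, z]
  | .extract _ _ y => [y]
  | .replace _ _ y => [y]
  | .replaceAll _ _ y => [y]

/-- The formula contains neither negation nor disjunction. -/
def Formula.Conjunctive : Formula k → Prop
  | .eqn _ _ => True
  | .mem _ _ => True
  | .and φ ψ => φ.Conjunctive ∧ ψ.Conjunctive
  | .or _ _ => False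
  | .not _ => False

/-- The equations that occur in a formula. -/
def Formula.eqns : Formula k → List (ℕ × Term k)
  | .eqn x t => [(x, t)]
  | .mem _ _ => []
  | .and φ ψ => φ.eqns ++ ψ.eqns
  | .or φ ψ => φ.eqns ++ ψ.eqns
  | .not φ => φ.eqns

/-- Straight-line formulas: there are neither negations nor disjunctions, and the equations can
be ordered into a sequence `x₁ = t₁, …, xₙ = tₙ` such that the variables `xᵢ` are mutually
distinct and `xᵢ` does not occur in `t₁, …, tᵢ`. -/
def Formula.StraightLine (φ : Formula k) : Prop :=
  φ.Conjunctive ∧ ∃ l : List (ℕ × Term k), (∀ p, p ∈ l ↔ p ∈ φ.eqns) ∧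
    l.Pairwise (fun p q => p.1 ≠ q.1 ∧ q.1 ∉ p.2.vars) ∧ ∀ p ∈ l, p.1 ∉ p.2.vars

/-! ## Formulas as inputs of algorithms

Formulas are written in prefix notation, as a sequence of symbols. A symbol is a list of
numbers, namely a number for its kind followed by its parameters. -/

def Regex.code : Regex k → List (List ℕ)
  | .empty => [[0]]
  | .eps => [[1]]
  | .letter a => [[2, a.val]]
  | .group e => [3] :: e.code
  | .alt e₁ e₂ => [4] :: (e₁.code ++ e₂.code)
  | .seq e₁ e₂ => [5] :: (e₁.code ++ e₂.code)
  | .opt g e => [6, g.toNat] :: e.code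
  | .star g e => [7, g.toNat] :: e.code
  | .plus g e => [8, g.toNat] :: e.code
  | .rep g m d e => [9, g.toNat, m, m + d] :: e.code

def RepSym.code : RepSym k → List ℕ
  | .letter a => [10, a.val]
  | .ref i => [11, i]
  | .before => [12]
  | .after => [13]

/-- The code of a replacement string, with an end marker. -/
def repCode (rep : List (RepSym k)) : List (List ℕ) := rep.map RepSym.code ++ [[14]]

def Formula.code : Formula k → List (List ℕ)
  | .eqn x (.var y) => [[15, x, y]]
  | .eqn x (.concat y z) => [[16, x, y, z]]
  | .eqn x (.extract i e y) => [17, x, i, y] :: e.code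
  | .eqn x (.replace pat rep y) => [18, x, y] :: (repCode rep ++ pat.code)
  | .eqn x (.replaceAll pat rep y) => [19, x, y] :: (repCode rep ++ pat.code)
  | .mem x e => [20, x] :: e.code
  | .and φ ψ => [21] :: (φ.code ++ ψ.code)
  | .or φ ψ => [22] :: (φ.code ++ ψ.code)
  | .not φ => [23] :: φ.code

lemma toNat_bool_inj {a b : Bool} (h : a.toNat = b.toNat) : a = b := by
  cases a <;> cases b <;> simp_all

/-- The code is a prefix code: formulas are determined by their codes. -/
lemma Regex.code_append_inj (e e' : Regex k) (s s' : List (List ℕ))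
    (h : e.code ++ s = e'.code ++ s') : e = e' ∧ s = s' := by
  induction e generalizing e' s s' with
  | empty => cases e' <;> simp_all [Regex.code]
  | eps => cases e' <;> simp_all [Regex.code]
  | letter a => cases e' <;> simp_all [Regex.code, Fin.ext_iff]
  | group e ih =>
    cases e' <;> simp [Regex.code] at h
    simpa using ih _ _ _ h
  | alt e₁ e₂ ih₁ ih₂ =>
    cases e' <;> simp [Regex.code] at h
    obtain ⟨h₁, h₂⟩ := ih₁ _ _ _ h
    simpa [h₁] using ih₂ _ _ _ h₂
  | seq e₁ e₂ ih₁ ih₂ =>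
    cases e' <;> simp [Regex.code] at h
    obtain ⟨h₁, h₂⟩ := ih₁ _ _ _ h
    simpa [h₁] using ih₂ _ _ _ h₂
  | opt g e ih =>
    cases e' <;> simp [Regex.code] at h
    have hg := toNat_bool_inj h.1
    simpa [hg] using ih _ _ _ h.2
  | star g e ih =>
    cases e' <;> simp [Regex.code] at h
    have hg := toNat_bool_inj h.1
    simpa [hg] using ih _ _ _ h.2
  | plus g e ih =>
    cases e' <;> simp [Regex.code] at h
    have hg := toNat_bool_inj h.1
    simpa [hg] using ih _ _ _ h.2
  | rep g m d e ih =>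
    cases e' <;> simp [Regex.code] at h
    have hg := toNat_bool_inj h.1.1
    obtain ⟨⟨_, hm, hd⟩, h⟩ := h
    subst hm
    have hd := Nat.add_left_cancel hd
    simpa [hg, hd] using ih _ _ _ h

lemma repCode_append_inj (r r' : List (RepSym k)) (s s' : List (List ℕ))
    (h : repCode r ++ s = repCode r' ++ s') : r = r' ∧ s = s' := by
  induction r generalizing r' with
  | nil =>
    rcases r' with _ | ⟨c, r'⟩
    · simpa [repCode] using h
    · cases c <;> simp [repCode, RepSym.code] at h
  | cons c r ih =>
    rcases r' with _ | ⟨c', r'⟩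
    · cases c <;> simp [repCode, RepSym.code] at h
    · simp only [repCode, List.map_cons, List.cons_append, List.cons.injEq] at h
      obtain ⟨h₁, h₂⟩ := ih r' h.2
      have hc : c = c' := by
        cases c <;> cases c' <;> simp_all [RepSym.code, Fin.ext_iff]
      exact ⟨by rw [hc, h₁], h₂⟩

lemma Formula.code_append_inj (φ φ' : Formula k) (s s' : List (List ℕ))
    (h : φ.code ++ s = φ'.code ++ s') : φ = φ' ∧ s = s' := by
  induction φ generalizing φ' s s' with
  | eqn x t =>
    rcases φ' with ⟨x', t'⟩ | _ | _ | _ | _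
    · cases t <;> cases t' <;> simp [Formula.code] at h
      · simp [h]
      · simp [h]
      · obtain ⟨⟨rfl, rfl, rfl⟩, h⟩ := h
        simpa using Regex.code_append_inj _ _ _ _ h
      · obtain ⟨⟨rfl, rfl⟩, h⟩ := h
        obtain ⟨h₁, h₂⟩ := repCode_append_inj _ _ _ _ h
        simpa [h₁] using Regex.code_append_inj _ _ _ _ h₂
      · obtain ⟨⟨rfl, rfl⟩, h⟩ := h
        obtain ⟨h₁, h₂⟩ := repCode_append_inj _ _ _ _ h
        simpa [h₁] using Regex.code_append_inj _ _ _ _ h₂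
    all_goals cases t <;> simp [Formula.code] at h
  | mem x e =>
    rcases φ' with ⟨x', (_ | _ | _ | _ | _)⟩ | _ | _ | _ | _ <;> simp [Formula.code] at h
    obtain ⟨rfl, h⟩ := h
    simpa using Regex.code_append_inj _ _ _ _ h
  | and φ ψ ih₁ ih₂ =>
    rcases φ' with ⟨x', (_ | _ | _ | _ | _)⟩ | _ | _ | _ | _ <;> simp [Formula.code] at h
    obtain ⟨h₁, h₂⟩ := ih₁ _ _ _ h
    simpa [h₁] using ih₂ _ _ _ h₂
  | or φ ψ ih₁ ih₂ =>
    rcases φ' with ⟨x', (_ | _ | _ | _ | _)⟩ | _ | _ | _ | _ <;> simp [Formula.code] at h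
    obtain ⟨h₁, h₂⟩ := ih₁ _ _ _ h
    simpa [h₁] using ih₂ _ _ _ h₂
  | not φ ih =>
    rcases φ' with ⟨x', (_ | _ | _ | _ | _)⟩ | _ | _ | _ | _ <;> simp [Formula.code] at h
    simpa using ih _ _ _ h

lemma Formula.code_injective : Function.Injective (Formula.code : Formula k → List (List ℕ)) :=
  fun φ ψ h => (Formula.code_append_inj φ ψ [] [] (by simpa using h)).1

end StrSL

/-! The proof is a small-model argument. Regular information about words is given by a congruence of
finite index (`Recog`). Every right-hand side `t` has regular preimages in a uniform, quantitative
sense (`Term.Bounded`): for each congruence on the results there is a congruence on the arguments,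
of explicitly bounded index, such that the classes of the arguments determine the class of the
result and whether it is defined. Starting with a congruence that recognizes all membership
constraints, one goes backwards through the ordered equations (`exec_bounded`) and obtains a single
congruence for the initial values. Each initial word may then be replaced by a congruent word
shorter than the index (`Recog.exists_short`), and executing the equations forwards still satisfies
all constraints. So a bounded search decides satisfiability (`exists_solution_iff`).

For `extract` and the replacements, the accepting run is the head of a list of accepting runs sorted
by priority (`PSST.accepting_iff`). The profile of a word `w` records, for every state `q`, the
effect of the best accepting run from `q` on `w` upon the classes of the values of the variables.
The best run on `a :: w` begins with the first of the sorted `ε`-sequences followed by `a` whose end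
state admits an accepting run on `w`; hence the profile of `w` determines that of `a :: w`
(`PSST.first_cons_congr`), and this left compatibility yields a congruence (`hasInd_of_left`).

For `replaceAll` the text behind the first match is processed again. The profile therefore also
carries information on this text, which includes the result of replacing all matches in it, as a
relation between the class of the preceding text and the class of the output. Both kinds of
information are computed together by one recursion on the word (`Regex.restInfo_cons_congr`).

For computability, all of this is mirrored on codes by primitive recursive functions: expressions
are evaluated on a stack, transducers become finite tables, runs are found by a search in the order
of priority, formulas are parsed, and the bounds are calculated. Each function is proved to agree
with its semantic counterpart, and `decideFormula_iff` puts them together. -/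

namespace StrSL

/-! ### Runs of transducers, listed by priority -/

namespace PSST

variable {k : ℕ}

/-- The transitions out of `q`, ordered by priority. -/
def moves (T : PSST k) (q : T.Q) : List (Option (Fin k) × T.Q) :=
  (T.τ q).1.map (fun p => (none, p)) ++
    ((List.finRange k).flatMap (fun a => (T.δ q a).map (fun p => (some a, p))) ++
      (T.τ q).2.map (fun p => (none, p)))

lemma mem_moves {T : PSST k} {q : T.Q} {a : Option (Fin k)} {q' : T.Q} :
    (a, q') ∈ T.moves q ↔ T.Edge q a q' := by
  cases a <;> simp [moves, Edge]

/-- `q` is a final state. -/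
def fin (T : PSST k) (q : T.Q) : Bool := T.fin1 q || T.fin2 q

/-- Transitions reading different letters are incomparable, so the order is asserted only among
`ε`-transitions and those with one fixed label `a`. Runs on the same word never differ by two
different letters, so this is enough. -/
lemma pairwise_moves (T : PSST k) (q : T.Q) (a : Option (Fin k)) :
    (T.moves q).Pairwise (fun t t' => (t.1 = none ∨ t.1 = a) → (t'.1 = none ∨ t'.1 = a) →
      T.Prior q t t') := by
  have key : ∀ l : List T.Q, l.Nodup → l.Pairwise (fun x y => x ≠ y ∧ [x, y].Sublist l) :=
    fun l hl => List.pairwise_iff_forall_sublist.2 fun h =>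
      ⟨List.pairwise_iff_forall_sublist.1 hl h, h⟩
  have hn := List.nodup_append.1 (T.τ_nodup q)
  have hdis : ∀ x ∈ (T.τ q).1, ∀ y ∈ (T.τ q).2, x ≠ y := hn.2.2
  rw [moves, List.pairwise_append, List.pairwise_append]
  refine ⟨?_, ⟨?_, ?_, ?_⟩, ?_⟩
  · rw [List.pairwise_map]
    exact (key _ hn.1).imp fun {x y} h _ _ => ⟨h.1, Or.inl h.2⟩
  · rw [List.pairwise_flatMap]
    refine ⟨fun b _ => ?_, ?_⟩
    · rw [List.pairwise_map]
      exact (key _ (T.δ_nodup q b)).imp fun {x y} h _ _ => ⟨rfl, h⟩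
    · refine (List.nodup_finRange k).imp fun {b c} hbc x hx y hy h1 h2 => ?_
      obtain ⟨x', _, rfl⟩ := List.mem_map.1 hx
      obtain ⟨y', _, rfl⟩ := List.mem_map.1 hy
      simp only [reduceCtorEq, false_or] at h1 h2
      exact absurd (Option.some.inj (h1.trans h2.symm)) hbc
  · rw [List.pairwise_map]
    exact (key _ hn.2.1).imp fun {x y} h _ _ => ⟨h.1, Or.inr (Or.inl h.2)⟩
  · intro x hx y hy _ _
    obtain ⟨b, _, hx⟩ := List.mem_flatMap.1 hx
    obtain ⟨x', hx', rfl⟩ := List.mem_map.1 hx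
    obtain ⟨y', hy', rfl⟩ := List.mem_map.1 hy
    exact ⟨hx', hy'⟩
  · intro x hx y hy _ _
    obtain ⟨x', hx', rfl⟩ := List.mem_map.1 hx
    rcases List.mem_append.1 hy with hy | hy
    · obtain ⟨b, _, hy⟩ := List.mem_flatMap.1 hy
      obtain ⟨y', hy', rfl⟩ := List.mem_map.1 hy
      exact ⟨hx', hy'⟩
    · obtain ⟨y', hy', rfl⟩ := List.mem_map.1 hy
      exact ⟨hdis _ hx' _ hy', Or.inr (Or.inr ⟨hx', hy'⟩)⟩

/-- The number of pairs of states that are not in the list. -/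
noncomputable def unused (T : PSST k) (used : List (T.Q × T.Q)) : ℕ :=
  letI := Fintype.ofFinite T.Q
  (Finset.univ \ used.toFinset).card

/-- The termination measure of `eps`: without repetitions, an `ε`-sequence has to stop when all
pairs of states are used. -/
lemma unused_cons_lt (T : PSST k) {used : List (T.Q × T.Q)} {p : T.Q × T.Q} (h : p ∉ used) :
    T.unused (p :: used) < T.unused used := by
  let _ := Fintype.ofFinite T.Q
  apply Finset.card_lt_card
  refine ⟨fun x hx => ?_, fun hs => ?_⟩
  · simp at hx ⊢; exact hx.2
  · have := hs (show p ∈ Finset.univ \ used.toFinset by simpa using h)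
    simp at this

lemma unused_le (T : PSST k) (used : List (T.Q × T.Q)) : T.unused used ≤ Nat.card T.Q ^ 2 := by
  let _ := Fintype.ofFinite T.Q
  refine (Finset.card_le_univ _).trans ?_
  simp [Nat.card_eq_fintype_card, sq]

/-- The sequences of `ε`-transitions from `q` that avoid the pairs in `used` and do not repeat a
transition, and that are followed by a transition reading the letter `a`, or end in a final state
if `a = none`, ordered by priority. -/
noncomputable def eps (T : PSST k) (a : Option (Fin k)) (q : T.Q) (used : List (T.Q × T.Q)) :
    List (List (Option (Fin k) × T.Q)) :=
  (T.moves q).flatMap (fun t =>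
    if t.1 = none then
      if _h : (q, t.2) ∈ used then [] else (eps T a t.2 ((q, t.2) :: used)).map (t :: ·)
    else if t.1 = a then [[t]] else []) ++
  -- A run has higher priority than its proper prefixes, so stopping here is the last option.
  if a = none ∧ T.fin q = true then [[]] else []
termination_by T.unused used
decreasing_by exact T.unused_cons_lt _h

/-- The accepting runs from `q` on a word, ordered by priority. -/
noncomputable def accs (T : PSST k) : T.Q → List (Fin k) → List (List (Option (Fin k) × T.Q))
  | q, [] => T.eps none q []
  | q, a :: w => (T.eps (some a) q []).flatMap (fun f => (T.accs (T.last q f) w).map (f ++ ·))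

/-- Paths from `q` that read `w` and repeat no `ε`-transition between two letters, where those in
`used` must not be taken before the first letter. -/
def RunFrom (T : PSST k) : T.Q → List (T.Q × T.Q) → List (Fin k) →
    List (Option (Fin k) × T.Q) → Prop
  | _, _, w, [] => w = []
  | q, used, w, (none, q') :: r =>
      T.Edge q none q' ∧ (q, q') ∉ used ∧ T.RunFrom q' ((q, q') :: used) w r
  | q, _, w, (some a, q') :: r =>
      T.Edge q (some a) q' ∧ ∃ w', w = a :: w' ∧ T.RunFrom q' [] w' r

lemma eps_induction {T : PSST k} {P : T.Q → List (T.Q × T.Q) → Prop}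
    (h : ∀ q used, (∀ q', (q, q') ∉ used → P q' ((q, q') :: used)) → P q used) (q : T.Q)
    (used : List (T.Q × T.Q)) : P q used := by
  induction hn : T.unused used using Nat.strong_induction_on generalizing q used with
  | _ n ih =>
    subst hn
    exact h q used fun q' hq => ih _ (T.unused_cons_lt hq) _ _ rfl

lemma mem_eps {T : PSST k} {a : Option (Fin k)} {q : T.Q} {used : List (T.Q × T.Q)}
    {r : List (Option (Fin k) × T.Q)} : r ∈ T.eps a q used ↔
      (∃ q' s, r = (none, q') :: s ∧ T.Edge q none q' ∧ (q, q') ∉ used ∧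
        s ∈ T.eps a q' ((q, q') :: used)) ∨
      (∃ b q', a = some b ∧ r = [(some b, q')] ∧ T.Edge q (some b) q') ∨
      (r = [] ∧ a = none ∧ T.fin q = true) := by
  rw [eps, List.mem_append, List.mem_flatMap, or_assoc.symm]
  refine or_congr ⟨?_, ?_⟩ ?_
  · rintro ⟨⟨b, q'⟩, hm, hr⟩
    rw [mem_moves] at hm
    split_ifs at hr with h1 h2 h3
    · simp at hr
    · obtain ⟨s, hs, rfl⟩ := List.mem_map.1 hr
      simp only at h1; subst h1
      exact Or.inl ⟨q', s, rfl, hm, h2, hs⟩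
    · simp only at h1 h3; subst h3
      obtain ⟨c, rfl⟩ := Option.ne_none_iff_exists'.1 h1
      exact Or.inr ⟨c, q', rfl, by simpa using hr, hm⟩
    · simp at hr
  · rintro (⟨q', s, rfl, hm, hu, hs⟩ | ⟨b, q', rfl, rfl, hm⟩)
    · exact ⟨(none, q'), mem_moves.2 hm, by simp [hu, hs]⟩
    · exact ⟨(some b, q'), mem_moves.2 hm, by simp⟩
  · split_ifs with h
    · simp [h]
    · simp only [List.not_mem_nil, false_iff]
      exact fun h' => h h'.2

lemma mem_eps_none {T : PSST k} {r : List (Option (Fin k) × T.Q)} {q : T.Q}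
    {used : List (T.Q × T.Q)} :
    r ∈ T.eps none q used ↔ T.RunFrom q used [] r ∧ T.fin (T.last q r) = true := by
  induction r generalizing q used with
  | nil => rw [mem_eps]; simp [RunFrom, last]
  | cons t r ih =>
    obtain ⟨a, q'⟩ := t
    rw [mem_eps]
    cases a <;> simp [RunFrom, last, ih, and_assoc]

/-- A run is cut behind its first letter transition; there the list of used `ε`-transitions becomes
empty again. -/
lemma runFrom_cons_iff {T : PSST k} {r : List (Option (Fin k) × T.Q)} {q : T.Q}
    {used : List (T.Q × T.Q)} {a : Fin k} {w : List (Fin k)} :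
    T.RunFrom q used (a :: w) r ↔ ∃ f ∈ T.eps (some a) q used, ∃ r', r = f ++ r' ∧
      T.RunFrom (T.last q f) [] w r' := by
  induction r generalizing q used with
  | nil =>
    simp only [RunFrom, reduceCtorEq, false_iff]
    rintro ⟨f, hf, r', hr, -⟩
    obtain rfl : f = [] := by simpa using (List.append_eq_nil_iff.1 hr.symm).1
    rw [mem_eps] at hf; simp at hf
  | cons t r ih =>
    obtain ⟨b, q'⟩ := t
    cases b with
    | none =>
      simp only [RunFrom, ih]
      constructor
      · rintro ⟨he, hu, f, hf, r', rfl, hr'⟩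
        exact ⟨(none, q') :: f, mem_eps.2 (Or.inl ⟨q', f, rfl, he, hu, hf⟩), r', rfl, hr'⟩
      · rintro ⟨f, hf, r', hr, hr'⟩
        rcases mem_eps.1 hf with ⟨q₁, s, rfl, he, hu, hs⟩ | ⟨b, q₁, hb, rfl, he⟩ | ⟨_, h, _⟩
        · simp only [List.cons_append, List.cons.injEq, Prod.mk.injEq, true_and] at hr
          obtain ⟨rfl, rfl⟩ := hr
          exact ⟨he, hu, s, hs, r', rfl, hr'⟩
        · simp at hr
        · simp at h
    | some b =>
      simp only [RunFrom]
      constructor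
      · rintro ⟨he, w', h, hr⟩
        obtain ⟨rfl, rfl⟩ := List.cons.inj h
        exact ⟨[(some a, q')], mem_eps.2 (Or.inr (Or.inl ⟨a, q', rfl, rfl, he⟩)), r, rfl, hr⟩
      · rintro ⟨f, hf, r', hr, hr'⟩
        rcases mem_eps.1 hf with ⟨q₁, s, rfl, he, hu, hs⟩ | ⟨c, q₁, hb, rfl, he⟩ | ⟨_, h, _⟩
        · simp at hr
        · simp only [List.cons_append, List.nil_append, List.cons.injEq, Prod.mk.injEq,
            Option.some.injEq] at hr hb
          obtain ⟨⟨rfl, rfl⟩, rfl⟩ := hr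
          exact ⟨he, w, by rw [hb], hr'⟩
        · simp at h

lemma last_append (T : PSST k) (q : T.Q) (r s : List (Option (Fin k) × T.Q)) :
    T.last q (r ++ s) = T.last (T.last q r) s := by
  induction r generalizing q with
  | nil => rfl
  | cons t r ih => exact ih _

lemma mem_accs {T : PSST k} {w : List (Fin k)} {q : T.Q} {r : List (Option (Fin k) × T.Q)} :
    r ∈ T.accs q w ↔ T.RunFrom q [] w r ∧ T.fin (T.last q r) = true := by
  induction w generalizing q r with
  | nil => exact mem_eps_none
  | cons a w ih =>
    simp only [accs, List.mem_flatMap, List.mem_map, runFrom_cons_iff, ih]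
    constructor
    · rintro ⟨f, hf, r', ⟨h1, h2⟩, rfl⟩
      exact ⟨⟨f, hf, r', rfl, h1⟩, by rwa [last_append]⟩
    · rintro ⟨⟨f, hf, r', rfl, h1⟩, h2⟩
      exact ⟨f, hf, r', ⟨h1, by rwa [last_append] at h2⟩, rfl⟩

/-- Links the stepwise condition with the condition on infixes in `IsRun`. For the induction a
clause about `used` is added; it concerns only prefixes without letters, since `used` is forgotten
at the first letter. -/
lemma runFrom_iff {T : PSST k} {w : List (Fin k)} {q : T.Q} {used : List (T.Q × T.Q)}
    {r : List (Option (Fin k) × T.Q)} : T.RunFrom q used w r ↔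
      T.Path q r ∧ r.filterMap Prod.fst = w ∧
        (∀ s, s <:+: T.trans q r → (∀ t ∈ s, t.2.1 = none) → s.Nodup) ∧
        (∀ s, s <+: T.trans q r → (∀ t ∈ s, t.2.1 = none) → ∀ t ∈ s, (t.1, t.2.2) ∉ used) := by
  induction r generalizing q used w with
  | nil => simp [RunFrom, Path, trans, eq_comm]
  | cons t r ih =>
    obtain ⟨a, q'⟩ := t
    cases a with
    | none =>
      simp only [RunFrom, Path, trans, ih, List.filterMap_cons]
      constructor
      · rintro ⟨he, hu, hp, hw, hi, hpre⟩
        have hcons : ∀ s, s <+: T.trans q' r → (∀ t ∈ s, t.2.1 = none) →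
            (q, none, q') ∉ s := fun s hs hn hm => hpre s hs hn _ hm (by simp)
        refine ⟨⟨he, hp⟩, hw, fun s hs hn => ?_, fun s hs hn t ht => ?_⟩
        · rcases List.infix_cons_iff.1 hs with hs | hs
          · rcases s with _ | ⟨x, s⟩
            · simp
            · obtain ⟨rfl, hs₁⟩ := List.cons_prefix_cons.1 hs
              have hn' : ∀ t ∈ s, t.2.1 = none := fun t ht => hn t (by simp [ht])
              exact List.nodup_cons.2 ⟨hcons s hs₁ hn', hi s hs₁.isInfix hn'⟩
          · exact hi s hs hn
        · rcases s with _ | ⟨x, s⟩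
          · simp at ht
          · obtain ⟨rfl, hs₁⟩ := List.cons_prefix_cons.1 hs
            have hn' : ∀ t ∈ s, t.2.1 = none := fun t ht => hn t (by simp [ht])
            rcases List.mem_cons.1 ht with rfl | ht
            · exact hu
            · exact fun h => hpre s hs₁ hn' t ht (by simp [h])
      · rintro ⟨⟨he, hp⟩, hw, hi, hpre⟩
        refine ⟨he, hpre [(q, none, q')] (by simp) (by simp) (q, none, q') (by simp), hp, hw,
          fun s hs hn => hi s (List.infix_cons_iff.2 (Or.inr hs)) hn, fun s hs hn t ht h => ?_⟩
        have hs' : (q, none, q') :: s <+: (q, none, q') :: T.trans q' r :=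
          List.cons_prefix_cons.2 ⟨rfl, hs⟩
        have hn' : ∀ t ∈ (q, (none : Option (Fin k)), q') :: s, t.2.1 = none := by
          intro t ht; rcases List.mem_cons.1 ht with rfl | ht
          · rfl
          · exact hn t ht
        rcases List.mem_cons.1 h with h | h
        · have := (List.nodup_cons.1 (hi _ hs'.isInfix hn')).1
          have ht' := hn t ht
          obtain ⟨t1, t2, t3⟩ := t
          simp only [Prod.mk.injEq] at h ht'
          obtain ⟨rfl, rfl⟩ := h
          subst ht'
          exact this ht
        · exact hpre _ hs' hn' t (by simp [ht]) h
    | some b =>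
      simp only [RunFrom, Path, trans, ih, List.filterMap_cons]
      constructor
      · rintro ⟨he, w', rfl, hp, rfl, hi, hpre⟩
        refine ⟨⟨he, hp⟩, rfl, fun s hs hn => ?_, fun s hs hn t ht => ?_⟩
        · rcases List.infix_cons_iff.1 hs with hs | hs
          · rcases s with _ | ⟨x, s⟩
            · simp
            · obtain ⟨rfl, hs⟩ := List.cons_prefix_cons.1 hs
              simpa using hn _ (List.mem_cons_self)
          · exact hi s hs hn
        · rcases s with _ | ⟨x, s⟩
          · simp at ht
          · obtain ⟨rfl, hs⟩ := List.cons_prefix_cons.1 hs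
            simpa using hn _ (List.mem_cons_self)
      · rintro ⟨⟨he, hp⟩, rfl, hi, hpre⟩
        exact ⟨he, _, rfl, hp, rfl, fun s hs hn => hi s (List.infix_cons_iff.2 (Or.inr hs)) hn,
          by simp⟩

lemma runFrom_start_iff {T : PSST k} {w : List (Fin k)} {r : List (Option (Fin k) × T.Q)} :
    T.RunFrom T.start [] w r ↔ T.IsRun w r := by
  rw [runFrom_iff, IsRun]; simp

/-- At the first difference of two paths from `q`, the first path has higher priority. -/
def Diff (T : PSST k) (q : T.Q) (r r' : List (Option (Fin k) × T.Q)) : Prop :=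
  ∃ p t t' s s', r = p ++ t :: s ∧ r' = p ++ t' :: s' ∧ T.Prior (T.last q p) t t'

lemma Diff.cons {T : PSST k} {q : T.Q} {r r' : List (Option (Fin k) × T.Q)}
    (t : Option (Fin k) × T.Q) (h : T.Diff t.2 r r') : T.Diff q (t :: r) (t :: r') := by
  obtain ⟨p, u, u', s, s', rfl, rfl, h⟩ := h
  exact ⟨t :: p, u, u', s, s', rfl, rfl, h⟩

lemma Diff.append_left {T : PSST k} {q : T.Q} {r r' : List (Option (Fin k) × T.Q)}
    (f : List (Option (Fin k) × T.Q)) (h : T.Diff (T.last q f) r r') :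
    T.Diff q (f ++ r) (f ++ r') := by
  induction f generalizing q with
  | nil => exact h
  | cons t f ih => exact (ih h).cons t

lemma Diff.append_right {T : PSST k} {q : T.Q} {r r' : List (Option (Fin k) × T.Q)}
    (h : T.Diff q r r') (f f' : List (Option (Fin k) × T.Q)) : T.Diff q (r ++ f) (r' ++ f') := by
  obtain ⟨p, u, u', s, s', rfl, rfl, h⟩ := h
  exact ⟨p, u, u', s ++ f, s' ++ f', by simp, by simp, h⟩

/-- Sequences with the same first transition are compared by induction, those with different first
transitions by `pairwise_moves`. The prefix alternative arises only from stopping in a final state,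
which needs `a = none`. -/
lemma pairwise_eps (T : PSST k) (a : Option (Fin k)) (q : T.Q) (used : List (T.Q × T.Q)) :
    (T.eps a q used).Pairwise (fun r r' => T.Diff q r r' ∨ (a = none ∧ r' <+: r ∧ r' ≠ r)) := by
  induction q, used using eps_induction with
  | h q used ih =>
    have hhead : ∀ t : Option (Fin k) × T.Q, ∀ x ∈ (if t.1 = none then
        if _h : (q, t.2) ∈ used then [] else (T.eps a t.2 ((q, t.2) :: used)).map (t :: ·)
        else if t.1 = a then [[t]] else []),
        (t.1 = none ∨ t.1 = a) ∧ ∃ s, x = t :: s := by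
      intro t x hx
      split_ifs at hx with h1 h2 h3
      · simp at hx
      · obtain ⟨s, -, rfl⟩ := List.mem_map.1 hx
        exact ⟨Or.inl h1, s, rfl⟩
      · exact ⟨Or.inr h3, [], by simpa using hx⟩
      · simp at hx
    rw [eps, List.pairwise_append, List.pairwise_flatMap]
    refine ⟨⟨fun t _ => ?_, ?_⟩, ?_, ?_⟩
    · split_ifs with h1 h2 h3
      · simp
      · rw [List.pairwise_map]
        refine (ih _ h2).imp fun {r r'} h => ?_
        rcases h with h | ⟨h, h', h''⟩
        · exact Or.inl (h.cons t)
        · exact Or.inr ⟨h, List.cons_prefix_cons.2 ⟨rfl, h'⟩, by simpa using h''⟩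
      · simp
      · simp
    · refine (T.pairwise_moves q a).imp fun {t t'} h x hx y hy => ?_
      obtain ⟨h1, s, rfl⟩ := hhead _ _ hx
      obtain ⟨h2, s', rfl⟩ := hhead _ _ hy
      exact Or.inl ⟨[], t, t', s, s', rfl, rfl, h h1 h2⟩
    · split_ifs <;> simp
    · intro x hx y hy
      split_ifs at hy with h
      · obtain rfl : y = [] := by simpa using hy
        obtain ⟨t, -, hx⟩ := List.mem_flatMap.1 hx
        obtain ⟨-, s, rfl⟩ := hhead _ _ hx
        exact Or.inr ⟨h.1, List.nil_prefix, by simp⟩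
      · simp at hy

lemma pairwise_accs (T : PSST k) (q : T.Q) (w : List (Fin k)) :
    (T.accs q w).Pairwise (fun r r' => T.Diff q r r' ∨ (r' <+: r ∧ r' ≠ r)) := by
  induction w generalizing q with
  | nil => exact (T.pairwise_eps none q []).imp fun h => h.imp id And.right
  | cons a w ih =>
    rw [accs, List.pairwise_flatMap]
    refine ⟨fun f _ => ?_, ?_⟩
    · rw [List.pairwise_map]
      refine (ih _).imp fun {r r'} h => ?_
      rcases h with h | ⟨h', h''⟩
      · exact Or.inl (h.append_left f)
      · exact Or.inr ⟨(List.prefix_append_right_inj f).2 h', by simpa using h''⟩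
    · refine (T.pairwise_eps (some a) q []).imp fun {f f'} h x hx y hy => ?_
      obtain ⟨s, -, rfl⟩ := List.mem_map.1 hx
      obtain ⟨s', -, rfl⟩ := List.mem_map.1 hy
      rcases h with h | h
      · exact Or.inl (h.append_right _ _)
      · simp at h

lemma Prior.ne {T : PSST k} {u : T.Q} {t t' : Option (Fin k) × T.Q} (h : T.Prior u t t') :
    t ≠ t' := by
  rintro rfl
  obtain ⟨_ | a, q⟩ := t
  · exact h.1 rfl
  · exact h.2.1 rfl

lemma not_sublist_swap {α : Type} {l : List α} (hl : l.Nodup) {x y : α} (hne : x ≠ y)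
    (h : [x, y].Sublist l) : ¬ [y, x].Sublist l := by
  induction l with
  | nil => simp at h
  | cons z l ih =>
    have hz := List.nodup_cons.1 hl
    intro h'
    rcases List.sublist_cons_iff.1 h with h₁ | ⟨r, hr, h₁⟩
    · rcases List.sublist_cons_iff.1 h' with h₂ | ⟨r', hr', h₂⟩
      · exact ih hz.2 h₁ h₂
      · exact hz.1 (h₁.subset (by simp [(List.cons.inj hr').1]))
    · obtain ⟨rfl, rfl⟩ := List.cons.inj hr
      rcases List.sublist_cons_iff.1 h' with h₂ | ⟨r', hr', h₂⟩
      · exact hz.1 (h₂.subset (by simp))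
      · exact hne (List.cons.inj hr').1.symm

lemma Prior.asymm {T : PSST k} {u : T.Q} {t t' : Option (Fin k) × T.Q} (h : T.Prior u t t') :
    ¬ T.Prior u t' t := by
  have hn := List.nodup_append.1 (T.τ_nodup u)
  obtain ⟨_ | a, q⟩ := t <;> obtain ⟨_ | b, q'⟩ := t' <;> intro h'
  · obtain ⟨hne, h⟩ := h
    obtain ⟨-, h'⟩ := h'
    have hd : ∀ x ∈ (T.τ u).1, x ∉ (T.τ u).2 := fun x hx hx' => hn.2.2 x hx x hx' rfl
    rcases h with h | h | ⟨h1, h2⟩ <;> rcases h' with h' | h' | ⟨h1', h2'⟩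
    · exact not_sublist_swap hn.1 hne h h'
    · exact hd q (h.subset (by simp)) (h'.subset (by simp))
    · exact hd q (h.subset (by simp)) h2'
    · exact hd q (h'.subset (by simp)) (h.subset (by simp))
    · exact not_sublist_swap hn.2.1 hne h h'
    · exact hd q' h1' (h.subset (by simp))
    · exact hd q' (h'.subset (by simp)) h2
    · exact hd q h1 (h'.subset (by simp))
    · exact hd q h1 h2'
  · exact hn.2.2 q h.1 q h'.2 rfl
  · exact hn.2.2 q' h'.1 q' h.2 rfl
  · obtain ⟨rfl, hne, h⟩ := h
    exact not_sublist_swap (T.δ_nodup u a) hne h h'.2.2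

/-- At the first difference of two runs the priority of the transitions is asymmetric because the
lists of successors have no repetitions; this makes the accepting run unique. -/
lemma higher_asymm {T : PSST k} {r r' : List (Option (Fin k) × T.Q)} (h : T.Higher r r') :
    ¬ T.Higher r' r := by
  have main : ∀ q p t t' s s', T.Prior (T.last q p) t t' →
      ¬ T.Diff q (p ++ t' :: s') (p ++ t :: s) := by
    intro q p t t' s s' h
    induction p generalizing q with
    | nil =>
      rintro ⟨_ | ⟨x, p⟩, u, u', v, v', h1, h2, h3⟩
      · obtain ⟨rfl, rfl⟩ := List.cons.inj h1
        obtain ⟨rfl, rfl⟩ := List.cons.inj h2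
        exact h.asymm h3
      · exact h.ne ((List.cons.inj h2).1.trans (List.cons.inj h1).1.symm)
    | cons x p ih =>
      rintro ⟨_ | ⟨y, p'⟩, u, u', v, v', h1, h2, h3⟩
      · exact h3.ne ((List.cons.inj h1).1.symm.trans (List.cons.inj h2).1)
      · obtain ⟨rfl, h4⟩ := List.cons.inj h1
        exact ih x.2 h ⟨p', u, u', v, v', h4, (List.cons.inj h2).2, h3⟩
  have pre : ∀ p t t' (s s' : List (Option (Fin k) × T.Q)), t ≠ t' →
      ¬ p ++ t :: s <+: p ++ t' :: s' := by
    intro p t t' s s' hne h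
    rw [List.prefix_append_right_inj, List.cons_prefix_cons] at h
    exact hne h.1
  rintro (⟨h', hne'⟩ | ⟨p', u, u', v, v', rfl, rfl, h'⟩)
  · rcases h with ⟨h, hne⟩ | ⟨p, t, t', s, s', rfl, rfl, h⟩
    · exact hne (h.eq_of_length_le h'.length_le)
    · exact pre _ _ _ _ _ h.ne h'
  · rcases h with ⟨h, hne⟩ | ⟨p, t, t', s, s', h1, h2, h⟩
    · exact pre _ _ _ _ _ h'.ne h
    · exact main T.start p t t' s s' h ⟨p', u, u', v, v', h2.symm, h1.symm, h'⟩

/-- The head of the sorted list beats all other accepting runs. Conversely, if another run were of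
highest priority, then it and the head would each be higher than the other. -/
lemma accepting_iff {T : PSST k} {w : List (Fin k)} {r : List (Option (Fin k) × T.Q)} :
    T.Accepting w r ↔ (T.accs T.start w).head? = some r := by
  have hmem : ∀ r, r ∈ T.accs T.start w ↔ T.IsRun w r ∧ T.Final r := by
    intro r; rw [mem_accs, runFrom_start_iff]; simp [Final, fin]
  have hhead : ∀ r, (T.accs T.start w).head? = some r → T.Accepting w r := by
    intro r h
    obtain ⟨l, hl⟩ : ∃ l, T.accs T.start w = r :: l := by
      cases hl : T.accs T.start w with
      | nil => simp [hl] at h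
      | cons x l => exact ⟨l, by simp [hl] at h; rw [h]⟩
    have hr := (hmem r).1 (by simp [hl])
    refine ⟨hr.1, hr.2, fun r' h1 h2 hne => ?_⟩
    have hr' := (hmem r').2 ⟨h1, h2⟩
    have hp := T.pairwise_accs T.start w
    rw [hl] at hr' hp
    rcases List.mem_cons.1 hr' with rfl | hr'
    · exact absurd rfl hne
    · exact ((List.pairwise_cons.1 hp).1 r' hr').symm
  refine ⟨fun h => ?_, hhead r⟩
  cases hh : (T.accs T.start w).head? with
  | none =>
    have := (hmem r).2 ⟨h.1, h.2.1⟩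
    rw [List.head?_eq_none_iff.1 hh] at this
    simp at this
  | some r' =>
    by_contra hne
    have hne : r' ≠ r := fun h => hne (by rw [h])
    have h' := hhead r' hh
    exact higher_asymm (h.2.2 r' h'.1 h'.2.1 hne) (h'.2.2 r h.1 h.2.1 hne.symm)

end PSST

end StrSL

namespace StrSL

variable {k : ℕ}

/-! ## The variables used by the transducers of regular expressions -/

/-- The valuation after an assignment. -/
def Asg.upd (A : Asg k) (η : ℕ → Val k) : ℕ → Val k :=
  fun x => (A x).flatMap (Sum.elim η (fun c => [c]))

/-- The assignment concerns only the variables in `[lo, hi)`. -/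
def Asg.Within (A : Asg k) (lo hi : ℕ) : Prop :=
  ∀ x, (¬ (lo ≤ x ∧ x < hi) → A x = [Sum.inl x]) ∧
    (lo ≤ x ∧ x < hi → ∀ y, Sum.inl y ∈ A x → lo ≤ y ∧ y < hi)

lemma Asg.within_keep (lo hi : ℕ) : (Asg.keep k).Within lo hi := by
  intro x
  simp +contextual [Asg.keep]

lemma Asg.within_nullify {lo hi lo' hi' : ℕ} (h : lo ≤ lo') (h' : hi' ≤ hi) :
    (Asg.nullify k lo' hi').Within lo hi := by
  intro x
  refine ⟨fun hx => ?_, fun hx y hy => ?_⟩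
  · rw [Asg.nullify, if_neg]
    exact fun h => hx ⟨by omega, by omega⟩
  · unfold Asg.nullify at hy
    split_ifs at hy
    · simp at hy
    · obtain rfl : y = x := by simpa using hy
      exact hx

lemma Asg.Within.mono {A : Asg k} {lo hi lo' hi' : ℕ} (hA : A.Within lo hi) (h : lo' ≤ lo)
    (h' : hi ≤ hi') : A.Within lo' hi' := by
  intro x
  by_cases hx : lo ≤ x ∧ x < hi
  · refine ⟨fun hn => absurd ⟨by omega, by omega⟩ hn, fun _ y hy => ?_⟩
    have := (hA x).2 hx y hy
    exact ⟨by omega, by omega⟩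
  · rw [(hA x).1 hx]
    simp +contextual

lemma Asg.Within.upd_eq {A : Asg k} {lo hi x : ℕ} (hA : A.Within lo hi)
    (hx : ¬ (lo ≤ x ∧ x < hi)) (η : ℕ → Val k) : A.upd η x = η x := by
  simp [Asg.upd, (hA x).1 hx]

namespace PSST

/-- All assignments of the transducer concern only the variables in `[lo, hi)`. -/
def Within (T : PSST k) (lo hi : ℕ) : Prop := ∀ q a q', (T.E q a q').Within lo hi

/-- The initial state is not final, has no incoming transitions, and reads no letters. -/
structure Init (T : PSST k) : Prop where
  ne_start : ∀ q a q', T.Edge q a q' → q' ≠ T.start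
  not_letter : ∀ a q', ¬ T.Edge T.start (some a) q'
  not_fin : T.fin T.start = false

/-- The variable `n` records the word read, with the help of the variable `b`. -/
def Tracks (T : PSST k) (n b : ℕ) : Prop :=
  ∀ q a q', ∀ x, x = n ∨ x = b → T.E q a q' x =
    if q = T.start then [] else Sum.inl b :: a.toList.map (fun c => Sum.inr (some c))

lemma Within.mono {T : PSST k} {lo hi lo' hi' : ℕ} (hT : T.Within lo hi) (h : lo' ≤ lo)
    (h' : hi ≤ hi') : T.Within lo' hi' := fun q a q' => (hT q a q').mono h h'

lemma Within.track {T : PSST k} {lo hi n : ℕ} (hT : T.Within lo hi) (hn : lo ≤ n ∧ n < hi) :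
    (T.track n).Within lo hi := by
  intro q a q' x
  have h := hT q a q' x
  unfold PSST.track at q q' ⊢
  by_cases hx : x = n
  · subst hx
    refine ⟨fun h => absurd hn h, fun _ y hy => ?_⟩
    simp only [if_true] at hy
    split_ifs at hy
    · simp at hy
    · simp at hy
      exact hy ▸ hn
  · simp only [if_neg hx]
    exact h

lemma Within.copyVar {T : PSST k} {lo hi n : ℕ} (hT : T.Within lo hi)
    (hn : lo ≤ n ∧ n + 1 < hi) : (T.copyVar n).Within lo hi := by
  intro q a q' x
  have h := hT q a q' x
  unfold PSST.copyVar at q q' ⊢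
  by_cases hx : x = n
  · subst hx
    refine ⟨fun h => absurd ⟨hn.1, by omega⟩ h, fun _ y hy => ?_⟩
    simp only [if_true] at hy
    exact (hT q a q' (x + 1)).2 ⟨by omega, hn.2⟩ y hy
  · simp only [if_neg hx]
    exact h

lemma Within.altCore {T₁ T₂ : PSST k} {lo hi : ℕ} (h₁ : T₁.Within lo hi)
    (h₂ : T₂.Within lo hi) : (altCore T₁ T₂).Within lo hi := by
  rintro (_ | q | q) a (_ | q' | q')
  all_goals first | exact Asg.within_keep _ _ | exact h₁ _ _ _ | exact h₂ _ _ _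

lemma Within.concat {T₁ T₂ : PSST k} {lo hi lo' hi' : ℕ} (h₁ : T₁.Within lo hi)
    (h₂ : T₂.Within lo hi) (h : lo ≤ lo') (h' : hi' ≤ hi) :
    (concat T₁ T₂ lo' hi').Within lo hi := by
  rintro (q | q | q) a (q' | q' | q')
  all_goals first
    | exact Asg.within_keep _ _ | exact Asg.within_nullify h h' | exact h₁ _ _ _ | exact h₂ _ _ _

lemma Within.initCore {T : PSST k} {lo hi : ℕ} (hT : T.Within lo hi) :
    (initCore T).Within lo hi := by
  rintro (_ | q) a (_ | q')
  all_goals first | exact Asg.within_keep _ _ | exact hT _ _ _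

lemma Within.optCore {T : PSST k} {lo hi : ℕ} (g : Bool) (hT : T.Within lo hi) :
    (optCore g T).Within lo hi := by
  rintro (q | q) a (q' | q')
  all_goals first | exact Asg.within_keep _ _ | exact hT _ _ _

lemma Within.starCore {T : PSST k} {lo hi : ℕ} (g : Bool) (hT : T.Within lo hi) :
    (starCore g T lo hi).Within lo hi := by
  rintro (q | q) a (q' | q')
  · simp only [PSST.starCore]
    split_ifs
    · exact Asg.within_nullify le_rfl le_rfl
    · exact hT _ _ _
  all_goals exact Asg.within_keep _ _

lemma Within.pow {T : PSST k} {lo hi : ℕ} (hT : T.Within lo hi) (n : ℕ) :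
    (T.pow lo hi n).Within lo hi := by
  induction n with
  | zero => exact hT
  | succ n ih => exact ih.concat hT le_rfl le_rfl

lemma Within.upTo {T : PSST k} {lo hi : ℕ} (g : Bool) (hT : T.Within lo hi) (n : ℕ) :
    (upTo g T lo hi n).Within lo hi := by
  rintro (⟨i, q⟩ | q) a (⟨j, q'⟩ | q')
  · simp only [PSST.upTo]
    split_ifs
    · exact hT _ _ _
    · exact Asg.within_nullify le_rfl le_rfl
  all_goals exact Asg.within_keep _ _

lemma Within.repCore {T : PSST k} {lo hi : ℕ} (g : Bool) (hT : T.Within lo hi) :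
    ∀ m d, (repCore g T lo hi m d).Within lo hi
  | 0, 0 => fun _ _ _ => Asg.within_keep _ _
  | 0, d + 1 => hT.upTo g d
  | m + 1, 0 => hT.pow m
  | m + 1, d + 1 => (hT.pow m).concat (hT.upTo g d) le_rfl le_rfl

end PSST

lemma Regex.size_pos (e : Regex k) : 0 < e.size := by cases e <;> simp [Regex.size]

-- In preorder the variables of a subexpression form an interval. This is used twice: a component
-- cannot change the variables of the others, and only finitely many variables matter.
open PSST in
lemma Regex.within_toPSST (e : Regex k) (n : ℕ) : (e.toPSST n).Within n (n + e.size) := by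
  induction e generalizing n with
  | empty => exact Within.track (fun _ _ _ => Asg.within_keep _ _) (by simp [Regex.size])
  | eps => exact Within.track (fun _ _ _ => Asg.within_keep _ _) (by simp [Regex.size])
  | letter a => exact Within.track (fun _ _ _ => Asg.within_keep _ _) (by simp [Regex.size])
  | group e ih =>
    have := e.size_pos
    exact ((ih (n + 1)).mono (by omega) (by simp only [size]; omega)).copyVar
      (by simp only [size]; omega)
  | alt e₁ e₂ ih₁ ih₂ =>
    exact ((((ih₁ (n + 1)).mono (by omega) (by simp only [size]; omega))).altCore
      (((ih₂ (n + 1 + e₁.size)).mono (by omega) (by simp only [size]; omega)))).track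
      (by simp only [size]; omega)
  | seq e₁ e₂ ih₁ ih₂ =>
    exact ((((ih₁ (n + 1)).mono (by omega) (by simp only [size]; omega))).concat
      (((ih₂ (n + 1 + e₁.size)).mono (by omega) (by simp only [size]; omega)))
      (by omega) (by simp only [size]; omega)).initCore.track (by simp only [size]; omega)
  | opt g e ih =>
    exact (((ih (n + 1)).mono (by omega) (by simp only [size]; omega)).optCore g).track
      (by simp only [size]; omega)
  | star g e ih =>
    exact (((ih (n + 1)).starCore g).mono (by omega) (by simp only [size]; omega)).track
      (by simp only [size]; omega)
  | plus g e ih =>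
    exact (((ih (n + 1)).concat ((ih (n + 1)).starCore g) le_rfl le_rfl).mono (by omega)
      (by simp only [size]; omega)).initCore.track (by simp only [size]; omega)
  | rep g m d e ih =>
    exact (((ih (n + 1)).repCore g m d).mono (by omega)
      (by simp only [size]; omega)).initCore.track (by simp only [size]; omega)

namespace PSST

lemma Init.track {T : PSST k} (h : T.Init) (n : ℕ) : (T.track n).Init :=
  ⟨fun q a q' he => h.ne_start q a q' (by cases a <;> exact he),
    fun a q' he => h.not_letter a q' he, h.not_fin⟩

lemma Init.copyVar {T : PSST k} (h : T.Init) (n : ℕ) : (T.copyVar n).Init :=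
  ⟨fun q a q' he => h.ne_start q a q' (by cases a <;> exact he),
    fun a q' he => h.not_letter a q' he, h.not_fin⟩

lemma Init.initCore (T : PSST k) : (initCore T).Init := by
  unfold PSST.initCore
  refine ⟨?_, ?_, rfl⟩
  · rintro (_ | q) (_ | a) q' h rfl <;> simp [Edge] at h
  · intro a q' h
    simp [Edge] at h

lemma tracks_track {T : PSST k} (n : ℕ) : (T.track n).Tracks n n := by
  unfold track
  intro q a q' x hx
  obtain rfl : x = n := by simpa using hx
  simp only [if_true]

/-- The variable `n` receives the right-hand side of `n + 1`, which refers to `b` and not to `n`. So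
`b` is unchanged when groups are nested. -/
lemma Tracks.copyVar {T : PSST k} {n b : ℕ} (h : T.Tracks (n + 1) b) (hb : b ≠ n) :
    (T.copyVar n).Tracks n b := by
  unfold PSST.copyVar
  intro q a q' x hx
  rcases hx with rfl | rfl
  · simpa using h q a q' (x + 1) (Or.inl rfl)
  · simpa [hb] using h q a q' x (Or.inr rfl)

lemma init_emptyCore : (emptyCore k).Init := by
  unfold emptyCore
  refine ⟨?_, ?_, rfl⟩
  · rintro q (_ | a) q' h <;> simp [Edge] at h
  · intro a q' h
    simp [Edge] at h

lemma init_epsCore : (epsCore k).Init := by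
  unfold epsCore
  refine ⟨?_, ?_, rfl⟩
  · rintro (_ | _) (_ | a) q' h <;> simp_all [Edge]
  · intro a q' h
    simp [Edge] at h

lemma init_letterCore (a : Fin k) : (letterCore a).Init := by
  unfold letterCore
  refine ⟨?_, ?_, by simp [fin]⟩
  · rintro q (_ | b) q' h rfl <;> simp only [Edge] at h <;> split_ifs at h <;> simp at h
  · intro a q' h
    simp [Edge] at h

lemma init_altCore (T₁ T₂ : PSST k) : (altCore T₁ T₂).Init := by
  unfold altCore
  refine ⟨?_, ?_, rfl⟩
  · rintro (_ | q | q) (_ | a) q' h rfl <;> simp [Edge] at h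
  · intro a q' h
    simp [Edge] at h

lemma init_optCore (g : Bool) (T : PSST k) : (optCore g T).Init := by
  unfold optCore
  refine ⟨?_, ?_, rfl⟩
  · rintro (q | _ | _) (_ | a) q' h rfl <;> cases g <;> simp [Edge, order] at h
  · intro a q' h
    simp [Edge] at h

lemma init_starCore (g : Bool) (T : PSST k) (lo hi : ℕ) : (starCore g T lo hi).Init := by
  unfold starCore
  refine ⟨?_, ?_, rfl⟩
  · rintro (q | i) (_ | a) q' h rfl <;> cases g <;> simp [Edge, order] at h <;>
      split_ifs at h <;> simp at h
  · intro a q' h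
    simp [Edge] at h

end PSST

-- The transitions out of the initial state reset the tracking variable. It records the word read
-- only if this state is never entered again and reads no letter, and it is set in every accepting
-- run only if this state is not final.
open PSST in
lemma Regex.init_toPSST (e : Regex k) (n : ℕ) : (e.toPSST n).Init := by
  induction e generalizing n with
  | empty => exact init_emptyCore.track n
  | eps => exact init_epsCore.track n
  | letter a => exact (init_letterCore a).track n
  | group e ih => exact (ih _).copyVar n
  | alt e₁ e₂ ih₁ ih₂ => exact (init_altCore _ _).track n
  | seq e₁ e₂ ih₁ ih₂ => exact (Init.initCore _).track n
  | opt g e ih => exact (init_optCore _ _).track n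
  | star g e ih => exact (init_starCore _ _ _ _).track n
  | plus g e ih => exact (Init.initCore _).track n
  | rep g m d e ih => exact (Init.initCore _).track n

-- The witness `b` is the number of the outermost subexpression of `e` that is not a group.
open PSST in
lemma Regex.exists_tracks (e : Regex k) (n : ℕ) :
    ∃ b, n ≤ b ∧ b < n + e.size ∧ (e.toPSST n).Tracks n b := by
  induction e generalizing n with
  | group e ih =>
    obtain ⟨b, h1, h2, h⟩ := ih (n + 1)
    exact ⟨b, by omega, by simp only [size]; omega, h.copyVar (by omega)⟩
  | _ => exact ⟨n, le_rfl, by simp only [size]; omega, tracks_track n⟩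

/-! ## The first match -/

namespace PSST

/-- The word read along a path from `q` after the first visit of the states in `C`. -/
def post (T : PSST k) (C : T.Q → Bool) : T.Q → List (Option (Fin k) × T.Q) → List (Fin k)
  | _, [] => []
  | q, (a, q') :: r =>
      if C q then ((a, q') :: r).filterMap Prod.fst else T.post C q' r

lemma eval_cons (T : PSST k) (η : ℕ → Val k) (q : T.Q) (a : Option (Fin k)) (q' : T.Q)
    (r : List (Option (Fin k) × T.Q)) :
    T.eval η q ((a, q') :: r) = T.eval ((T.E q a q').upd η) q' r := rfl

lemma post_of_mem {T : PSST k} {C : T.Q → Bool} {q : T.Q} (h : C q = true)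
    (r : List (Option (Fin k) × T.Q)) : T.post C q r = r.filterMap Prod.fst := by
  cases r with
  | nil => rfl
  | cons t r => simp [post, h]

lemma post_cons {T : PSST k} {C : T.Q → Bool} {q : T.Q} (h : C q = false)
    {t : Option (Fin k) × T.Q} (r : List (Option (Fin k) × T.Q)) :
    T.post C q (t :: r) = T.post C t.2 r := by
  simp [post, h]

/-- In the initial state the old values are irrelevant: the step sets the variables to the empty
word and reads nothing. Elsewhere the label is appended to the value of `b`. -/
lemma Tracks.step {T : PSST k} {n b : ℕ} (hT : T.Tracks n b) (hi : T.Init) {q q' : T.Q}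
    {a : Option (Fin k)} (he : T.Edge q a q') {u : List (Fin k)} {η : ℕ → Val k}
    (h : if q = T.start then u = [] else η n = u.map some ∧ η b = u.map some) {x : ℕ}
    (hx : x = n ∨ x = b) :
    (T.E q a q').upd η x = (u ++ a.toList).map some := by
  rw [Asg.upd, hT q a q' x hx]
  split_ifs at h ⊢ with hq
  · subst hq
    cases a with
    | none => simp [h]
    | some a => exact absurd he (hi.not_letter a q')
  · cases a <;> simp [h.2]

lemma edge_initCore_none {T : PSST k} {a : Option (Fin k)} {p : Option T.Q}
    (h : (initCore T).Edge (none : Option T.Q) a p) : a = none ∧ p = some T.start := by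
  unfold initCore at h
  cases a with
  | none => simpa [Edge] using h
  | some a => simp [Edge] at h

lemma edge_initCore_some {T : PSST k} {q : T.Q} {a : Option (Fin k)} {p : Option T.Q}
    (h : (initCore T).Edge (some q) a p) : ∃ q', p = some q' ∧ T.Edge q a q' := by
  unfold initCore at h
  cases a with
  | none => rcases h with h | h <;> obtain ⟨q', hq, rfl⟩ := List.mem_map.1 h <;>
      exact ⟨q', rfl, by simp [Edge, hq]⟩
  | some a => obtain ⟨q', hq, rfl⟩ := List.mem_map.1 h; exact ⟨q', rfl, hq⟩

lemma edge_concat_inl {T₁ T₂ : PSST k} {lo hi : ℕ} {q : T₁.Q} {a : Option (Fin k)}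
    {p : T₁.Q ⊕ (T₂.Q ⊕ T₂.Q)} (h : (concat T₁ T₂ lo hi).Edge (Sum.inl q) a p) :
    (∃ q', p = Sum.inl q' ∧ T₁.Edge q a q') ∨ (a = none ∧ T₁.fin q = true ∧
      (p = Sum.inr (Sum.inl T₂.start) ∨ p = Sum.inr (Sum.inr T₂.start))) := by
  unfold concat at h
  cases a with
  | none =>
    simp only [Edge] at h
    split_ifs at h with h1 h2
    · exact Or.inr ⟨rfl, by simp [fin, h1], by simpa using Or.inl h⟩
    · exact Or.inr ⟨rfl, by simp [fin, h2], by simpa using Or.inr h⟩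
    · rcases h with h | h <;> obtain ⟨q', hq, rfl⟩ := List.mem_map.1 h <;>
        exact Or.inl ⟨q', rfl, by simp [Edge, hq]⟩
  | some a => obtain ⟨q', hq, rfl⟩ := List.mem_map.1 h; exact Or.inl ⟨q', rfl, hq⟩

lemma edge_concat_inr_inl {T₁ T₂ : PSST k} {lo hi : ℕ} {q : T₂.Q} {a : Option (Fin k)}
    {p : T₁.Q ⊕ (T₂.Q ⊕ T₂.Q)} (h : (concat T₁ T₂ lo hi).Edge (Sum.inr (Sum.inl q)) a p) :
    ∃ q', p = Sum.inr (Sum.inl q') ∧ T₂.Edge q a q' := by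
  unfold concat at h
  cases a with
  | none => rcases h with h | h <;> obtain ⟨q', hq, rfl⟩ := List.mem_map.1 h <;>
      exact ⟨q', rfl, by simp [Edge, hq]⟩
  | some a => obtain ⟨q', hq, rfl⟩ := List.mem_map.1 h; exact ⟨q', rfl, hq⟩

lemma edge_concat_inr_inr {T₁ T₂ : PSST k} {lo hi : ℕ} {q : T₂.Q} {a : Option (Fin k)}
    {p : T₁.Q ⊕ (T₂.Q ⊕ T₂.Q)} (h : (concat T₁ T₂ lo hi).Edge (Sum.inr (Sum.inr q)) a p) :
    ∃ q', p = Sum.inr (Sum.inr q') ∧ T₂.Edge q a q' := by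
  unfold concat at h
  cases a with
  | none => rcases h with h | h <;> obtain ⟨q', hq, rfl⟩ := List.mem_map.1 h <;>
      exact ⟨q', rfl, by simp [Edge, hq]⟩
  | some a => obtain ⟨q', hq, rfl⟩ := List.mem_map.1 h; exact ⟨q', rfl, hq⟩

/-- A property of the state, the valuation and the word read so far that holds along all paths
from the initial state, and that does not depend on the variables `0` and `1`. -/
structure Invariant (T : PSST k) (I : T.Q → (ℕ → Val k) → List (Fin k) → Prop) : Prop where
  congr : ∀ q η η' u, (∀ x, 2 ≤ x → η x = η' x) → I q η u → I q η' u
  start : ∀ η, I T.start η []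
  step : ∀ q a q' η u, T.Edge q a q' → I q η u →
    I q' ((T.E q a q').upd η) (u ++ a.toList)

/-- In a search expression `0` and `1` are the variables of the two concatenations, and the group
for the text before the match has number `2`. Tracking the concatenations must not disturb the
invariant. -/
lemma Invariant.track {T : PSST k} {I : T.Q → (ℕ → Val k) → List (Fin k) → Prop}
    (h : T.Invariant I) {n : ℕ} (hn : n < 2) : (T.track n).Invariant I where
  congr := h.congr
  start := h.start
  step q a q' η u he hI := by
    refine h.congr q' ((T.E q a q').upd η) _ _ (fun x hx => ?_)
      (h.step q a q' η u (by cases a <;> exact he) hI)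
    have hxn : x ≠ n := by omega
    simp [Asg.upd, PSST.track, hxn]

lemma Invariant.initCore {T : PSST k} {I : T.Q → (ℕ → Val k) → List (Fin k) → Prop}
    (h : T.Invariant I) :
    (initCore T).Invariant (fun (q : Option T.Q) η u => q.elim (u = []) (fun q => I q η u)) where
  congr q η η' u hη hI := by
    rcases q with _ | q
    · exact hI
    · exact h.congr q η η' u hη hI
  start η := rfl
  step q a q' η u he hI := by
    rcases q with _ | q
    · obtain ⟨rfl, rfl⟩ := edge_initCore_none he
      obtain rfl : u = [] := hI
      exact h.start _
    · obtain ⟨q', rfl, he₁⟩ := edge_initCore_some he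
      exact h.step q a q' η u he₁ hI

/-- The word `u` is the concatenation of the values of two variables. -/
def Splits (x y : ℕ) (η : ℕ → Val k) (u : List (Fin k)) : Prop :=
  ∃ pre v, u = pre ++ v ∧ η x = pre.map some ∧ η y = v.map some

/-- Inside `T₁` the variable `2` holds the word read. On entering `T₂` it is frozen, because all
variables of `T₂` are at least `m > 2`, and `m` records the rest. -/
lemma invariant_concat {T₁ T₂ : PSST k} {m l b₁ b₂ : ℕ} (hm : 2 < m) (hi₁ : T₁.Init)
    (hi₂ : T₂.Init) (ht₁ : T₁.Tracks 2 b₁) (ht₂ : T₂.Tracks m b₂) (hb₁ : 2 ≤ b₁) (hb₂ : m ≤ b₂)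
    (hw₂ : T₂.Within m l) : ∃ I, (concat T₁ T₂ m l).Invariant I ∧
      ∀ q η u, (concat T₁ T₂ m l).fin q = true → I q η u → Splits 2 m η u := by
  -- The invariant for both copies of `T₂`: `pre` was read by `T₁`, and `v` has been read since
  -- then.
  let J : T₂.Q → (ℕ → Val k) → List (Fin k) → Prop := fun q η u =>
    ∃ pre v, u = pre ++ v ∧ η 2 = pre.map some ∧
      if q = T₂.start then v = [] else η m = v.map some ∧ η b₂ = v.map some
  have hJ : ∀ q η η' u, (∀ x, 2 ≤ x → η x = η' x) → J q η u → J q η' u := by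
    rintro q η η' u hη ⟨pre, v, h⟩
    exact ⟨pre, v, by rw [← hη 2 le_rfl, ← hη m (by omega), ← hη b₂ (by omega)]; exact h⟩
  have hJs : ∀ q a q' η u, T₂.Edge q a q' → J q η u →
      J q' ((T₂.E q a q').upd η) (u ++ a.toList) := by
    rintro q a q' η _ he ⟨pre, v, rfl, h1, h2⟩
    refine ⟨pre, v ++ a.toList, by simp, ?_, ?_⟩
    · rw [(hw₂ q a q').upd_eq (by omega), h1]
    · rw [if_neg (hi₂.ne_start q a q' he)]
      exact ⟨ht₂.step hi₂ he h2 (Or.inl rfl), ht₂.step hi₂ he h2 (Or.inr rfl)⟩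
  have hJf : ∀ q η u, T₂.fin q = true → J q η u → Splits 2 m η u := by
    rintro q η u hf ⟨pre, v, rfl, h1, h2⟩
    rw [if_neg (fun h => by rw [h, hi₂.not_fin] at hf; simp at hf)] at h2
    exact ⟨pre, v, rfl, h1, h2.1⟩
  refine ⟨fun (q : T₁.Q ⊕ (T₂.Q ⊕ T₂.Q)) η u => Sum.elim
    (fun q => if q = T₁.start then u = [] else η 2 = u.map some ∧ η b₁ = u.map some)
    (Sum.elim (fun q => J q η u) (fun q => J q η u)) q, ⟨?_, ?_, ?_⟩, ?_⟩
  · rintro (q | q | q) η η' u hη hI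
    · simp only [Sum.elim_inl] at hI ⊢
      rw [← hη 2 le_rfl, ← hη b₁ hb₁]
      exact hI
    · exact hJ q η η' u hη hI
    · exact hJ q η η' u hη hI
  · intro η
    simp [concat]
  · rintro (q | q | q) a q' η u he hI
    · simp only [Sum.elim_inl] at hI
      rcases edge_concat_inl he with ⟨q', rfl, he₁⟩ | ⟨rfl, hf, hq'⟩
      · simp only [Sum.elim_inl]
        rw [if_neg (hi₁.ne_start q a q' he₁)]
        exact ⟨ht₁.step hi₁ he₁ hI (Or.inl rfl), ht₁.step hi₁ he₁ hI (Or.inr rfl)⟩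
      -- A final state is not initial, so the variable `2` has been set.
      · rw [if_neg (fun h => by rw [h, hi₁.not_fin] at hf; simp at hf)] at hI
        have key : J T₂.start ((Asg.nullify k m l).upd η) (u ++ (none : Option (Fin k)).toList) := by
          refine ⟨u, [], by simp, ?_, by simp⟩
          rw [(Asg.within_nullify le_rfl le_rfl : (Asg.nullify k m l).Within m l).upd_eq (by omega),
            hI.1]
        rcases hq' with rfl | rfl <;> exact key
    · obtain ⟨q', rfl, he₁⟩ := edge_concat_inr_inl he
      exact hJs q a q' η u he₁ hI
    · obtain ⟨q', rfl, he₁⟩ := edge_concat_inr_inr he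
      exact hJs q a q' η u he₁ hI
  · rintro (q | q | q) η u hf hI
    · simp [fin, concat] at hf
    · exact hJf q η u (by simpa [fin, concat] using hf) hI
    · exact hJf q η u (by simpa [fin, concat] using hf) hI

lemma fin_initCore {T : PSST k} {q : Option T.Q} (h : (initCore T).fin q = true) :
    ∃ p, q = some p ∧ T.fin p = true := by
  rcases q with _ | p
  · simp [fin, initCore] at h
  · exact ⟨p, rfl, h⟩

/-- The states of the last component of the transducer for searching. -/
def lastPart (T₁ T₂ : PSST k) (lo hi : ℕ) : ((initCore (concat T₁ T₂ lo hi)).track 0).Q → Bool :=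
  fun (q : Option (T₁.Q ⊕ (T₂.Q ⊕ T₂.Q))) => q.elim false (Sum.elim (fun _ => false) fun _ => true)

lemma lastPart_edge {T₁ T₂ : PSST k} {lo hi : ℕ} (hw : T₂.Within lo hi) {x : ℕ} (hx : x < lo)
    (hx0 : x ≠ 0) {q q' : ((initCore (concat T₁ T₂ lo hi)).track 0).Q} {a : Option (Fin k)}
    (hq : lastPart T₁ T₂ lo hi q = true)
    (he : ((initCore (concat T₁ T₂ lo hi)).track 0).Edge q a q') :
    lastPart T₁ T₂ lo hi q' = true ∧ ∀ η : ℕ → Val k,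
      (((initCore (concat T₁ T₂ lo hi)).track 0).E q a q').upd η x = η x := by
  have he' : (initCore (concat T₁ T₂ lo hi)).Edge q a q' := by cases a <;> exact he
  have hE : ∀ η : ℕ → Val k, (((initCore (concat T₁ T₂ lo hi)).track 0).E q a q').upd η x =
      ((initCore (concat T₁ T₂ lo hi)).E q a q').upd η x := by
    intro η
    simp [Asg.upd, PSST.track, hx0]
  simp only [hE]
  rcases q with _ | q | q | q
  · exact absurd (show false = true from hq) (by simp)
  · exact absurd (show false = true from hq) (by simp)
  · obtain ⟨p, rfl, h⟩ := edge_initCore_some he'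
    obtain ⟨p, rfl, h⟩ := edge_concat_inr_inl h
    exact ⟨rfl, fun η => (hw q a p).upd_eq (by omega) η⟩
  · obtain ⟨p, rfl, h⟩ := edge_initCore_some he'
    obtain ⟨p, rfl, h⟩ := edge_concat_inr_inr h
    exact ⟨rfl, fun η => (hw q a p).upd_eq (by omega) η⟩

/-- Behind the match only the variables of the last component and the variable `0` change, so the
captures are frozen. -/
lemma lastPart_path {T₁ T₂ : PSST k} {lo hi : ℕ} (hw : T₂.Within lo hi) {x : ℕ} (hx : x < lo)
    (hx0 : x ≠ 0) (r : List (Option (Fin k) × ((initCore (concat T₁ T₂ lo hi)).track 0).Q))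
    {q : ((initCore (concat T₁ T₂ lo hi)).track 0).Q} (hq : lastPart T₁ T₂ lo hi q = true)
    (hp : ((initCore (concat T₁ T₂ lo hi)).track 0).Path q r) (η : ℕ → Val k) :
    ((initCore (concat T₁ T₂ lo hi)).track 0).eval η q r x = η x := by
  induction r generalizing q η with
  | nil => rfl
  | cons t r ih =>
    obtain ⟨a, q'⟩ := t
    obtain ⟨h1, h2⟩ := lastPart_edge hw hx hx0 hq hp.1
    rw [eval_cons, ih h1 hp.2, h2]

/-- On an accepting path, the word read is composed of the two parts recorded in the variables,
and the part read in the last component. -/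
lemma splits_of_path {T₁ T₂ : PSST k} {lo hi m : ℕ} (hw : T₂.Within lo hi) (h2 : 2 < lo)
    (hm : m < lo) (hm0 : m ≠ 0) {I : T₁.Q → (ℕ → Val k) → List (Fin k) → Prop}
    (hI : T₁.Invariant I) (hIf : ∀ q η u, T₁.fin q = true → I q η u → Splits 2 m η u)
    (r : List (Option (Fin k) × ((initCore (concat T₁ T₂ lo hi)).track 0).Q))
    (q : Option (T₁.Q ⊕ (T₂.Q ⊕ T₂.Q))) (hq : lastPart T₁ T₂ lo hi q = false)
    (hp : ((initCore (concat T₁ T₂ lo hi)).track 0).Path q r)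
    (hf : ((initCore (concat T₁ T₂ lo hi)).track 0).fin
      (((initCore (concat T₁ T₂ lo hi)).track 0).last q r) = true) (η : ℕ → Val k)
    (u : List (Fin k))
    (hinv : q.elim (u = []) (Sum.elim (fun q => I q η u) fun _ => True)) :
    ∃ pre v, u ++ r.filterMap Prod.fst = pre ++ v ++
        ((initCore (concat T₁ T₂ lo hi)).track 0).post (lastPart T₁ T₂ lo hi) q r ∧
      ((initCore (concat T₁ T₂ lo hi)).track 0).eval η q r 2 = pre.map some ∧
      ((initCore (concat T₁ T₂ lo hi)).track 0).eval η q r m = v.map some := by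
  have hE : ∀ (q : Option (T₁.Q ⊕ (T₂.Q ⊕ T₂.Q))) a (q' : Option (T₁.Q ⊕ (T₂.Q ⊕ T₂.Q)))
      (η : ℕ → Val k) x, x ≠ 0 →
      (((initCore (concat T₁ T₂ lo hi)).track 0).E q a q').upd η x =
      ((initCore (concat T₁ T₂ lo hi)).E q a q').upd η x := by
    intro q a q' η x hx
    simp [Asg.upd, PSST.track, hx]
  induction r generalizing q η u with
  | nil =>
    exfalso
    rcases q with _ | q | q
    · simp [last, fin, track, initCore] at hf
    · simp [last, fin, track, initCore, concat] at hf
    · exact absurd (show true = false from hq) (by simp)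
  | cons t r ih =>
    obtain ⟨a, q'⟩ := t
    have he' : (initCore (concat T₁ T₂ lo hi)).Edge q a q' := by cases a <;> exact hp.1
    suffices h : ∃ pre v, (u ++ a.toList) ++ r.filterMap Prod.fst = pre ++ v ++
        ((initCore (concat T₁ T₂ lo hi)).track 0).post (lastPart T₁ T₂ lo hi) q' r ∧
        ((initCore (concat T₁ T₂ lo hi)).track 0).eval
          ((((initCore (concat T₁ T₂ lo hi)).track 0).E q a q').upd η) q' r 2 = pre.map some ∧
        ((initCore (concat T₁ T₂ lo hi)).track 0).eval
          ((((initCore (concat T₁ T₂ lo hi)).track 0).E q a q').upd η) q' r m = v.map some by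
      obtain ⟨pre, v, h1, h2, h3⟩ := h
      have hcons : ((a, q') :: r).filterMap Prod.fst = a.toList ++ r.filterMap Prod.fst := by
        cases a <;> simp
      exact ⟨pre, v, (congrArg (u ++ ·) hcons).trans ((List.append_assoc _ _ _).symm.trans
        (h1.trans (congrArg (pre ++ v ++ ·) (post_cons (t := (a, q')) hq r).symm))), h2, h3⟩
    rcases q with _ | q | q
    · obtain ⟨rfl, rfl⟩ := edge_initCore_none he'
      obtain rfl : u = [] := hinv
      exact ih (some (Sum.inl T₁.start)) rfl hp.2 hf _ _ (hI.start _)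
    · obtain ⟨p, rfl, h⟩ := edge_initCore_some he'
      rcases edge_concat_inl h with ⟨p, rfl, h₁⟩ | ⟨rfl, hfq, hq'⟩
      · refine ih (some (Sum.inl p)) rfl hp.2 hf _ _ ?_
        refine hI.congr p ((T₁.E q a p).upd η) _ _ (fun x hx => ?_) (hI.step q a p η u h₁ hinv)
        exact (hE (some (Sum.inl q)) a (some (Sum.inl p)) η x (by omega)).symm
      -- The last component is entered here. The word read so far splits by the invariant, and
      -- everything that is still to be read is `post`.
      · obtain ⟨pre, v, h1, h2', h3⟩ := hIf q η u hfq hinv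
        have hC : lastPart T₁ T₂ lo hi (some p) = true := by
          rcases hq' with rfl | rfl <;> rfl
        have hup : ∀ x, x < lo → x ≠ 0 →
            (((initCore (concat T₁ T₂ lo hi)).track 0).E (some (Sum.inl q)) none (some p)).upd η x =
              η x := by
          intro x hx hx0
          refine (hE (some (Sum.inl q)) none (some p) η x hx0).trans ?_
          rcases hq' with rfl | rfl <;>
          exact (Asg.within_nullify le_rfl le_rfl : (Asg.nullify k lo hi).Within lo hi).upd_eq
            (by omega) η
        refine ⟨pre, v, ?_, ?_, ?_⟩
        · rw [h1, Option.toList_none, List.append_nil]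
          exact congrArg (pre ++ v ++ ·) (post_of_mem
            (T := (initCore (concat T₁ T₂ lo hi)).track 0) (q := some p) hC r).symm
        · exact ((lastPart_path hw h2 (by omega) r hC hp.2 _).trans (hup 2 h2 (by omega))).trans h2'
        · exact ((lastPart_path hw hm hm0 r hC hp.2 _).trans (hup m hm hm0)).trans h3
    · exact absurd (show true = false from hq) (by simp)

end PSST

/-- The accepting run of the transducer of `e`. -/
noncomputable def Regex.finalRun (e : Regex k) (w : List (Fin k)) :
    Option (List (Option (Fin k) × (e.toPSST 0).Q)) :=
  ((e.toPSST 0).accs (e.toPSST 0).start w).head?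

/-- The match of the capturing group `i + 1` on a run. -/
noncomputable def Regex.capt (e : Regex k) (r : List (Option (Fin k) × (e.toPSST 0).Q)) (i : ℕ) :
    Option (List (Fin k)) :=
  (e.groups 0)[i]?.bind fun x =>
    Val.toWord ((e.toPSST 0).eval (fun _ => [none]) (e.toPSST 0).start r x)

lemma Regex.matches_iff {e : Regex k} {w : List (Fin k)} {c : ℕ → Option (List (Fin k))} :
    e.Matches w c ↔ ∃ r, e.finalRun w = some r ∧ c 0 = some w ∧ ∀ i, c (i + 1) = e.capt r i := by
  simp only [Regex.Matches, PSST.accepting_iff, Regex.finalRun, Regex.capt]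

/-- The number of the group for the match in a search expression. -/
def searchPos (k : ℕ) : ℕ := 1 + 1 + (Regex.group (Regex.star false (Regex.any k))).size

lemma Regex.groups_any (k n : ℕ) : (Regex.any k).groups n = [] := by
  have key : ∀ (l : List (Fin k)) (e : Regex k), (∀ n, e.groups n = []) → ∀ n,
      (l.foldl (fun e b => Regex.alt e (.letter b)) e).groups n = [] := by
    intro l
    induction l with
    | nil => exact fun e h => h
    | cons a l ih => exact fun e h => ih _ fun n => by simp [Regex.groups, h]
  unfold Regex.any
  cases List.finRange k with
  | nil => rfl
  | cons a l => exact key l _ (fun _ => rfl) n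

/-- Alphabet expressions contain no groups. Hence index `0` of `capt` is the text before the match,
index `1` the match, and the following indices are the groups of `pat`. -/
lemma Regex.groups_search (pat : Regex k) :
    pat.search.groups 0 = 2 :: searchPos k :: pat.groups (searchPos k + 1) := by
  simp [Regex.search, Regex.groups, Regex.groups_any, searchPos]

/-- The states of the transducer of a search expression behind the match. -/
def Regex.searchLast (pat : Regex k) : (pat.search.toPSST 0).Q → Bool :=
  PSST.lastPart ((Regex.seq (.group (.star false (.any k))) (.group pat)).toPSST 1)
    ((Regex.star true (Regex.any k)).toPSST
      (0 + 1 + (Regex.seq (.group (.star false (.any k))) (.group pat)).size)) _ _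

lemma Val.toWord_map_some (l : List (Fin k)) : Val.toWord (l.map some) = some l := by
  induction l with
  | nil => rfl
  | cons a l ih => simp [Val.toWord, ih]

-- On every accepting run both outer groups are defined, and the text behind the match is what is
-- read in the last component. This ties the text `post`, which is no capture, to the run.
open PSST in
lemma Regex.splits_of_finalRun {pat : Regex k} {x : List (Fin k)}
    {r : List (Option (Fin k) × (pat.search.toPSST 0).Q)} (h : pat.search.finalRun x = some r) :
    ∃ pre v, pat.search.capt r 0 = some pre ∧ pat.search.capt r 1 = some v ∧
      x = pre ++ v ++ (pat.search.toPSST 0).post pat.searchLast (pat.search.toPSST 0).start r := by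
  have h' := (accepting_iff.2 h)
  obtain ⟨⟨hp, hw, -⟩, hf, -⟩ := h'
  have hfin : (pat.search.toPSST 0).fin
      ((pat.search.toPSST 0).last (pat.search.toPSST 0).start r) = true := by
    rcases hf with hf | hf <;> simp [PSST.fin, hf]
  obtain ⟨b₁, hb₁, -, ht₁⟩ := (Regex.group (.star false (.any k))).exists_tracks 2
  obtain ⟨b₂, hb₂, -, ht₂⟩ := (Regex.group pat).exists_tracks (searchPos k)
  obtain ⟨I, hI, hIf⟩ := invariant_concat (l := searchPos k + (Regex.group pat).size)
    (by simp only [searchPos, size]; omega)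
    ((Regex.group (.star false (.any k))).init_toPSST 2)
    ((Regex.group pat).init_toPSST (searchPos k)) ht₁ ht₂ hb₁ hb₂
    ((Regex.group pat).within_toPSST (searchPos k))
  obtain ⟨pre, v, h1, h2, h3⟩ := splits_of_path (m := searchPos k)
    ((Regex.star true (Regex.any k)).within_toPSST
      (0 + 1 + (Regex.seq (.group (.star false (.any k))) (.group pat)).size))
    (by simp only [size]; omega) (by simp only [searchPos, size]; omega)
    (by simp only [searchPos, size]; omega)
    (hI.initCore.track one_lt_two)
    (fun q η u hq hu => by
      obtain ⟨p, rfl, hp⟩ := fin_initCore hq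
      exact hIf p η u hp hu)
    r none rfl hp hfin (fun _ => [none]) [] rfl
  refine ⟨pre, v, ?_, ?_, ?_⟩
  · rw [capt, groups_search]
    exact (congrArg Val.toWord h2).trans (Val.toWord_map_some _)
  · rw [capt, groups_search]
    exact (congrArg Val.toWord h3).trans (Val.toWord_map_some _)
  · rw [← hw]
    exact h1

/-- The equation `x = pre ++ v ++ post` holds automatically for the accepting run; it serves only to
determine `post`. -/
lemma Regex.firstMatch_iff {pat : Regex k} {x pre v post : List (Fin k)}
    {c : ℕ → Option (List (Fin k))} : pat.FirstMatch x pre v post c ↔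
      ∃ r, pat.search.finalRun x = some r ∧ pat.search.capt r 0 = some pre ∧
        pat.search.capt r 1 = some v ∧
        post = (pat.search.toPSST 0).post pat.searchLast (pat.search.toPSST 0).start r ∧
        c = fun i => pat.search.capt r (i + 1) := by
  simp only [FirstMatch, matches_iff]
  constructor
  · rintro ⟨d, ⟨r, hr, -, hd⟩, h1, h2, h3, rfl⟩
    obtain ⟨pre', v', h1', h2', h3'⟩ := splits_of_finalRun hr
    rw [hd 0, h1'] at h1
    rw [hd 1, h2'] at h2
    obtain rfl := Option.some.inj h1
    obtain rfl := Option.some.inj h2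
    exact ⟨r, hr, h1', h2', List.append_cancel_left (h3.symm.trans h3'), funext fun i => hd _⟩
  · rintro ⟨r, hr, h1, h2, rfl, rfl⟩
    obtain ⟨pre', v', h1', h2', h3'⟩ := splits_of_finalRun hr
    obtain rfl := Option.some.inj (h1.symm.trans h1')
    obtain rfl := Option.some.inj (h2.symm.trans h2')
    exact ⟨fun i => Nat.casesOn i (some x) fun i => pat.search.capt r i,
      ⟨r, hr, rfl, fun i => rfl⟩, h1, h2, h3', rfl⟩

/-- An accepting run always defines the two outer groups, so only the absence of such a run can
prevent a match. -/
lemma Regex.noMatch_iff {pat : Regex k} {x : List (Fin k)} :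
    pat.NoMatch x ↔ pat.search.finalRun x = none := by
  rw [NoMatch, Option.eq_none_iff_forall_ne_some]
  constructor
  · intro h r hr
    obtain ⟨pre, v, h1, h2, -⟩ := splits_of_finalRun hr
    exact h ⟨pre, v, _, _, firstMatch_iff.2 ⟨r, hr, h1, h2, rfl, rfl⟩⟩
  · rintro h ⟨pre, v, post, c, hm⟩
    obtain ⟨r, hr, -⟩ := firstMatch_iff.1 hm
    exact h r hr

end StrSL

namespace StrSL

variable {k : ℕ}

/-! ## Congruences of finite index -/

/-- A congruence of finite index on the words over `Fin k`, given by a map to a finite set. -/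
structure Recog (k : ℕ) where
  M : Type
  [fin : Finite M]
  h : List (Fin k) → M
  congr : ∀ {u u' v v'}, h u = h u' → h v = h v' → h (u ++ v) = h (u' ++ v')

attribute [instance] Recog.fin

/-- The value of `f` on a word is determined by the class of the word. -/
def Recog.Det (R : Recog k) {β : Type*} (f : List (Fin k) → β) : Prop :=
  ∀ w w', R.h w = R.h w' → f w = f w'

/-- There is a congruence of index at most `N` that determines `f`. -/
def HasInd {β : Type*} (N : ℕ) (f : List (Fin k) → β) : Prop :=
  ∃ R : Recog k, Nat.card R.M ≤ N ∧ R.Det f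

lemma HasInd.comp {β γ : Type*} {N : ℕ} {f : List (Fin k) → β} {g : List (Fin k) → γ}
    (hf : HasInd N f) (h : ∀ w w', f w = f w' → g w = g w') : HasInd N g := by
  obtain ⟨R, hR, hd⟩ := hf
  exact ⟨R, hR, fun w w' hw => h _ _ (hd _ _ hw)⟩

/-- The product of two congruences. -/
def Recog.prod (R S : Recog k) : Recog k where
  M := R.M × S.M
  h w := (R.h w, S.h w)
  congr h h' := by
    simp only [Prod.mk.injEq] at h h' ⊢
    exact ⟨R.congr h.1 h'.1, S.congr h.2 h'.2⟩

lemma HasInd.prod {β γ : Type*} {N N' : ℕ} {f : List (Fin k) → β} {g : List (Fin k) → γ}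
    (hf : HasInd N f) (hg : HasInd N' g) : HasInd (N * N') (fun w => (f w, g w)) := by
  obtain ⟨R, hR, hd⟩ := hf
  obtain ⟨S, hS, hd'⟩ := hg
  refine ⟨R.prod S, ?_, fun w w' hw => ?_⟩
  · change Nat.card (R.M × S.M) ≤ _
    rw [Nat.card_prod]
    exact Nat.mul_le_mul hR hS
  · have hw : (R.h w, S.h w) = (R.h w', S.h w') := hw
    simp only [Prod.mk.injEq] at hw
    exact Prod.ext (hd _ _ hw.1) (hd' _ _ hw.2)

lemma hasInd_const {β : Type*} (c : β) : HasInd 1 (fun _ : List (Fin k) => c) :=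
  ⟨⟨Unit, fun _ => (), fun _ _ => rfl⟩, by simp, fun _ _ _ => rfl⟩

/-- A map that is compatible with adding letters on the left is determined by a congruence. -/
lemma hasInd_of_left {β : Type} [Finite β] {n : ℕ} (B : List (Fin k) → β)
    (hB : ∀ a w w', B w = B w' → B (a :: w) = B (a :: w')) (hn : Nat.card β ≤ n) :
    HasInd (n ^ n) B := by
  classical
  -- The action of prepending a letter on the values attained by `B`, and the identity on all
  -- others. The class of a word is the composed action of its letters, a map `β → β`; this explains
  -- the bound `n ^ n`.
  let F : Fin k → β → β := fun a b => if h : ∃ w, B w = b then B (a :: h.choose) else b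
  have hF : ∀ a w, F a (B w) = B (a :: w) := by
    intro a w
    have h : ∃ w', B w' = B w := ⟨w, rfl⟩
    simp only [F, dif_pos h]
    exact hB _ _ _ h.choose_spec
  have hfold : ∀ u v, u.foldr F (B v) = B (u ++ v) := by
    intro u v
    induction u with
    | nil => rfl
    | cons a u ih => rw [List.foldr_cons, ih, hF]; rfl
  have : Nonempty β := ⟨B []⟩
  have hpos : 0 < Nat.card β := Nat.card_pos
  refine ⟨⟨β → β, fun w b => w.foldr F b, ?_⟩, ?_, fun w w' hw => ?_⟩
  · intro u u' v v' h h'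
    funext b
    rw [List.foldr_append, List.foldr_append, congrFun h' b, congrFun h _]
  · rw [Nat.card_fun]
    exact (Nat.pow_le_pow_left hn _).trans (Nat.pow_le_pow_right (by omega) hn)
  · have := congrFun hw (B [])
    simpa [hfold] using this

/-- Every class contains a short word. -/
lemma Recog.exists_short (R : Recog k) (w : List (Fin k)) :
    ∃ w', w'.length < Nat.card R.M ∧ R.h w' = R.h w := by
  induction hn : w.length using Nat.strong_induction_on generalizing w with
  | _ n ih =>
    by_cases hlt : w.length < Nat.card R.M
    · exact ⟨w, hlt, rfl⟩
    -- Pigeonhole: a word of length at least the index has more suffixes than there are classes.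
    -- Cutting out the piece between two equivalent suffixes keeps the class.
    · obtain ⟨i, j, hij, he⟩ : ∃ i j : Fin (w.length + 1), i ≠ j ∧
          R.h (w.drop i) = R.h (w.drop j) := by
        by_contra hcon
        push Not at hcon
        have hinj : Function.Injective (fun i : Fin (w.length + 1) => R.h (w.drop i)) :=
          fun i j h => by
            by_contra hne
            exact hcon i j hne h
        have := Nat.card_le_card_of_injective _ hinj
        simp at this
        omega
      wlog hlt : i < j generalizing i j
      · exact this j i hij.symm he.symm (lt_of_le_of_ne (not_lt.1 hlt) hij.symm)
      have hi := i.2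
      have hj := j.2
      have hlt' : (i : ℕ) < j := hlt
      obtain ⟨w', h1, h2⟩ := ih (w.take i ++ w.drop j).length (by simp; omega) _ rfl
      refine ⟨w', h1, h2.trans ?_⟩
      have := R.congr (u := w.take i) (u' := w.take i) rfl he.symm
      rwa [List.take_append_drop] at this

/-! ## Regular languages -/

/-- The bound for the concatenation of two languages. -/
def seqBound (N N' : ℕ) : ℕ := (N * N' * 2 ^ (N * N')) ^ (N * N' * 2 ^ (N * N'))

/-- The bound for the Kleene star of a language. -/
def starBound (N : ℕ) : ℕ := (2 * (N * 2 ^ N)) ^ (2 * (N * 2 ^ N))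

/-- Two values are enough, and `4 = 2 ^ 2` comes from `hasInd_of_left`. -/
lemma hasInd_nil : HasInd 4 (fun w : List (Fin k) => w = []) :=
  (hasInd_of_left (n := 2) (fun w : List (Fin k) => decide (w = [])) (by simp) (by simp)).comp
    fun w w' h => by simpa using h

lemma card_set_le {α : Type} [Finite α] {N : ℕ} (h : Nat.card α ≤ N) :
    Nat.card (Set α) ≤ 2 ^ N := by
  have h2 : Nat.card (Set α) = 2 ^ Nat.card α :=
    (Nat.card_fun (α := α) (β := Prop)).trans (by simp [Nat.card_eq_fintype_card])
  rw [h2]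
  exact Nat.pow_le_pow_right two_pos h

lemma card_prod_le {α β : Type} {N N' : ℕ} (h : Nat.card α ≤ N) (h' : Nat.card β ≤ N') :
    Nat.card (α × β) ≤ N * N' := by
  rw [Nat.card_prod]
  exact Nat.mul_le_mul h h'

lemma card_prod_set {α β : Type} [Finite α] [Finite β] {N N' : ℕ} (h : Nat.card α ≤ N)
    (h' : Nat.card β ≤ N') : Nat.card (α × β × Set (α × β)) ≤ N * N' * 2 ^ (N * N') := by
  rw [mul_assoc]
  exact card_prod_le h (card_prod_le h' (card_set_le (card_prod_le h h')))

/-- Besides the two classes, one keeps the set `X w` of the pairs of classes of all splittings of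
`w`. A splitting of `a :: w` is either in front of `a`, where the class of the whole word is needed,
or comes from a splitting of `w`; so the triple is compatible with adding letters on the left. -/
lemma HasInd.mul {L L' : Language (Fin k)} {N N' : ℕ} (hL : HasInd N (· ∈ L))
    (hL' : HasInd N' (· ∈ L')) : HasInd (seqBound N N') (· ∈ L * L') := by
  obtain ⟨R, hR, hd⟩ := hL
  obtain ⟨S, hS, hd'⟩ := hL'
  let X : List (Fin k) → Set (R.M × S.M) := fun w => {p | ∃ u v, w = u ++ v ∧ p = (R.h u, S.h v)}
  have hX : ∀ a w w', S.h w = S.h w' → X w = X w' → X (a :: w) ⊆ X (a :: w') := by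
    rintro a w w' hS hX p ⟨u, v, h, rfl⟩
    rcases List.cons_eq_append_iff.1 h with ⟨rfl, rfl⟩ | ⟨u', rfl, rfl⟩
    · exact ⟨[], a :: w', rfl, by
        rw [show S.h (a :: w) = S.h (a :: w') from S.congr (u := [a]) (u' := [a]) rfl hS]⟩
    · have : (R.h u', S.h v) ∈ X w' := hX ▸ ⟨u', v, rfl, rfl⟩
      obtain ⟨u₁, v₁, rfl, h⟩ := this
      simp only [Prod.mk.injEq] at h
      refine ⟨a :: u₁, v₁, rfl, ?_⟩
      rw [h.2, show R.h (a :: u') = R.h (a :: u₁) from R.congr (u := [a]) (u' := [a]) rfl h.1]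
  refine (hasInd_of_left (fun w => (R.h w, S.h w, X w)) ?_ (card_prod_set hR hS)).comp ?_
  · intro a w w' h
    simp only [Prod.mk.injEq] at h ⊢
    exact ⟨R.congr (u := [a]) (u' := [a]) rfl h.1, S.congr (u := [a]) (u' := [a]) rfl h.2.1,
      (hX a w w' h.2.1 h.2.2).antisymm (hX a w' w h.2.1.symm h.2.2.symm)⟩
  · have key : ∀ w w', X w = X w' → w ∈ L * L' → w' ∈ L * L' := by
      intro w w' h hw
      obtain ⟨u, hu, v, hv, rfl⟩ := Language.mem_mul.1 hw
      have : (R.h u, S.h v) ∈ X w' := h ▸ ⟨u, v, rfl, rfl⟩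
      obtain ⟨u₁, v₁, rfl, huv⟩ := this
      obtain ⟨h1, h2⟩ := Prod.mk.inj huv
      exact Language.mem_mul.2 ⟨u₁, (hd _ _ h1).mp hu, v₁, (hd' _ _ h2).mp hv, rfl⟩
    intro w w' h
    simp only [Prod.mk.injEq] at h
    exact propext ⟨key w w' h.2.2, key w' w h.2.2.symm⟩

/-- Here `X w` is the set of the classes of those prefixes of `w` whose remainder lies in the star.
A nonempty word of the star begins with a nonempty factor `a :: u`, so `X w` decides whether `a ::
w` is in the star. -/
lemma HasInd.kstar {L : Language (Fin k)} {N : ℕ} (hL : HasInd N (· ∈ L)) :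
    HasInd (starBound N) (· ∈ KStar.kstar L) := by
  obtain ⟨R, hR, hd⟩ := hL
  let X : List (Fin k) → Set R.M := fun w => {p | ∃ u v, w = u ++ v ∧ p = R.h u ∧ v ∈ KStar.kstar L}
  have hcons : ∀ a w, a :: w ∈ KStar.kstar L ↔
      ∃ u v, w = u ++ v ∧ a :: u ∈ L ∧ v ∈ KStar.kstar L := by
    intro a w
    constructor
    · intro h
      obtain ⟨S, hS, hS'⟩ := (Language.mem_kstar_iff_exists_nonempty).1 h
      rcases S with _ | ⟨x, S⟩
      · simp at hS
      · rcases x with _ | ⟨b, x⟩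
        · exact absurd rfl (hS' [] (by simp)).2
        · simp only [List.flatten_cons, List.cons_append, List.cons.injEq] at hS
          obtain ⟨rfl, rfl⟩ := hS
          exact ⟨x, S.flatten, rfl, (hS' _ (by simp)).1, Language.join_mem_kstar
            fun y hy => (hS' y (by simp [hy])).1⟩
    · rintro ⟨u, v, rfl, hu, hv⟩
      have : a :: u ++ v ∈ L * KStar.kstar L := Language.append_mem_mul hu hv
      exact (mul_kstar_le_kstar : L * KStar.kstar L ≤ KStar.kstar L) this
  have hmem : ∀ a w w', X w = X w' → a :: w ∈ KStar.kstar L → a :: w' ∈ KStar.kstar L := by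
    intro a w w' hX h
    obtain ⟨u, v, rfl, hu, hv⟩ := (hcons a w).1 h
    have : R.h u ∈ X w' := hX ▸ ⟨u, v, rfl, rfl, hv⟩
    obtain ⟨u₁, v₁, rfl, h1, h2⟩ := this
    exact (hcons _ _).2 ⟨u₁, v₁, rfl,
      (hd (a :: u) (a :: u₁) (R.congr (u := [a]) (u' := [a]) rfl h1)).mp hu, h2⟩
  have hX : ∀ a w w', X w = X w' → X (a :: w) ⊆ X (a :: w') := by
    rintro a w w' hX p ⟨u, v, h, rfl, hv⟩
    rcases List.cons_eq_append_iff.1 h with ⟨rfl, rfl⟩ | ⟨u', rfl, rfl⟩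
    · exact ⟨[], a :: w', rfl, rfl, hmem a w w' hX hv⟩
    · have : R.h u' ∈ X w' := hX ▸ ⟨u', v, rfl, rfl, hv⟩
      obtain ⟨u₁, v₁, rfl, h, hv₁⟩ := this
      exact ⟨a :: u₁, v₁, rfl, R.congr (u := [a]) (u' := [a]) rfl h, hv₁⟩
  refine (hasInd_of_left (fun w => (w ∈ KStar.kstar L, R.h w, X w)) ?_ (n := 2 * (N * 2 ^ N)) ?_).comp ?_
  · intro a w w' h
    simp only [Prod.mk.injEq] at h ⊢
    exact ⟨propext ⟨hmem a w w' h.2.2, hmem a w' w h.2.2.symm⟩,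
      R.congr (u := [a]) (u' := [a]) rfl h.2.1,
      (hX a w w' h.2.2).antisymm (hX a w' w h.2.2.symm)⟩
  · exact card_prod_le (by simp [Nat.card_eq_fintype_card]) (card_prod_le hR (card_set_le hR))
  · intro w w' h
    simp only [Prod.mk.injEq] at h
    exact h.1

/-- A bound for the index of a congruence that recognizes the language of an expression. -/
def Regex.langBound : Regex k → ℕ
  | .empty => 1
  | .eps => 4
  | .letter _ => 27
  | .group e => e.langBound
  | .alt e₁ e₂ => e₁.langBound * e₂.langBound
  | .seq e₁ e₂ => seqBound e₁.langBound e₂.langBound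
  | .opt _ e => e.langBound * 4
  | .star _ e => starBound e.langBound
  | .plus _ e => seqBound e.langBound (starBound e.langBound)
  | .rep _ m d e => seqBound ((seqBound e.langBound)^[m] 4) ((seqBound (e.langBound * 4))^[d] 4)

lemma HasInd.add {L L' : Language (Fin k)} {N N' : ℕ} (hL : HasInd N (· ∈ L))
    (hL' : HasInd N' (· ∈ L')) : HasInd (N * N') (· ∈ L + L') :=
  (hL.prod hL').comp fun w w' h => by
    simp only [Prod.mk.injEq] at h
    simp only [Language.mem_add, h.1, h.2]

lemma hasInd_one : HasInd 4 (· ∈ (1 : Language (Fin k))) :=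
  hasInd_nil.comp fun w w' h => by simpa [Language.mem_one] using h

lemma HasInd.pow {L : Language (Fin k)} {N : ℕ} (hL : HasInd N (· ∈ L)) (n : ℕ) :
    HasInd ((seqBound N)^[n] 4) (· ∈ L ^ n) := by
  induction n with
  | zero => simpa using hasInd_one
  | succ n ih =>
    rw [Function.iterate_succ_apply', pow_succ']
    exact hL.mul ih

lemma mem_add_one_pow {L : Language (Fin k)} {d : ℕ} {w : List (Fin k)} :
    w ∈ (L + 1) ^ d ↔ ∃ n ≤ d, w ∈ L ^ n := by
  induction d generalizing w with
  | zero => simp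
  | succ d ih =>
    rw [pow_succ', add_mul, one_mul, Language.mem_add, Language.mem_mul, ih]
    constructor
    · rintro (⟨u, hu, v, hv, rfl⟩ | ⟨n, hn, h⟩)
      · obtain ⟨n, hn, h⟩ := ih.1 hv
        exact ⟨n + 1, by omega, by rw [pow_succ']; exact Language.append_mem_mul hu h⟩
      · exact ⟨n, by omega, h⟩
    · rintro ⟨n, hn, h⟩
      rcases n with _ | n
      · exact Or.inr ⟨0, by omega, h⟩
      · rw [pow_succ', Language.mem_mul] at h
        obtain ⟨u, hu, v, hv, rfl⟩ := h
        exact Or.inl ⟨u, hu, v, ih.2 ⟨n, by omega, hv⟩, rfl⟩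

/-- In this form bounded repetition needs only products and powers, both for the congruence and for
the later enumeration of words. -/
lemma Regex.lang_rep (g : Bool) (m d : ℕ) (e : Regex k) :
    (Regex.rep g m d e).lang = e.lang ^ m * (e.lang + 1) ^ d := by
  ext w
  rw [Language.mem_mul]
  constructor
  · rintro ⟨n, h1, h2, hw⟩
    obtain ⟨j, rfl⟩ := Nat.exists_eq_add_of_le h1
    rw [pow_add, Language.mem_mul] at hw
    obtain ⟨u, hu, v, hv, rfl⟩ := hw
    exact ⟨u, hu, v, mem_add_one_pow.2 ⟨j, by omega, hv⟩, rfl⟩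
  · rintro ⟨u, hu, v, hv, rfl⟩
    obtain ⟨j, hj, hv⟩ := mem_add_one_pow.1 hv
    refine ⟨m + j, by omega, by omega, ?_⟩
    rw [pow_add]
    exact Language.append_mem_mul hu hv

lemma Regex.hasInd_lang (e : Regex k) : HasInd e.langBound (· ∈ e.lang) := by
  induction e with
  | empty => exact (hasInd_const False).comp fun w w' _ => rfl
  | eps => exact hasInd_one
  | letter a =>
    -- Three values: the empty word, the word `[a]`, and all others. Hence the bound `27 = 3 ^ 3`.
    refine (hasInd_of_left (n := 3) (fun w : List (Fin k) =>
      (if w = [] then 0 else if w = [a] then 1 else 2 : Fin 3)) ?_ (by simp)).comp ?_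
    · intro b w w' h
      by_cases h1 : w = [] <;> by_cases h2 : w' = [] <;> simp_all <;> split_ifs at h <;> simp at h
    · intro w w' h
      change (w = [a]) = (w' = [a])
      by_cases h1 : w = [a] <;> by_cases h2 : w' = [a] <;> simp_all <;> split_ifs at h <;> simp at h
  | group e ih => exact ih
  | alt e₁ e₂ ih₁ ih₂ => exact ih₁.add ih₂
  | seq e₁ e₂ ih₁ ih₂ => exact ih₁.mul ih₂
  | opt g e ih => exact ih.add hasInd_one
  | star g e ih => exact ih.kstar
  | plus g e ih => exact ih.mul ih.kstar
  | rep g m d e ih =>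
    rw [lang_rep]
    exact (ih.pow m).mul ((ih.add hasInd_one).pow d)

end StrSL

namespace StrSL

variable {k : ℕ}

/-! ## Abstraction of runs -/

lemma Val.toWord_append (a b : Val k) :
    Val.toWord (a ++ b) = (Val.toWord a).bind fun u => (Val.toWord b).map (u ++ ·) := by
  induction a with
  | nil => simp [Val.toWord]
  | cons c a ih =>
    cases c with
    | none => rfl
    | some c =>
      rw [List.cons_append, Val.toWord, Val.toWord, ih]
      cases Val.toWord a <;> cases Val.toWord b <;> simp

/-- The class of the value of a variable, if it is defined. -/
def Recog.abs (R : Recog k) (v : Val k) : Option R.M := (Val.toWord v).map R.h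

lemma Recog.abs_append {R : Recog k} {a a' b b' : Val k} (h : R.abs a = R.abs a')
    (h' : R.abs b = R.abs b') : R.abs (a ++ b) = R.abs (a' ++ b') := by
  unfold Recog.abs at *
  rw [Val.toWord_append, Val.toWord_append]
  revert h h'
  cases Val.toWord a <;> cases Val.toWord a' <;> cases Val.toWord b <;> cases Val.toWord b' <;>
    simp
  exact fun h h' => R.congr h h'

lemma Recog.abs_flatMap {R : Recog k} {α : Type} {l : List α} {f g : α → Val k}
    (h : ∀ c ∈ l, R.abs (f c) = R.abs (g c)) : R.abs (l.flatMap f) = R.abs (l.flatMap g) := by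
  induction l with
  | nil => rfl
  | cons c l ih =>
    rw [List.flatMap_cons, List.flatMap_cons]
    exact abs_append (h c (by simp)) (ih fun c hc => h c (by simp [hc]))

namespace PSST

/-- Assignments only concatenate, and a value is undefined as soon as one of its factors is. So the
classes after a path depend only on the classes before it. -/
lemma abs_eval_congr {T : PSST k} {V : ℕ} (hT : T.Within 0 V) (R : Recog k) (q : T.Q)
    (r : List (Option (Fin k) × T.Q)) {η η' : ℕ → Val k}
    (h : ∀ x < V, R.abs (η x) = R.abs (η' x)) :
    ∀ x < V, R.abs (T.eval η q r x) = R.abs (T.eval η' q r x) := by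
  induction r generalizing q η η' with
  | nil => exact h
  | cons t r ih =>
    obtain ⟨a, q'⟩ := t
    rw [eval_cons, eval_cons]
    refine ih q' fun x hx => Recog.abs_flatMap fun c hc => ?_
    rcases c with y | c
    · exact h y ((hT q a q' x).2 ⟨by omega, hx⟩ y hc).2
    · rfl

lemma eval_append (T : PSST k) (η : ℕ → Val k) (q : T.Q) (f r : List (Option (Fin k) × T.Q)) :
    T.eval η q (f ++ r) = T.eval (T.eval η q f) (T.last q f) r := by
  induction f generalizing q η with
  | nil => rfl
  | cons t f ih => exact ih _ _

/-- The effect of a path on the classes of the values of the variables. -/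
def eff (T : PSST k) (R : Recog k) (V : ℕ) (q : T.Q) (r : List (Option (Fin k) × T.Q)) :
    Set ((Fin V → Option R.M) × (Fin V → Option R.M)) :=
  {p | ∃ η, p = (fun x : Fin V => R.abs (η x), fun x : Fin V => R.abs (T.eval η q r x))}

/-- The effect is the graph of a function by `abs_eval_congr`. Writing it as a set of pairs over a
finite type makes the effects countable. -/
lemma eff_eq_iff {T : PSST k} {R : Recog k} {V : ℕ} (hT : T.Within 0 V) {q : T.Q}
    {r r' : List (Option (Fin k) × T.Q)} : T.eff R V q r = T.eff R V q r' ↔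
      ∀ η, ∀ x < V, R.abs (T.eval η q r x) = R.abs (T.eval η q r' x) := by
  constructor
  · intro h η x hx
    have hm : (fun x : Fin V => R.abs (η x), fun x : Fin V => R.abs (T.eval η q r x)) ∈
      T.eff R V q r' := h ▸ ⟨η, rfl⟩
    obtain ⟨η', h'⟩ := hm
    obtain ⟨h1, h2⟩ := Prod.mk.inj h'
    rw [show R.abs (T.eval η q r x) = R.abs (T.eval η' q r' x) from congrFun h2 ⟨x, hx⟩]
    exact abs_eval_congr hT R q r' (fun y hy => (congrFun h1 ⟨y, hy⟩).symm) x hx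
  · intro h
    ext p
    constructor
    · rintro ⟨η, rfl⟩
      exact ⟨η, Prod.ext rfl (funext fun x => h η x x.2)⟩
    · rintro ⟨η, rfl⟩
      exact ⟨η, Prod.ext rfl (funext fun x => (h η x x.2).symm)⟩

/-- The accepting run from `q` of highest priority. -/
noncomputable def first (T : PSST k) (q : T.Q) (w : List (Fin k)) :
    Option (List (Option (Fin k) × T.Q)) := (T.accs q w).head?

/-- Runs are sorted by the segment up to the first letter and then by the rest. The best run uses
the first segment whose end state admits an accepting run on the remaining word. -/
lemma first_cons (T : PSST k) (q : T.Q) (a : Fin k) (w : List (Fin k)) :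
    T.first q (a :: w) =
      (T.eps (some a) q []).findSome? (fun f => (T.first (T.last q f) w).map (f ++ ·)) := by
  rw [first, accs, List.head?_flatMap]
  simp only [List.head?_map]
  rfl

lemma labels_of_first {T : PSST k} {q : T.Q} {w : List (Fin k)}
    {r : List (Option (Fin k) × T.Q)} (h : T.first q w = some r) : r.filterMap Prod.fst = w :=
  (runFrom_iff.1 (mem_accs.1 (List.mem_of_mem_head? h)).1).2.1

/-- If a transition of the segment starts in `C`, then the letter `a`, which is read at the end of
the segment, and all later letters are behind the match. Otherwise the match has not ended before
the end of the segment. -/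
lemma post_append_of_mem_eps {T : PSST k} (C : T.Q → Bool) {a : Fin k}
    {f : List (Option (Fin k) × T.Q)} {q : T.Q} {used : List (T.Q × T.Q)}
    (hf : f ∈ T.eps (some a) q used) :
    (∀ r, T.post C q (f ++ r) = a :: r.filterMap Prod.fst) ∨
      (∀ r, T.post C q (f ++ r) = T.post C (T.last q f) r) := by
  have hlab : ∀ (f : List (Option (Fin k) × T.Q)) q used, f ∈ T.eps (some a) q used →
      f.filterMap Prod.fst = [a] := by
    intro f
    induction f with
    | nil => intro q used hf; rw [mem_eps] at hf; simp at hf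
    | cons t f ih =>
      intro q used hf
      rcases mem_eps.1 hf with ⟨q', s, h, he, hu, hs⟩ | ⟨b, q', hb, h, he⟩ | ⟨h, -⟩
      · obtain ⟨rfl, rfl⟩ := List.cons.inj h
        simpa using ih _ _ hs
      · obtain ⟨rfl, rfl⟩ := List.cons.inj h
        obtain rfl := Option.some.inj hb
        rfl
      · simp at h
  induction f generalizing q used with
  | nil => rw [mem_eps] at hf; simp at hf
  | cons t f ih =>
    cases hC : C q with
    | true =>
      left
      intro r
      rw [post_of_mem hC, List.filterMap_append, hlab _ _ _ hf]
      rfl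
    | false =>
      simp only [List.cons_append, post_cons hC]
      rcases mem_eps.1 hf with ⟨q', s, h, he, hu, hs⟩ | ⟨b, q', hb, h, he⟩ | ⟨h, -⟩
      · obtain ⟨rfl, rfl⟩ := List.cons.inj h
        exact ih hs
      · obtain ⟨rfl, rfl⟩ := List.cons.inj h
        right
        intro r
        rfl
      · simp at h

section Profile

variable (T : PSST k) (R : Recog k) (V : ℕ) (C : T.Q → Bool) {κ : Type} (K : List (Fin k) → κ)

/-- For every state, what is known about the accepting run on a word: its effect on the
variables, and a property of the part of the word that is read behind the match. -/
noncomputable def profile (w : List (Fin k)) (q : T.Q) :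
    Option (Set ((Fin V → Option R.M) × (Fin V → Option R.M)) × κ) :=
  (T.first q w).map fun r => (T.eff R V q r, K (T.post C q r))

variable {T R V C K}

lemma first_cons_congr (hT : T.Within 0 V) {w w' : List (Fin k)}
    (h : T.profile R V C K w = T.profile R V C K w') (q : T.Q) (a : Fin k) :
    (T.first q (a :: w) = none ∧ T.first q (a :: w') = none) ∨
    ∃ r r', T.first q (a :: w) = some r ∧ T.first q (a :: w') = some r' ∧
      T.eff R V q r = T.eff R V q r' ∧
      ((T.post C q r = a :: w ∧ T.post C q r' = a :: w') ∨
        K (T.post C q r) = K (T.post C q r')) := by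
  simp only [first_cons]
  -- The list of candidates is generalized for the induction, while it is remembered that its
  -- members are segments from `q`.
  have hsub : ∀ f ∈ T.eps (some a) q [], f ∈ T.eps (some a) q [] := fun _ h => h
  generalize hl : T.eps (some a) q [] = l at hsub ⊢
  nth_rw 2 [← hl] at hsub
  clear hl
  induction l with
  | nil => exact Or.inl ⟨rfl, rfl⟩
  | cons f l ih =>
    have hf := congrFun h (T.last q f)
    simp only [profile] at hf
    simp only [List.findSome?_cons]
    cases h1 : T.first (T.last q f) w with
    | none =>
      rw [h1, Option.map_none] at hf
      have h2 : T.first (T.last q f) w' = none := by simpa using hf.symm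
      rw [h2]
      exact ih fun f hf => hsub f (by simp [hf])
    | some r =>
      rw [h1, Option.map_some] at hf
      obtain ⟨r', h2, h3⟩ := Option.map_eq_some_iff.1 hf.symm
      rw [h2]
      simp only [Prod.mk.injEq] at h3
      refine Or.inr ⟨f ++ r, f ++ r', rfl, rfl, ?_, ?_⟩
      · rw [eff_eq_iff hT] at h3 ⊢
        intro η x hx
        rw [eval_append, eval_append]
        exact (h3.1 _ x hx).symm
      · rcases post_append_of_mem_eps C (hsub f (by simp)) with h4 | h4
        · left
          rw [h4, h4, labels_of_first h1, labels_of_first h2]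
          exact ⟨rfl, rfl⟩
        · right
          rw [h4, h4, h3.2]

lemma profile_cons_congr (hT : T.Within 0 V) {w w' : List (Fin k)} (a : Fin k)
    (h : T.profile R V C K w = T.profile R V C K w') (hK : K (a :: w) = K (a :: w')) :
    T.profile R V C K (a :: w) = T.profile R V C K (a :: w') := by
  funext q
  rw [profile, profile]
  rcases first_cons_congr hT h q a with ⟨h1, h2⟩ | ⟨r, r', h1, h2, h3, h4⟩
  · rw [h1, h2]
  · rw [h1, h2, Option.map_some, Option.map_some, h3]
    rcases h4 with ⟨h4, h5⟩ | h4
    · rw [h4, h5, hK]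
    · rw [h4]

end Profile

/-- A bound for the number of profiles. -/
def profileCount (N V q c : ℕ) : ℕ := c * (2 ^ ((N + 1) ^ V * (N + 1) ^ V) * c + 1) ^ q

/-- A bound for the index of the congruence that determines the profile. -/
def profileBound (N V q c : ℕ) : ℕ := profileCount N V q c ^ profileCount N V q c

lemma card_option_le {α : Type} [Finite α] {N : ℕ} (h : Nat.card α ≤ N) :
    Nat.card (Option α) ≤ N + 1 := by
  rw [Finite.card_option]; omega

lemma card_fun_le {α β : Type} [Finite α] [Finite β] [Nonempty β] {N N' : ℕ} (h : Nat.card α ≤ N)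
    (h' : Nat.card β ≤ N') : Nat.card (α → β) ≤ N' ^ N := by
  rw [Nat.card_fun]
  exact (Nat.pow_le_pow_left h' _).trans
    (Nat.pow_le_pow_right (Nat.card_pos.trans_le h') h)

/-- The property `K` need not be compatible with adding letters by itself: its value on `a :: w` may
depend on the profile of `w`, while the profile in turn contains values of `K`. This mutual
recursion is what `replaceAll` requires. -/
lemma hasInd_profile {T : PSST k} {R : Recog k} {V : ℕ} {C : T.Q → Bool} {κ : Type} [Finite κ]
    {K : List (Fin k) → κ} (hT : T.Within 0 V) {N q c : ℕ} (hR : Nat.card R.M ≤ N)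
    (hq : Nat.card T.Q ≤ q) (hκ : Nat.card κ ≤ c)
    (hK : ∀ a w w', K w = K w' → T.profile R V C K w = T.profile R V C K w' →
      K (a :: w) = K (a :: w')) :
    HasInd (profileBound N V q c) (fun w => (K w, T.profile R V C K w)) := by
  have hM : Nat.card (Fin V → Option R.M) ≤ (N + 1) ^ V :=
    card_fun_le (by simp) (card_option_le hR)
  refine hasInd_of_left _ (fun a w w' h => ?_) (card_prod_le hκ (card_fun_le hq
    (card_option_le (card_prod_le (card_set_le (card_prod_le hM hM)) hκ))))
  simp only [Prod.mk.injEq] at h ⊢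
  have := hK a w w' h.1 h.2
  exact ⟨this, profile_cons_congr hT a h.2 this⟩

end PSST

lemma Regex.finalRun_eq (e : Regex k) (w : List (Fin k)) :
    e.finalRun w = (e.toPSST 0).first (e.toPSST 0).start w := rfl

lemma Regex.within_size (e : Regex k) : (e.toPSST 0).Within 0 e.size := by
  simpa using e.within_toPSST 0

lemma Regex.lt_of_mem_groups {e : Regex k} {n x : ℕ} (h : x ∈ e.groups n) : x < n + e.size := by
  induction e generalizing n with
  | empty => simp [groups] at h
  | eps => simp [groups] at h
  | letter a => simp [groups] at h
  | group e ih =>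
    simp only [groups, List.mem_cons, size] at h ⊢
    rcases h with rfl | h
    · omega
    · have := ih h; omega
  | alt e₁ e₂ ih₁ ih₂ =>
    simp only [groups, List.mem_append, size] at h ⊢
    rcases h with h | h
    · have := ih₁ h; omega
    · have := ih₂ h; omega
  | seq e₁ e₂ ih₁ ih₂ =>
    simp only [groups, List.mem_append, size] at h ⊢
    rcases h with h | h
    · have := ih₁ h; omega
    · have := ih₂ h; omega
  | opt g e ih => have := ih h; simp only [size]; omega
  | star g e ih => have := ih h; simp only [size]; omega
  | plus g e ih => have := ih h; simp only [size]; omega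
  | rep g m d e ih => have := ih h; simp only [size]; omega

lemma Regex.capt_congr {e : Regex k} {R : Recog k}
    {r r' : List (Option (Fin k) × (e.toPSST 0).Q)}
    (h : (e.toPSST 0).eff R e.size (e.toPSST 0).start r =
      (e.toPSST 0).eff R e.size (e.toPSST 0).start r') (i : ℕ) :
    (e.capt r i).map R.h = (e.capt r' i).map R.h := by
  rw [PSST.eff_eq_iff e.within_size] at h
  unfold capt
  cases hx : (e.groups 0)[i]? with
  | none => rfl
  | some x =>
    have := lt_of_mem_groups (List.mem_of_getElem? hx)
    exact h _ x (by omega)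

/-! ## The functions of the constraint language -/

/-- The function `extract`. -/
noncomputable def Regex.ext (i : ℕ) (e : Regex k) (x : List (Fin k)) : Option (List (Fin k)) :=
  (e.finalRun x).bind fun r => if i = 0 then some x else e.capt r (i - 1)

lemma extract_iff {i : ℕ} {e : Regex k} {x y : List (Fin k)} :
    Extract i e x y ↔ e.ext i x = some y := by
  simp only [Extract, Regex.matches_iff, Regex.ext]
  constructor
  · rintro ⟨c, ⟨r, hr, h0, hc⟩, hy⟩
    rw [hr, Option.bind_some]
    rcases i with _ | i
    · rw [if_pos rfl, ← hy, h0]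
    · rw [if_neg (by omega), ← hy, hc]; rfl
  · intro h
    obtain ⟨r, hr, h⟩ := Option.bind_eq_some_iff.1 h
    refine ⟨fun i => Nat.casesOn i (some x) fun i => e.capt r i, ⟨r, hr, rfl, fun i => rfl⟩, ?_⟩
    rcases i with _ | i
    · exact h
    · exact h

lemma Regex.hasInd_ext (i : ℕ) (e : Regex k) {R : Recog k} {N q : ℕ} (hR : Nat.card R.M ≤ N)
    (hq : Nat.card (e.toPSST 0).Q ≤ q) :
    HasInd (PSST.profileBound N e.size q N) (fun x => (e.ext i x).map R.h) := by
  -- There is no text behind a match here, so `C` is empty. Taking the class of the word for `K`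
  -- settles the case `i = 0`.
  refine (PSST.hasInd_profile (T := e.toPSST 0) (R := R) (C := fun _ => false) (K := R.h)
    e.within_size hR hq hR (fun a w w' h _ => R.congr (u := [a]) (u' := [a]) rfl h)).comp ?_
  intro w w' h
  simp only [Prod.mk.injEq] at h
  have h2 := congrFun h.2 (e.toPSST 0).start
  rw [PSST.profile, PSST.profile, ← finalRun_eq, ← finalRun_eq] at h2
  unfold ext
  cases h3 : e.finalRun w with
  | none =>
    rw [h3] at h2
    rw [show e.finalRun w' = none by simpa using h2.symm]
    rfl
  | some r =>
    rw [h3, Option.map_some] at h2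
    obtain ⟨r', h4, h5⟩ := Option.map_eq_some_iff.1 h2.symm
    simp only [Prod.mk.injEq] at h5
    rw [h4, Option.bind_some, Option.bind_some]
    split_ifs
    · simp [h.1]
    · exact capt_congr h5.1.symm _

end StrSL

/-! ### The replacement functions -/

namespace StrSL

variable {k : ℕ}

/-- The first match of a pattern, as a function: the text before the match, the match, the text
behind the match, and the captures. -/
noncomputable def Regex.firstMatch (pat : Regex k) (x : List (Fin k)) :
    Option (List (Fin k) × List (Fin k) × List (Fin k) × (ℕ → Option (List (Fin k)))) :=
  (pat.search.finalRun x).map fun r => ((pat.search.capt r 0).getD [],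
    (pat.search.capt r 1).getD [],
    (pat.search.toPSST 0).post pat.searchLast (pat.search.toPSST 0).start r,
    fun i => pat.search.capt r (i + 1))

lemma Regex.firstMatch_eq_some {pat : Regex k} {x pre v post : List (Fin k)}
    {c : ℕ → Option (List (Fin k))} :
    pat.firstMatch x = some (pre, v, post, c) ↔ pat.FirstMatch x pre v post c := by
  rw [firstMatch_iff, firstMatch, Option.map_eq_some_iff]
  refine exists_congr fun r => and_congr_right fun hr => ?_
  obtain ⟨pre', v', h1, h2, -⟩ := splits_of_finalRun hr
  rw [h1, h2]
  simp [eq_comm]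

lemma Regex.firstMatch_eq_none {pat : Regex k} {x : List (Fin k)} :
    pat.firstMatch x = none ↔ pat.NoMatch x := by
  rw [noMatch_iff, firstMatch, Option.map_eq_none_iff]

lemma Regex.split_of_firstMatch {pat : Regex k} {x pre v post : List (Fin k)}
    {c : ℕ → Option (List (Fin k))} (h : pat.firstMatch x = some (pre, v, post, c)) :
    x = pre ++ v ++ post := by
  obtain ⟨d, -, -, -, h, -⟩ := firstMatch_eq_some.1 h
  exact h

/-- The function `replace`. -/
noncomputable def Regex.repl (pat : Regex k) (rep : List (RepSym k)) (x : List (Fin k)) :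
    List (Fin k) :=
  (pat.firstMatch x).elim x fun m => m.1 ++ instRep rep m.2.2.2 m.1 m.2.2.1 ++ m.2.2.1

lemma replace_iff {pat : Regex k} {rep : List (RepSym k)} {x y : List (Fin k)} :
    Replace pat rep x y ↔ y = pat.repl rep x := by
  rw [Replace, Regex.repl]
  cases h : pat.firstMatch x with
  | none =>
    rw [← Regex.firstMatch_eq_none]
    simp only [← Regex.firstMatch_eq_some, h]
    simp
  | some m =>
    obtain ⟨pre, v, post, c⟩ := m
    rw [← Regex.firstMatch_eq_none]
    simp only [← Regex.firstMatch_eq_some, h]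
    simp only [Option.some.injEq, Prod.mk.injEq, reduceCtorEq, false_and, or_false,
      Option.elim_some]
    constructor
    · rintro ⟨_, _, _, _, ⟨rfl, rfl, rfl, rfl⟩, h⟩
      exact h
    · exact fun h => ⟨_, _, _, _, ⟨rfl, rfl, rfl, rfl⟩, h⟩

/-- The result of replacing at most `n` matches. -/
noncomputable def Regex.replIter (pat : Regex k) (rep : List (RepSym k)) :
    ℕ → List (Fin k) → List (Fin k) → List (Fin k)
  | 0, _, _ => []
  | n + 1, u, x => (pat.firstMatch x).elim x fun m =>
      m.1 ++ instRep rep m.2.2.2 (u ++ m.1) m.2.2.1 ++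
        if m.2.1 = [] then
          if m.2.2.1 = [] then [] else m.2.2.1.take 1 ++
            pat.replIter rep n (u ++ m.1 ++ m.2.2.1.take 1) (m.2.2.1.drop 1)
        else pat.replIter rep n (u ++ m.1 ++ m.2.1) m.2.2.1

/-- The function `replaceAll` on a suffix of the input. -/
noncomputable def Regex.replFrom (pat : Regex k) (rep : List (RepSym k)) (u x : List (Fin k)) :
    -- Every round but the last consumes a letter, by a nonempty match or by copying the letter
    -- behind an empty one.
    List (Fin k) := pat.replIter rep (x.length + 1) u x

lemma Regex.replaceFrom_replIter (pat : Regex k) (rep : List (RepSym k)) {n : ℕ}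
    {u x : List (Fin k)} (hn : x.length < n) : ReplaceFrom pat rep u x (pat.replIter rep n u x) := by
  induction n generalizing u x with
  | zero => omega
  | succ n ih =>
    rw [replIter]
    cases h : pat.firstMatch x with
    | none => exact .done u x (firstMatch_eq_none.1 h)
    | some m =>
      obtain ⟨pre, v, post, c⟩ := m
      have hs := split_of_firstMatch h
      have hlen := congrArg List.length hs
      simp only [List.length_append] at hlen
      have hm := firstMatch_eq_some.1 h
      simp only [Option.elim_some]
      rcases v with _ | ⟨b, v⟩
      · rcases post with _ | ⟨a, post⟩
        · simpa using ReplaceFrom.emptyEnd (rep := rep) u x pre c hm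
        · simp only [if_true, reduceCtorEq, if_false, List.take_succ_cons, List.take_zero,
            List.drop_succ_cons, List.drop_zero]
          exact .empty u x pre post _ a c hm (ih (by simp at hlen; omega))
      · simp only [reduceCtorEq, if_false]
        exact .nonempty u x pre (b :: v) post _ c hm (by simp) (ih (by simp at hlen; omega))

/-- The rules of `ReplaceFrom` exclude each other because the first match is a function of the
input. So the result is unique and does not depend on `n`, once `n` exceeds the length. -/
lemma Regex.eq_replIter {pat : Regex k} {rep : List (RepSym k)} {u x y : List (Fin k)}
    (h : ReplaceFrom pat rep u x y) {n : ℕ} (hn : x.length < n) : y = pat.replIter rep n u x := by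
  induction h generalizing n with
  | done u x hx =>
    obtain ⟨n, rfl⟩ := Nat.exists_eq_succ_of_ne_zero (by omega : n ≠ 0)
    rw [replIter, firstMatch_eq_none.2 hx]
    rfl
  | nonempty u x pre v post y c hm hv hr ih =>
    obtain ⟨n, rfl⟩ := Nat.exists_eq_succ_of_ne_zero (by omega : n ≠ 0)
    have hm := firstMatch_eq_some.2 hm
    have hlen := congrArg List.length (split_of_firstMatch hm)
    have := List.length_pos_of_ne_nil hv
    simp only [List.length_append] at hlen
    rw [replIter, hm, Option.elim_some, if_neg hv, ih (n := n) (by omega)]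
  | empty u x pre post y a c hm hr ih =>
    obtain ⟨n, rfl⟩ := Nat.exists_eq_succ_of_ne_zero (by omega : n ≠ 0)
    have hm := firstMatch_eq_some.2 hm
    have hlen := congrArg List.length (split_of_firstMatch hm)
    simp only [List.length_append, List.length_cons] at hlen
    rw [replIter, hm, Option.elim_some, ih (n := n) (by omega)]
    simp
  | emptyEnd u x pre c hm =>
    obtain ⟨n, rfl⟩ := Nat.exists_eq_succ_of_ne_zero (by omega : n ≠ 0)
    rw [replIter, firstMatch_eq_some.2 hm]
    simp

lemma Regex.replaceFrom_iff {pat : Regex k} {rep : List (RepSym k)} {u x y : List (Fin k)} :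
    ReplaceFrom pat rep u x y ↔ y = pat.replFrom rep u x :=
  ⟨fun h => eq_replIter h (Nat.lt_succ_self _), fun h => h ▸ replaceFrom_replIter _ _ (by omega)⟩

lemma Regex.replIter_eq_replFrom {pat : Regex k} {rep : List (RepSym k)} {u x : List (Fin k)}
    {n : ℕ} (hn : x.length < n) : pat.replIter rep n u x = pat.replFrom rep u x :=
  (eq_replIter (replaceFrom_iff.2 rfl) hn).symm

/-- Unfolding `replFrom`. -/
lemma Regex.replFrom_eq (pat : Regex k) (rep : List (RepSym k)) (u x : List (Fin k)) :
    pat.replFrom rep u x = (pat.firstMatch x).elim x fun m =>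
      m.1 ++ instRep rep m.2.2.2 (u ++ m.1) m.2.2.1 ++
        if m.2.1 = [] then
          if m.2.2.1 = [] then [] else m.2.2.1.take 1 ++
            pat.replFrom rep (u ++ m.1 ++ m.2.2.1.take 1) (m.2.2.1.drop 1)
        else pat.replFrom rep (u ++ m.1 ++ m.2.1) m.2.2.1 := by
  rw [replFrom, replIter]
  cases h : pat.firstMatch x with
  | none => rfl
  | some m =>
    obtain ⟨pre, v, post, c⟩ := m
    have hlen := congrArg List.length (split_of_firstMatch h)
    simp only [List.length_append] at hlen
    simp only [Option.elim_some]
    split_ifs with h1 h2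
    · rfl
    · have := List.length_pos_of_ne_nil h2
      rw [replIter_eq_replFrom (by simp; omega)]
    · have := List.length_pos_of_ne_nil h1
      rw [replIter_eq_replFrom (by omega)]

/-! ## Recognizing the results of replacements -/

lemma Recog.flatMap_congr {R : Recog k} {α : Type} {l : List α} {f g : α → List (Fin k)}
    (h : ∀ c ∈ l, R.h (f c) = R.h (g c)) : R.h (l.flatMap f) = R.h (l.flatMap g) := by
  induction l with
  | nil => rfl
  | cons c l ih =>
    rw [List.flatMap_cons, List.flatMap_cons]
    exact R.congr (h c (by simp)) (ih fun c hc => h c (by simp [hc]))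

/-- The classes of the captures include whether they are defined; an undefined capture contributes
the empty word on both sides. -/
lemma instRep_congr {R : Recog k} (rep : List (RepSym k)) {c c' : ℕ → Option (List (Fin k))}
    {pre pre' post post' : List (Fin k)} (hc : ∀ i, (c i).map R.h = (c' i).map R.h)
    (hpre : R.h pre = R.h pre') (hpost : R.h post = R.h post') :
    R.h (instRep rep c pre post) = R.h (instRep rep c' pre' post') := by
  refine Recog.flatMap_congr fun s _ => ?_
  cases s with
  | letter a => rfl
  | ref i =>
    have := hc i
    simp only [RepSym.value]
    revert this
    cases c i <;> cases c' i <;> simp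
  | before => exact hpre
  | after => exact hpost

/-- Two matches that cannot be distinguished by the congruence. -/
structure SimMatch (R : Recog k)
    (m m' : List (Fin k) × List (Fin k) × List (Fin k) × (ℕ → Option (List (Fin k)))) : Prop where
  pre : R.h m.1 = R.h m'.1
  mat : R.h m.2.1 = R.h m'.2.1
  post : R.h m.2.2.1 = R.h m'.2.2.1
  capt : ∀ i, (m.2.2.2 i).map R.h = (m'.2.2.2 i).map R.h

/-- The input and output classes of replacing all matches in `x`, behind all possible words. -/
def Regex.replRel (pat : Regex k) (rep : List (RepSym k)) (R : Recog k) (x : List (Fin k)) :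
    Set (R.M × R.M) := {p | ∃ u, p = (R.h u, R.h (pat.replFrom rep u x))}

section

variable {pat : Regex k} {rep : List (RepSym k)} {R : Recog k}

/-- One round of replacing on both sides. As the congruence recognizes emptiness, both sides take
the same branch; `h1` and `h2` then deal with the remaining input after an empty and after a
nonempty match. -/
lemma Regex.replFrom_congr_of_match (hR : R.Det (fun w => w = [])) {x x' : List (Fin k)}
    {m m' : List (Fin k) × List (Fin k) × List (Fin k) × (ℕ → Option (List (Fin k)))}
    (hm : pat.firstMatch x = some m) (hm' : pat.firstMatch x' = some m') (hs : SimMatch R m m')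
    (h1 : m.2.1 = [] → m.2.2.1 ≠ [] → R.h (m.2.2.1.take 1) = R.h (m'.2.2.1.take 1) ∧
      ∀ u u', R.h u = R.h u' →
      R.h (pat.replFrom rep u (m.2.2.1.drop 1)) = R.h (pat.replFrom rep u' (m'.2.2.1.drop 1)))
    (h2 : m.2.1 ≠ [] → ∀ u u', R.h u = R.h u' →
      R.h (pat.replFrom rep u m.2.2.1) = R.h (pat.replFrom rep u' m'.2.2.1))
    {u u' : List (Fin k)} (hu : R.h u = R.h u') :
    R.h (pat.replFrom rep u x) = R.h (pat.replFrom rep u' x') := by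
  rw [replFrom_eq, replFrom_eq, hm, hm', Option.elim_some, Option.elim_some]
  have hv : m.2.1 = [] ↔ m'.2.1 = [] := (hR _ _ hs.mat).to_iff
  have hp : m.2.2.1 = [] ↔ m'.2.2.1 = [] := (hR _ _ hs.post).to_iff
  refine R.congr (R.congr hs.pre (instRep_congr rep hs.capt (R.congr hu hs.pre) hs.post)) ?_
  by_cases hv1 : m.2.1 = []
  · rw [if_pos hv1, if_pos (hv.1 hv1)]
    by_cases hp1 : m.2.2.1 = []
    · rw [if_pos hp1, if_pos (hp.1 hp1)]
    · rw [if_neg hp1, if_neg (mt hp.2 hp1)]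
      obtain ⟨h3, h4⟩ := h1 hv1 hp1
      exact R.congr h3 (h4 _ _ (R.congr (R.congr hu hs.pre) h3))
  · rw [if_neg hv1, if_neg (mt hv.2 hv1)]
    exact h2 hv1 _ _ (R.congr (R.congr hu hs.pre) hs.mat)

/-- The text `u` enters only through the reference to the text before a match, hence only with its
class. The induction is on the length of `x`, which decreases in each round. -/
lemma Regex.replFrom_congr_left (hR : R.Det (fun w => w = [])) (x : List (Fin k))
    {u u' : List (Fin k)} (hu : R.h u = R.h u') :
    R.h (pat.replFrom rep u x) = R.h (pat.replFrom rep u' x) := by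
  induction hn : x.length using Nat.strong_induction_on generalizing x u u' with
  | _ n ih =>
    cases hm : pat.firstMatch x with
    | none => rw [replFrom_eq, replFrom_eq, hm]; rfl
    | some m =>
      obtain ⟨pre, v, post, c⟩ := m
      have hlen := congrArg List.length (split_of_firstMatch hm)
      simp only [List.length_append] at hlen
      refine replFrom_congr_of_match hR hm hm ⟨rfl, rfl, rfl, fun _ => rfl⟩ ?_ ?_ hu
      · intro _ h
        have := List.length_pos_of_ne_nil h
        change 0 < post.length at this
        exact ⟨rfl, fun u u' hu => ih _ (by simp; omega) _ hu rfl⟩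
      · intro h u u' hu
        have := List.length_pos_of_ne_nil h
        exact ih _ (by simp only at this ⊢; omega) _ hu rfl

/-- The relation is functional on classes by `replFrom_congr_left`, so its equality can be tested
with arbitrary equivalent `u` and `u'`. -/
lemma Regex.replRel_eq_iff (hR : R.Det (fun w => w = [])) {x x' : List (Fin k)} :
    pat.replRel rep R x = pat.replRel rep R x' ↔ ∀ u u', R.h u = R.h u' →
      R.h (pat.replFrom rep u x) = R.h (pat.replFrom rep u' x') := by
  constructor
  · intro h u u' hu
    have hm : (R.h u, R.h (pat.replFrom rep u x)) ∈ pat.replRel rep R x' := h ▸ ⟨u, rfl⟩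
    obtain ⟨v, hv⟩ := hm
    obtain ⟨h1, h2⟩ := Prod.mk.inj hv
    rw [h2]
    exact replFrom_congr_left hR x' (h1.symm.trans hu)
  · intro h
    ext p
    constructor
    · rintro ⟨u, rfl⟩
      exact ⟨u, Prod.ext rfl (h u u rfl)⟩
    · rintro ⟨u, rfl⟩
      exact ⟨u, Prod.ext rfl (h u u rfl).symm⟩

/-- What has to be known about the part of a word behind the first match. -/
def Regex.restInfo (pat : Regex k) (rep : List (RepSym k)) (R : Recog k) (x : List (Fin k)) :
    R.M × Set (R.M × R.M) × R.M × Set (R.M × R.M) :=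
  -- The first two components serve after a nonempty match; the other two after an empty match,
  -- where a letter is copied before the search goes on.
  (R.h x, pat.replRel rep R x, R.h (x.take 1), pat.replRel rep R (x.drop 1))

/-- A bound for the number of values of `restInfo`. -/
def restCount (N : ℕ) : ℕ := N * (2 ^ (N * N) * (N * 2 ^ (N * N)))

lemma Regex.simMatch_of_eff {r r' : List (Option (Fin k) × (pat.search.toPSST 0).Q)}
    (h : (pat.search.toPSST 0).eff R pat.search.size (pat.search.toPSST 0).start r =
      (pat.search.toPSST 0).eff R pat.search.size (pat.search.toPSST 0).start r')
    {x x' : List (Fin k)} (hx : pat.search.finalRun x = some r)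
    (hx' : pat.search.finalRun x' = some r')
    (hp : R.h ((pat.search.toPSST 0).post pat.searchLast (pat.search.toPSST 0).start r) =
      R.h ((pat.search.toPSST 0).post pat.searchLast (pat.search.toPSST 0).start r')) :
    SimMatch R ((pat.search.capt r 0).getD [], (pat.search.capt r 1).getD [],
      (pat.search.toPSST 0).post pat.searchLast (pat.search.toPSST 0).start r,
      fun i => pat.search.capt r (i + 1)) ((pat.search.capt r' 0).getD [],
      (pat.search.capt r' 1).getD [],
      (pat.search.toPSST 0).post pat.searchLast (pat.search.toPSST 0).start r',
      fun i => pat.search.capt r' (i + 1)) := by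
  obtain ⟨pre, v, h1, h2, -⟩ := splits_of_finalRun hx
  obtain ⟨pre', v', h1', h2', -⟩ := splits_of_finalRun hx'
  have h0 := capt_congr h 0
  have h3 := capt_congr h 1
  rw [h1, h1'] at h0
  rw [h2, h2'] at h3
  refine ⟨?_, ?_, hp, fun i => capt_congr h (i + 1)⟩
  · rw [h1, h1']; exact Option.some.inj h0
  · rw [h2, h2']; exact Option.some.inj h3

/-- The crucial step for `replaceAll`. The text behind the first match in `a :: w` is either all of
`a :: w`, so that the match is empty and the search goes on in `w`, or its `restInfo` is contained
in the profile of `w`. In both cases the result of the further replacements is already known up to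
the congruence. -/
lemma Regex.restInfo_cons_congr (hR : R.Det (fun w => w = [])) (a : Fin k) {w w' : List (Fin k)}
    (h : pat.restInfo rep R w = pat.restInfo rep R w')
    (hB : (pat.search.toPSST 0).profile R pat.search.size pat.searchLast (pat.restInfo rep R) w =
      (pat.search.toPSST 0).profile R pat.search.size pat.searchLast (pat.restInfo rep R) w') :
    pat.restInfo rep R (a :: w) = pat.restInfo rep R (a :: w') := by
  have hw : R.h (a :: w) = R.h (a :: w') :=
    R.congr (u := [a]) (u' := [a]) rfl (Prod.mk.inj h).1
  have hr : pat.replRel rep R w = pat.replRel rep R w' := (Prod.mk.inj (Prod.mk.inj h).2).1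
  have hrel : pat.replRel rep R (a :: w) = pat.replRel rep R (a :: w') := by
    rw [replRel_eq_iff hR]
    intro u u' hu
    rcases PSST.first_cons_congr pat.search.within_size hB (pat.search.toPSST 0).start a with
      ⟨h1, h2⟩ | ⟨r, r', h1, h2, h3, h4⟩
    · have h1' : pat.firstMatch (a :: w) = none := by
        rw [firstMatch, finalRun_eq, h1]; rfl
      have h2' : pat.firstMatch (a :: w') = none := by
        rw [firstMatch, finalRun_eq, h2]; rfl
      rw [replFrom_eq, replFrom_eq, h1', h2']
      exact hw
    · have h1' := congrArg (Option.map fun r => ((pat.search.capt r 0).getD [],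
        (pat.search.capt r 1).getD [],
        (pat.search.toPSST 0).post pat.searchLast (pat.search.toPSST 0).start r,
        fun i => pat.search.capt r (i + 1))) h1
      have h2' := congrArg (Option.map fun r => ((pat.search.capt r 0).getD [],
        (pat.search.capt r 1).getD [],
        (pat.search.toPSST 0).post pat.searchLast (pat.search.toPSST 0).start r,
        fun i => pat.search.capt r (i + 1))) h2
      have hpost : R.h ((pat.search.toPSST 0).post pat.searchLast (pat.search.toPSST 0).start r) =
          R.h ((pat.search.toPSST 0).post pat.searchLast (pat.search.toPSST 0).start r') := by
        rcases h4 with ⟨h4, h5⟩ | h4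
        · rw [h4, h5, hw]
        · exact (Prod.mk.inj h4).1
      refine replFrom_congr_of_match hR h1' h2' (simMatch_of_eff h3 h1 h2 hpost) ?_ ?_ hu
      · intro _ _
        rcases h4 with ⟨h4, h5⟩ | h4
        -- The empty match stands in front of `a`: this letter is copied, and `w` and `w'` remain.
        · simp only [h4, h5]
          exact ⟨rfl, (replRel_eq_iff hR).1 hr⟩
        · have h5 := (Prod.mk.inj (Prod.mk.inj h4).2).2
          exact ⟨(Prod.mk.inj h5).1, (replRel_eq_iff hR).1 (Prod.mk.inj h5).2⟩
      · intro hv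
        rcases h4 with ⟨h4, -⟩ | h4
        -- If the text behind the match is the whole word, the match cannot be nonempty, by
        -- comparing lengths.
        · exfalso
          have hs := split_of_firstMatch h1'
          rw [h4] at hs
          have := congrArg List.length hs
          have := List.length_pos_of_ne_nil hv
          simp at *
          omega
        · exact (replRel_eq_iff hR).1 (Prod.mk.inj (Prod.mk.inj h4).2).1
  simp only [restInfo, List.take_succ_cons, List.take_zero, List.drop_succ_cons, List.drop_zero,
    hw, hrel, hr]

lemma Regex.hasInd_restInfo (hR : R.Det (fun w => w = [])) {N q : ℕ} (hN : Nat.card R.M ≤ N)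
    (hq : Nat.card (pat.search.toPSST 0).Q ≤ q) :
    HasInd (PSST.profileBound N pat.search.size q (restCount N)) (fun w => (pat.restInfo rep R w,
      (pat.search.toPSST 0).profile R pat.search.size pat.searchLast (pat.restInfo rep R) w)) := by
  have hset : Nat.card (Set (R.M × R.M)) ≤ 2 ^ (N * N) := card_set_le (card_prod_le hN hN)
  exact PSST.hasInd_profile pat.search.within_size hN hq
    (card_prod_le hN (card_prod_le hset (card_prod_le hN hset)))
    fun a w w' h hB => restInfo_cons_congr hR a h hB

lemma Regex.hasInd_replaceAll (hR : R.Det (fun w => w = [])) {N q : ℕ} (hN : Nat.card R.M ≤ N)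
    (hq : Nat.card (pat.search.toPSST 0).Q ≤ q) :
    HasInd (PSST.profileBound N pat.search.size q (restCount N))
      (fun x => R.h (pat.replFrom rep [] x)) :=
  (hasInd_restInfo hR hN hq).comp fun _ _ h =>
    (replRel_eq_iff hR).1 (Prod.mk.inj (Prod.mk.inj (Prod.mk.inj h).1).2).1 [] [] rfl

/-- A single replacement needs only the class of the text behind the match, so the congruence for
`replaceAll` is reused. -/
lemma Regex.hasInd_repl (hR : R.Det (fun w => w = [])) {N q : ℕ} (hN : Nat.card R.M ≤ N)
    (hq : Nat.card (pat.search.toPSST 0).Q ≤ q) :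
    HasInd (PSST.profileBound N pat.search.size q (restCount N))
      (fun x => R.h (pat.repl rep x)) := by
  refine (hasInd_restInfo (rep := rep) hR hN hq).comp fun w w' h => ?_
  have hw : R.h w = R.h w' := (Prod.mk.inj (Prod.mk.inj h).1).1
  have hB := congrFun (Prod.mk.inj h).2 (pat.search.toPSST 0).start
  rw [PSST.profile, PSST.profile] at hB
  unfold repl firstMatch
  rw [finalRun_eq, finalRun_eq]
  cases h1 : (pat.search.toPSST 0).first (pat.search.toPSST 0).start w with
  | none =>
    rw [h1, Option.map_none] at hB
    rw [show (pat.search.toPSST 0).first (pat.search.toPSST 0).start w' = none by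
      simpa using hB.symm]
    exact hw
  | some r =>
    rw [h1, Option.map_some] at hB
    obtain ⟨r', h2, h3⟩ := Option.map_eq_some_iff.1 hB.symm
    rw [h2, Option.map_some, Option.map_some, Option.elim_some, Option.elim_some]
    obtain ⟨h4, h5⟩ := Prod.mk.inj h3
    have hs := simMatch_of_eff h4.symm h1 h2 (Prod.mk.inj h5).1.symm
    exact R.congr (R.congr hs.pre (instRep_congr rep hs.capt hs.pre hs.post)) hs.post

end

end StrSL

namespace StrSL

variable {k : ℕ}

/-! ## Short solutions of straight-line formulas -/

/-- The value of a term, if it is defined. -/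
noncomputable def Term.val (σ : ℕ → List (Fin k)) : Term k → Option (List (Fin k))
  | .var y => some (σ y)
  | .concat y z => some (σ y ++ σ z)
  | .extract i e y => e.ext i (σ y)
  | .replace pat rep y => some (pat.repl rep (σ y))
  | .replaceAll pat rep y => some (pat.replFrom rep [] (σ y))

lemma Term.eval_iff {σ : ℕ → List (Fin k)} {t : Term k} {w : List (Fin k)} :
    t.Eval σ w ↔ t.val σ = some w := by
  cases t with
  | var y => simp [Eval, val, eq_comm]
  | concat y z => simp [Eval, val, eq_comm]
  | extract i e y => exact extract_iff
  | replace pat rep y => rw [Eval, replace_iff, val, Option.some.injEq, eq_comm]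
  | replaceAll pat rep y =>
    rw [Eval, ReplaceAll, Regex.replaceFrom_iff, val, Option.some.injEq, eq_comm]

lemma Term.val_congr {σ σ' : ℕ → List (Fin k)} {t : Term k} (h : ∀ y ∈ t.vars, σ y = σ' y) :
    t.val σ = t.val σ' := by
  cases t <;> simp_all [vars, val]

/-- Computing the values of the left-hand sides of a sequence of equations. -/
noncomputable def exec : (ℕ → List (Fin k)) → List (ℕ × Term k) → Option (ℕ → List (Fin k))
  | σ, [] => some σ
  | σ, p :: l => (p.2.val σ).bind fun w => exec (Function.update σ p.1 w) l

lemma exec_self {σ : ℕ → List (Fin k)} {l : List (ℕ × Term k)}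
    (h : ∀ p ∈ l, p.2.Eval σ (σ p.1)) : exec σ l = some σ := by
  induction l with
  | nil => rfl
  | cons p l ih =>
    rw [exec, Term.eval_iff.1 (h p List.mem_cons_self), Option.bind_some,
      Function.update_eq_self]
    exact ih fun q hq => h q (List.mem_cons_of_mem _ hq)

lemma exec_of_ne {σ σ' : ℕ → List (Fin k)} {l : List (ℕ × Term k)} (h : exec σ l = some σ')
    {y : ℕ} (hy : ∀ p ∈ l, p.1 ≠ y) : σ' y = σ y := by
  induction l generalizing σ with
  | nil => rw [exec, Option.some.injEq] at h; rw [h]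
  | cons p l ih =>
    obtain ⟨w, -, h⟩ := Option.bind_eq_some_iff.1 h
    rw [ih h fun q hq => hy q (List.mem_cons_of_mem _ hq),
      Function.update_of_ne (hy p List.mem_cons_self).symm]

/-- The condition on the order of the equations of a straight-line formula. -/
def Ordered (l : List (ℕ × Term k)) : Prop :=
  l.Pairwise (fun p q => p.1 ≠ q.1 ∧ q.1 ∉ p.2.vars) ∧ ∀ p ∈ l, p.1 ∉ p.2.vars

/-- A later left-hand side is different from the earlier ones and does not occur in the earlier
terms, so an equation remains true once it has been executed. -/
lemma eval_of_exec {σ σ' : ℕ → List (Fin k)} {l : List (ℕ × Term k)} (h : exec σ l = some σ')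
    (hl : Ordered l) : ∀ p ∈ l, p.2.Eval σ' (σ' p.1) := by
  induction l generalizing σ with
  | nil => simp
  | cons p l ih =>
    obtain ⟨w, hw, h⟩ := Option.bind_eq_some_iff.1 h
    obtain ⟨h1, h2⟩ := hl
    rw [List.pairwise_cons] at h1
    rw [List.forall_mem_cons] at h2 ⊢
    refine ⟨?_, ih h ⟨h1.2, h2.2⟩⟩
    rw [Term.eval_iff, exec_of_ne h fun q hq => (h1.1 q hq).1.symm, Function.update_self, ← hw]
    refine Term.val_congr fun y hy => ?_
    rw [exec_of_ne h fun q hq hqy => (h1.1 q hq).2 (hqy ▸ hy), Function.update_of_ne]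
    exact fun hyp => h2.1 (hyp ▸ hy)

/-- The class of the value of `t` is determined by the classes of the values of the variables,
for a congruence whose index is bounded in terms of the given one. -/
def Term.Bounded (t : Term k) (b : ℕ → ℕ) : Prop :=
  ∀ (R : Recog k) (N : ℕ), R.Det (fun w => w = []) → Nat.card R.M ≤ N →
    ∃ R' : Recog k, Nat.card R'.M ≤ b N ∧ R'.Det R.h ∧
      ∀ σ σ' : ℕ → List (Fin k), (∀ y, R'.h (σ y) = R'.h (σ' y)) →
        (t.val σ).map R.h = (t.val σ').map R.h

lemma Term.bounded_var (y : ℕ) : (Term.var y : Term k).Bounded id :=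
  fun R _ _ hN => ⟨R, hN, fun _ _ h => h, fun _ _ h => congrArg some (h y)⟩

lemma Term.bounded_concat (y z : ℕ) : (Term.concat y z : Term k).Bounded id :=
  fun R _ _ hN => ⟨R, hN, fun _ _ h => h, fun _ _ h => congrArg some (R.congr (h y) (h z))⟩

lemma Recog.hasInd (R : Recog k) {N : ℕ} (hN : Nat.card R.M ≤ N) : HasInd N R.h :=
  ⟨R, hN, fun _ _ h => h⟩

/-- The new congruence must also determine the old one, because variables that are not assigned keep
their values. The factor `N` in the bound comes from this product. -/
lemma Term.bounded_of_hasInd {t : Term k} {y : ℕ} {f : List (Fin k) → Option (List (Fin k))}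
    (ht : ∀ σ, t.val σ = f (σ y)) {b : ℕ → ℕ}
    (hb : ∀ (R : Recog k) (N : ℕ), R.Det (fun w => w = []) → Nat.card R.M ≤ N →
      HasInd (b N) (fun x => (f x).map R.h)) : t.Bounded (fun N => N * b N) := by
  intro R N hR hN
  obtain ⟨R', h1, h2⟩ := (R.hasInd hN).prod (hb R N hR hN)
  refine ⟨R', h1, fun w w' h => (Prod.mk.inj (h2 w w' h)).1, fun σ σ' h => ?_⟩
  rw [ht, ht]
  exact (Prod.mk.inj (h2 _ _ (h y))).2

lemma Term.bounded_extract (i : ℕ) (e : Regex k) (y : ℕ) {q : ℕ}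
    (hq : Nat.card (e.toPSST 0).Q ≤ q) :
    (Term.extract i e y).Bounded (fun N => N * PSST.profileBound N e.size q N) :=
  bounded_of_hasInd (y := y) (f := e.ext i) (fun _ => rfl)
    fun _ _ _ hN => Regex.hasInd_ext i e hN hq

lemma Term.bounded_replace (pat : Regex k) (rep : List (RepSym k)) (y : ℕ) {q : ℕ}
    (hq : Nat.card (pat.search.toPSST 0).Q ≤ q) : (Term.replace pat rep y).Bounded
      (fun N => N * PSST.profileBound N pat.search.size q (restCount N)) :=
  bounded_of_hasInd (y := y) (f := fun x => some (pat.repl rep x)) (fun _ => rfl)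
    fun _ _ hR hN => (Regex.hasInd_repl hR hN hq).comp fun _ _ h => congrArg some h

lemma Term.bounded_replaceAll (pat : Regex k) (rep : List (RepSym k)) (y : ℕ) {q : ℕ}
    (hq : Nat.card (pat.search.toPSST 0).Q ≤ q) : (Term.replaceAll pat rep y).Bounded
      (fun N => N * PSST.profileBound N pat.search.size q (restCount N)) :=
  bounded_of_hasInd (y := y) (f := fun x => some (pat.replFrom rep [] x)) (fun _ => rfl)
    fun _ _ hR hN => (Regex.hasInd_replaceAll hR hN hq).comp fun _ _ h => congrArg some h

/-- The congruence is pulled back through the equations from the last one to the first one, whence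
the fold from the right in the bound. -/
lemma exec_bounded {b : ℕ × Term k → ℕ → ℕ} {l : List (ℕ × Term k)}
    (hb : ∀ p ∈ l, p.2.Bounded (b p)) (R : Recog k) {N : ℕ} (hR : R.Det (fun w => w = []))
    (hN : Nat.card R.M ≤ N) :
    ∃ R' : Recog k, Nat.card R'.M ≤ l.foldr b N ∧ R'.Det R.h ∧
      ∀ σ σ' τ : ℕ → List (Fin k), (∀ y, R'.h (σ y) = R'.h (σ' y)) → exec σ l = some τ →
        ∃ τ', exec σ' l = some τ' ∧ ∀ y, R.h (τ y) = R.h (τ' y) := by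
  induction l with
  | nil =>
    refine ⟨R, hN, fun _ _ h => h, fun σ σ' τ h hτ => ⟨σ', rfl, ?_⟩⟩
    obtain rfl : σ = τ := Option.some.inj hτ
    exact h
  | cons p l ih =>
    rw [List.forall_mem_cons] at hb
    obtain ⟨S, h1, h2, h3⟩ := ih hb.2
    obtain ⟨R', h4, h5, h6⟩ := hb.1 S _ (fun w w' h => hR _ _ (h2 w w' h)) h1
    refine ⟨R', h4, fun w w' h => h2 _ _ (h5 _ _ h), fun σ σ' τ h hτ => ?_⟩
    obtain ⟨w, hw, hτ⟩ := Option.bind_eq_some_iff.1 hτ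
    have he := h6 σ σ' h
    rw [hw, Option.map_some, eq_comm, Option.map_eq_some_iff] at he
    obtain ⟨w', hw', he⟩ := he
    rw [exec, hw', Option.bind_some]
    refine h3 _ _ τ (fun y => ?_) hτ
    by_cases hy : y = p.1
    · rw [hy, Function.update_self, Function.update_self, he]
    · rw [Function.update_of_ne hy, Function.update_of_ne hy]
      exact h5 _ _ (h y)

/-- The bound for the constraints `x ∈ e`. -/
def memBound (ms : List (ℕ × Regex k)) : ℕ := ms.foldr (fun m N => m.2.langBound * N) 4

/-- The starting point of the pullback: the product of the congruences of all constraints and one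
that recognizes emptiness, as the replacements require. -/
lemma hasInd_mems (ms : List (ℕ × Regex k)) : ∃ R : Recog k, Nat.card R.M ≤ memBound ms ∧
    R.Det (fun w => w = []) ∧ ∀ m ∈ ms, R.Det (· ∈ m.2.lang) := by
  induction ms with
  | nil =>
    obtain ⟨R, h1, h2⟩ := hasInd_nil (k := k)
    exact ⟨R, h1, h2, by simp⟩
  | cons m ms ih =>
    obtain ⟨R, h1, h2, h3⟩ := ih
    obtain ⟨S, h4, h5⟩ := m.2.hasInd_lang
    obtain ⟨P, h6, h7⟩ := (S.hasInd h4).prod (R.hasInd h1)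
    have hS : P.Det S.h := fun w w' h => (Prod.mk.inj (h7 w w' h)).1
    have hR : P.Det R.h := fun w w' h => (Prod.mk.inj (h7 w w' h)).2
    refine ⟨P, h6, fun w w' h => h2 _ _ (hR _ _ h), ?_⟩
    rw [List.forall_mem_cons]
    exact ⟨fun w w' h => h5 _ _ (hS _ _ h), fun m hm w w' h => h3 m hm _ _ (hR _ _ h)⟩

/-- Equations in a straight-line order and membership constraints have a common solution iff
they have one that is computed from short words. -/
theorem exists_solution_iff {b : ℕ × Term k → ℕ → ℕ} {l : List (ℕ × Term k)}
    {ms : List (ℕ × Regex k)} (hb : ∀ p ∈ l, p.2.Bounded (b p)) (hl : Ordered l) {M : ℕ}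
    (hM : ∀ p ∈ l, p.1 < M ∧ ∀ y ∈ p.2.vars, y < M) (hM' : ∀ m ∈ ms, m.1 < M) :
    (∃ σ : ℕ → List (Fin k), (∀ p ∈ l, p.2.Eval σ (σ p.1)) ∧ ∀ m ∈ ms, σ m.1 ∈ m.2.lang) ↔
      ∃ σ τ : ℕ → List (Fin k), (∀ y, (σ y).length ≤ l.foldr b (memBound ms)) ∧
        (∀ y, M ≤ y → σ y = []) ∧ exec σ l = some τ ∧ ∀ m ∈ ms, τ m.1 ∈ m.2.lang := by
  constructor
  · rintro ⟨σ, h1, h2⟩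
    obtain ⟨R, h3, h4, h5⟩ := hasInd_mems ms
    obtain ⟨R', h6, h7, h8⟩ := exec_bounded hb R h4 h3
    -- Only the variables below `M` occur. The others are made empty, so that there are finitely
    -- many candidates.
    let ρ : ℕ → List (Fin k) := fun y => if y < M then σ y else []
    have hρ : ∀ y, y < M → ρ y = σ y := fun y hy => if_pos hy
    have hex : exec ρ l = some ρ := exec_self fun p hp => by
      rw [Term.eval_iff, hρ _ (hM p hp).1,
        Term.val_congr fun y hy => hρ y ((hM p hp).2 y hy), ← Term.eval_iff]
      exact h1 p hp
    -- Each value is replaced by a short word of the same class. Executing the equations on these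
    -- words succeeds and ends in the classes of `ρ`.
    choose s hs hs' using fun w => R'.exists_short w
    obtain ⟨τ, h9, h10⟩ := h8 ρ (fun y => s (ρ y)) ρ (fun y => (hs' _).symm) hex
    refine ⟨fun y => s (ρ y), τ, fun y => (hs _).le.trans h6, fun y hy => ?_, h9,
      fun m hm => ?_⟩
    · have : ρ y = [] := if_neg (not_lt.2 hy)
      change s (ρ y) = []
      rw [this]
      -- The congruence recognizes emptiness, so the representative of the empty word is empty.
      exact (h4 _ _ (h7 _ _ (hs' []))).mpr rfl
    · refine (h5 m hm _ _ (h10 m.1)).mp ?_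
      rw [hρ _ (hM' m hm)]
      exact h2 m hm
  · rintro ⟨σ, τ, -, -, h, h'⟩
    exact ⟨τ, eval_of_exec h hl, h'⟩

/-- The membership constraints that occur in a formula. -/
def Formula.mems : Formula k → List (ℕ × Regex k)
  | .eqn _ _ => []
  | .mem x e => [(x, e)]
  | .and φ ψ => φ.mems ++ ψ.mems
  | .or φ ψ => φ.mems ++ ψ.mems
  | .not φ => φ.mems

lemma Formula.holds_iff {φ : Formula k} (hφ : φ.Conjunctive) (σ : ℕ → List (Fin k)) :
    φ.Holds σ ↔ (∀ p ∈ φ.eqns, p.2.Eval σ (σ p.1)) ∧ ∀ m ∈ φ.mems, σ m.1 ∈ m.2.lang := by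
  induction φ with
  | eqn x t => simp [Holds, eqns, mems]
  | mem x e => simp [Holds, eqns, mems]
  | and φ ψ ih1 ih2 =>
    rw [Holds, ih1 hφ.1, ih2 hφ.2]
    simp only [eqns, mems, List.forall_mem_append]
    tauto
  | or => exact hφ.elim
  | not => exact hφ.elim

end StrSL

/-! ## Primitive recursive functions -/

-- All functions of the decision procedure are composed of the operations below, with tests that are
-- Boolean functions. Their primitive recursiveness can then be read off from their definitions.
attribute [fun_prop] Primrec

namespace StrSL.PR

variable {α β γ : Type*} [Primcodable α] [Primcodable β] [Primcodable γ]

@[fun_prop]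
lemma id_pr : Primrec (fun x : α => x) := Primrec.id

@[fun_prop]
lemma const_pr (c : β) : Primrec (fun _ : α => c) := Primrec.const c

@[fun_prop]
lemma comp_pr {f : β → γ} {g : α → β} (hf : Primrec f) (hg : Primrec g) :
    Primrec (fun x => f (g x)) := hf.comp hg

@[fun_prop]
lemma pair_pr {f : α → β} {g : α → γ} (hf : Primrec f) (hg : Primrec g) :
    Primrec (fun x => (f x, g x)) := hf.pair hg

@[fun_prop]
lemma fst_pr {f : α → β × γ} (hf : Primrec f) : Primrec (fun x => (f x).1) := Primrec.fst.comp hf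

@[fun_prop]
lemma snd_pr {f : α → β × γ} (hf : Primrec f) : Primrec (fun x => (f x).2) := Primrec.snd.comp hf

@[fun_prop]
lemma cond_pr {c : α → Bool} {f g : α → β} (hc : Primrec c) (hf : Primrec f) (hg : Primrec g) :
    Primrec (fun x => bif c x then f x else g x) := Primrec.cond hc hf hg

/-- Equality as a Boolean function. -/
def eqB {α : Type*} [DecidableEq α] (a b : α) : Bool := decide (a = b)

/-- The order of the natural numbers as a Boolean function. -/
def leB (a b : ℕ) : Bool := decide (a ≤ b)

@[simp]
lemma eqB_iff {α : Type*} [DecidableEq α] {a b : α} : eqB a b = true ↔ a = b := by simp [eqB]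

@[simp]
lemma eqB_self {α : Type*} [DecidableEq α] (a : α) : eqB a a = true := by simp

@[simp]
lemma leB_iff {a b : ℕ} : leB a b = true ↔ a ≤ b := by simp [leB]

@[fun_prop]
lemma eqB_pr [DecidableEq β] {f g : α → β} (hf : Primrec f) (hg : Primrec g) :
    Primrec (fun x => eqB (f x) (g x)) := by
  obtain ⟨_, h⟩ := Primrec.eq (α := β)
  exact (h.comp (hf.pair hg)).of_eq fun x => by simp [eqB]

@[fun_prop]
lemma leB_pr {f g : α → ℕ} (hf : Primrec f) (hg : Primrec g) :
    Primrec (fun x => leB (f x) (g x)) := by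
  obtain ⟨_, h⟩ := Primrec.nat_le
  exact (h.comp (hf.pair hg)).of_eq fun x => by simp [leB]

@[fun_prop]
lemma and_pr {f g : α → Bool} (hf : Primrec f) (hg : Primrec g) :
    Primrec (fun x => f x && g x) := Primrec.and.comp hf hg

@[fun_prop]
lemma or_pr {f g : α → Bool} (hf : Primrec f) (hg : Primrec g) :
    Primrec (fun x => f x || g x) := Primrec.or.comp hf hg

@[fun_prop]
lemma not_pr {f : α → Bool} (hf : Primrec f) : Primrec (fun x => !f x) := Primrec.not.comp hf

@[fun_prop]
lemma add_pr {f g : α → ℕ} (hf : Primrec f) (hg : Primrec g) :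
    Primrec (fun x => f x + g x) := Primrec.nat_add.comp hf hg

@[fun_prop]
lemma sub_pr {f g : α → ℕ} (hf : Primrec f) (hg : Primrec g) :
    Primrec (fun x => f x - g x) := Primrec.nat_sub.comp hf hg

@[fun_prop]
lemma mul_pr {f g : α → ℕ} (hf : Primrec f) (hg : Primrec g) :
    Primrec (fun x => f x * g x) := Primrec.nat_mul.comp hf hg

@[fun_prop]
lemma iterate_pr {n : α → ℕ} {f : α → β → β} {g : α → β} (hn : Primrec n)
    (hf : Primrec (fun p : α × β => f p.1 p.2)) (hg : Primrec g) :
    Primrec (fun x => (f x)^[n x] (g x)) := Primrec.nat_iterate hn hg hf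

@[fun_prop]
lemma pow_pr {f g : α → ℕ} (hf : Primrec f) (hg : Primrec g) :
    Primrec (fun x => f x ^ g x) := by
  have : Primrec (fun x => (fun y => f x * y)^[g x] 1) := by fun_prop
  refine this.of_eq fun x => ?_
  induction g x with
  | zero => rfl
  | succ n ih => rw [Function.iterate_succ_apply', ih, pow_succ']

@[fun_prop]
lemma append_pr {f g : α → List β} (hf : Primrec f) (hg : Primrec g) :
    Primrec (fun x => f x ++ g x) := Primrec.list_append.comp hf hg

@[fun_prop]
lemma cons_pr {f : α → β} {g : α → List β} (hf : Primrec f) (hg : Primrec g) :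
    Primrec (fun x => f x :: g x) := Primrec.list_cons.comp hf hg

@[fun_prop]
lemma map_pr {f : α → List β} {g : α → β → γ} (hf : Primrec f)
    (hg : Primrec (fun p : α × β => g p.1 p.2)) : Primrec (fun x => (f x).map (g x)) :=
  Primrec.list_map hf hg

@[fun_prop]
lemma flatMap_pr {f : α → List β} {g : α → β → List γ} (hf : Primrec f)
    (hg : Primrec (fun p : α × β => g p.1 p.2)) : Primrec (fun x => (f x).flatMap (g x)) :=
  Primrec.list_flatMap hf hg

@[fun_prop]
lemma foldr_pr {f : α → List β} {i : α → γ} {g : α → β → γ → γ} (hf : Primrec f)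
    (hi : Primrec i) (hg : Primrec (fun p : α × β × γ => g p.1 p.2.1 p.2.2)) :
    Primrec (fun x => (f x).foldr (g x) (i x)) :=
  Primrec.list_foldr hf hi (h := fun a p => g a p.1 p.2) hg

@[fun_prop]
lemma foldl_pr {f : α → List β} {i : α → γ} {g : α → γ → β → γ} (hf : Primrec f)
    (hi : Primrec i) (hg : Primrec (fun p : α × γ × β => g p.1 p.2.1 p.2.2)) :
    Primrec (fun x => (f x).foldl (g x) (i x)) :=
  Primrec.list_foldl hf hi (h := fun a p => g a p.1 p.2) hg

@[fun_prop]
lemma filter_pr {f : α → List β} {g : α → β → Bool} (hf : Primrec f)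
    (hg : Primrec (fun p : α × β => g p.1 p.2)) : Primrec (fun x => (f x).filter (g x)) := by
  have : Primrec (fun x => (f x).flatMap fun b => bif g x b then [b] else []) := by fun_prop
  refine this.of_eq fun x => ?_
  induction f x with
  | nil => rfl
  | cons b l ih => rw [List.flatMap_cons, ih, List.filter_cons]; cases g x b <;> simp

@[fun_prop]
lemma any_pr {f : α → List β} {g : α → β → Bool} (hf : Primrec f)
    (hg : Primrec (fun p : α × β => g p.1 p.2)) : Primrec (fun x => (f x).any (g x)) := by
  have : Primrec (fun x => (f x).foldr (fun b c => g x b || c) false) := by fun_prop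
  refine this.of_eq fun x => ?_
  induction f x with
  | nil => rfl
  | cons b l ih => rw [List.foldr_cons, ih, List.any_cons]

@[fun_prop]
lemma all_pr {f : α → List β} {g : α → β → Bool} (hf : Primrec f)
    (hg : Primrec (fun p : α × β => g p.1 p.2)) : Primrec (fun x => (f x).all (g x)) := by
  have : Primrec (fun x => (f x).foldr (fun b c => g x b && c) true) := by fun_prop
  refine this.of_eq fun x => ?_
  induction f x with
  | nil => rfl
  | cons b l ih => rw [List.foldr_cons, ih, List.all_cons]

@[fun_prop]
lemma length_pr {f : α → List β} (hf : Primrec f) : Primrec (fun x => (f x).length) :=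
  Primrec.list_length.comp hf

@[fun_prop]
lemma range_pr {f : α → ℕ} (hf : Primrec f) : Primrec (fun x => List.range (f x)) :=
  Primrec.list_range.comp hf

@[fun_prop]
lemma take_pr {f : α → ℕ} {g : α → List β} (hf : Primrec f) (hg : Primrec g) :
    Primrec (fun x => (g x).take (f x)) := Primrec.list_take.comp hf hg

@[fun_prop]
lemma drop_pr {f : α → ℕ} {g : α → List β} (hf : Primrec f) (hg : Primrec g) :
    Primrec (fun x => (g x).drop (f x)) := Primrec.list_drop.comp hf hg

@[fun_prop]
lemma set_pr {f : α → List β} {g : α → ℕ} {h : α → β} (hf : Primrec f) (hg : Primrec g)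
    (hh : Primrec h) : Primrec (fun x => (f x).set (g x) (h x)) :=
  Primrec.list_set.comp hf (hg.pair hh)

@[fun_prop]
lemma getD_pr {f : α → List β} {g : α → ℕ} (d : β) (hf : Primrec f) (hg : Primrec g) :
    Primrec (fun x => (f x).getD (g x) d) := (Primrec.list_getD d).comp hf hg

@[fun_prop]
lemma getElem?_pr {f : α → List β} {g : α → ℕ} (hf : Primrec f) (hg : Primrec g) :
    Primrec (fun x => (f x)[g x]?) := Primrec.list_getElem?.comp hf hg

@[fun_prop]
lemma head?_pr {f : α → List β} (hf : Primrec f) : Primrec (fun x => (f x).head?) :=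
  Primrec.list_head?.comp hf

@[fun_prop]
lemma flatten_pr {f : α → List (List β)} (hf : Primrec f) : Primrec (fun x => (f x).flatten) :=
  Primrec.list_flatten.comp hf

@[fun_prop]
lemma zipIdx_pr {f : α → List β} {g : α → ℕ} (hf : Primrec f) (hg : Primrec g) :
    Primrec (fun x => (f x).zipIdx (g x)) := by
  -- The fold works from the right, so the positions assigned to the tail are shifted when an
  -- element is added in front.
  have : Primrec (fun x => (f x).foldr (fun b (s : List (β × ℕ)) =>
      (b, g x) :: s.map fun p => (p.1, p.2 + 1)) []) := by fun_prop
  refine this.of_eq fun x => ?_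
  induction f x with
  | nil => rfl
  | cons b l ih =>
    rw [List.foldr_cons, ih, List.zipIdx_cons, List.zipIdx_succ]

@[fun_prop]
lemma some_pr {f : α → β} (hf : Primrec f) : Primrec (fun x => some (f x)) :=
  Primrec.option_some.comp hf

@[fun_prop]
lemma option_map_pr {f : α → Option β} {g : α → β → γ} (hf : Primrec f)
    (hg : Primrec (fun p : α × β => g p.1 p.2)) : Primrec (fun x => (f x).map (g x)) :=
  Primrec.option_map hf hg

@[fun_prop]
lemma option_bind_pr {f : α → Option β} {g : α → β → Option γ} (hf : Primrec f)
    (hg : Primrec (fun p : α × β => g p.1 p.2)) : Primrec (fun x => (f x).bind (g x)) :=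
  Primrec.option_bind hf hg

@[fun_prop]
lemma option_getD_pr {f : α → Option β} {g : α → β} (hf : Primrec f) (hg : Primrec g) :
    Primrec (fun x => (f x).getD (g x)) := Primrec.option_getD.comp hf hg

@[fun_prop]
lemma option_elim_pr {f : α → Option β} {i : α → γ} {g : α → β → γ} (hf : Primrec f)
    (hi : Primrec i) (hg : Primrec (fun p : α × β => g p.1 p.2)) :
    Primrec (fun x => (f x).elim (i x) (g x)) := by
  refine (Primrec.option_casesOn hf hi hg).of_eq fun x => ?_
  cases f x <;> rfl

end StrSL.PR

namespace StrSL

open PR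

/-! ### Lists of bounded length -/

/-- The lists of length `n` with elements in `A`. -/
def listsEq {α : Type*} (A : List α) (n : ℕ) : List (List α) :=
  (fun S => A.flatMap fun a => S.map fun l => a :: l)^[n] [[]]

/-- The lists of length at most `n` with elements in `A`. -/
def listsLE {α : Type*} (A : List α) (n : ℕ) : List (List α) :=
  (List.range (n + 1)).flatMap fun i => listsEq A i

lemma mem_listsEq {α : Type*} {A : List α} {n : ℕ} {l : List α} :
    l ∈ listsEq A n ↔ l.length = n ∧ ∀ a ∈ l, a ∈ A := by
  induction n generalizing l with
  | zero =>
    rw [listsEq, Function.iterate_zero_apply, List.mem_singleton, List.length_eq_zero_iff]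
    exact ⟨fun h => ⟨h, by simp [h]⟩, And.left⟩
  | succ n ih =>
    have h : listsEq A (n + 1) = A.flatMap fun a => (listsEq A n).map fun l => a :: l :=
      Function.iterate_succ_apply' _ _ _
    rw [h]
    cases l with
    | nil => simp
    | cons a l =>
      simp only [List.mem_flatMap, List.mem_map, List.cons.injEq, List.length_cons,
        Nat.add_right_cancel_iff, List.forall_mem_cons, ih]
      constructor
      · rintro ⟨_, ha, _, hl, rfl, rfl⟩
        exact ⟨hl.1, ha, hl.2⟩
      · rintro ⟨h1, h2, h3⟩
        exact ⟨a, h2, l, ⟨h1, h3⟩, rfl, rfl⟩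

lemma mem_listsLE {α : Type*} {A : List α} {n : ℕ} {l : List α} :
    l ∈ listsLE A n ↔ l.length ≤ n ∧ ∀ a ∈ l, a ∈ A := by
  simp only [listsLE, List.mem_flatMap, List.mem_range, mem_listsEq]
  exact ⟨fun ⟨i, h1, h2, h3⟩ => ⟨by omega, h3⟩, fun h => ⟨_, by omega, rfl, h.2⟩⟩

section
variable {α β : Type*} [Primcodable α] [Primcodable β]

@[fun_prop]
lemma listsEq_pr {f : α → List β} {g : α → ℕ} (hf : Primrec f) (hg : Primrec g) :
    Primrec (fun x => listsEq (f x) (g x)) := by unfold listsEq; fun_prop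

@[fun_prop]
lemma listsLE_pr {f : α → List β} {g : α → ℕ} (hf : Primrec f) (hg : Primrec g) :
    Primrec (fun x => listsLE (f x) (g x)) := by unfold listsLE; fun_prop

end

/-- Whether `r a b` holds for all `a` before `b` in the list. -/
def pairwiseB {α : Type*} (r : α → α → Bool) (l : List α) : Bool :=
  (l.foldr (fun a s => (s.1 && s.2.all (r a), a :: s.2)) (true, ([] : List α))).1

lemma pairwiseB_iff {α : Type*} {r : α → α → Bool} {l : List α} :
    pairwiseB r l = true ↔ l.Pairwise fun a b => r a b = true := by
  have h : ∀ l : List α, (l.foldr (fun a s => (s.1 && s.2.all (r a), a :: s.2))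
      (true, ([] : List α))).2 = l := fun l => by
    induction l with
    | nil => rfl
    | cons a l ih => rw [List.foldr_cons, ih]
  induction l with
  | nil => simp [pairwiseB]
  | cons a l ih =>
    have he : pairwiseB r (a :: l) = (pairwiseB r l && l.all (r a)) := by
      rw [pairwiseB, List.foldr_cons, h, pairwiseB]
    rw [he, Bool.and_eq_true, List.pairwise_cons, List.all_eq_true, and_comm]
    exact and_congr_right fun _ => ih

/-! ### Folding codes of regular expressions -/

/-- The number of the immediate subexpressions of an expression whose code begins with `s`. -/
def arity (s : List ℕ) : ℕ :=
  bif leB (s.getD 0 0) 2 then 0 else bif eqB (s.getD 0 0) 4 || eqB (s.getD 0 0) 5 then 2 else 1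

/-- One step of the evaluation of a code. The symbols come with their positions. -/
def foldStep {β : Type*} (f : List ℕ × ℕ → List β → β) (s : List ℕ × ℕ) (st : List β) : List β :=
  f s (st.take (arity s.1)) :: st.drop (arity s.1)

/-- The evaluation of a code. -/
def foldCode {β : Type*} (d : β) (f : List ℕ × ℕ → List β → β) (c : List (List ℕ)) : β :=
  ((c.zipIdx 0).foldr (foldStep f) []).getD 0 d

section
variable {α β : Type*} [Primcodable α] [Primcodable β]

@[fun_prop]
lemma arity_pr {g : α → List ℕ} (hg : Primrec g) : Primrec (fun x => arity (g x)) := by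
  unfold arity; fun_prop

@[fun_prop]
lemma foldCode_pr (d : β) {f : α → List ℕ × ℕ → List β → β} {g : α → List (List ℕ)}
    (hf : Primrec (fun p : α × (List ℕ × ℕ) × List β => f p.1 p.2.1 p.2.2)) (hg : Primrec g) :
    Primrec (fun x => foldCode d (f x) (g x)) := by
  unfold foldCode foldStep; fun_prop

end

variable {k : ℕ}

lemma Regex.length_code (e : Regex k) : e.code.length = e.size := by
  induction e <;> simp_all [code, size]

/-- The rules for evaluating codes: if `P e n b` says that `b` is the value of the expression `e`
numbered `n`, then `f` computes the value of an expression from those of its immediate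
subexpressions. -/
structure FoldRules {β : Type*} (f : List ℕ × ℕ → List β → β) (P : Regex k → ℕ → β → Prop) :
    Prop where
  empty : ∀ n, P .empty n (f ([0], n) [])
  eps : ∀ n, P .eps n (f ([1], n) [])
  letter : ∀ (a : Fin k) n, P (.letter a) n (f ([2, a.val], n) [])
  group : ∀ e n b, P e (n + 1) b → P (.group e) n (f ([3], n) [b])
  alt : ∀ e₁ e₂ n b₁ b₂, P e₁ (n + 1) b₁ → P e₂ (n + 1 + e₁.size) b₂ →
    P (.alt e₁ e₂) n (f ([4], n) [b₁, b₂])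
  seq : ∀ e₁ e₂ n b₁ b₂, P e₁ (n + 1) b₁ → P e₂ (n + 1 + e₁.size) b₂ →
    P (.seq e₁ e₂) n (f ([5], n) [b₁, b₂])
  opt : ∀ g e n b, P e (n + 1) b → P (.opt g e) n (f ([6, g.toNat], n) [b])
  star : ∀ g e n b, P e (n + 1) b → P (.star g e) n (f ([7, g.toNat], n) [b])
  plus : ∀ g e n b, P e (n + 1) b → P (.plus g e) n (f ([8, g.toNat], n) [b])
  rep : ∀ g m d e n b, P e (n + 1) b →
    P (.rep g m d e) n (f ([9, g.toNat, m, m + d], n) [b])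

/-- Prefix notation, read from right to left, is evaluated on a stack: the values of the
subexpressions are on top, the first one uppermost. As a code has as many symbols as the expression
has subexpressions, the position of a symbol is its preorder number. -/
lemma FoldRules.foldr {β : Type*} {f : List ℕ × ℕ → List β → β} {P : Regex k → ℕ → β → Prop}
    (h : FoldRules f P) (e : Regex k) (n : ℕ) (st : List β) :
    ∃ b, P e n b ∧ (e.code.zipIdx n).foldr (foldStep f) st = b :: st := by
  induction e generalizing n st with
  | empty => exact ⟨_, h.empty n, rfl⟩
  | eps => exact ⟨_, h.eps n, rfl⟩
  | letter a => exact ⟨_, h.letter a n, rfl⟩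
  | group e ih =>
    obtain ⟨b, hb, he⟩ := ih (n + 1) st
    exact ⟨_, h.group e n b hb, by rw [Regex.code, List.zipIdx_cons, List.foldr_cons, he]; rfl⟩
  | alt e₁ e₂ ih₁ ih₂ =>
    obtain ⟨b₂, hb₂, he₂⟩ := ih₂ (n + 1 + e₁.size) st
    obtain ⟨b₁, hb₁, he₁⟩ := ih₁ (n + 1) (b₂ :: st)
    refine ⟨_, h.alt e₁ e₂ n b₁ b₂ hb₁ hb₂, ?_⟩
    rw [Regex.code, List.zipIdx_cons, List.foldr_cons, List.zipIdx_append, List.foldr_append,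
      Regex.length_code, he₂, he₁]
    rfl
  | seq e₁ e₂ ih₁ ih₂ =>
    obtain ⟨b₂, hb₂, he₂⟩ := ih₂ (n + 1 + e₁.size) st
    obtain ⟨b₁, hb₁, he₁⟩ := ih₁ (n + 1) (b₂ :: st)
    refine ⟨_, h.seq e₁ e₂ n b₁ b₂ hb₁ hb₂, ?_⟩
    rw [Regex.code, List.zipIdx_cons, List.foldr_cons, List.zipIdx_append, List.foldr_append,
      Regex.length_code, he₂, he₁]
    rfl
  | opt g e ih =>
    obtain ⟨b, hb, he⟩ := ih (n + 1) st
    exact ⟨_, h.opt g e n b hb, by rw [Regex.code, List.zipIdx_cons, List.foldr_cons, he]; rfl⟩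
  | star g e ih =>
    obtain ⟨b, hb, he⟩ := ih (n + 1) st
    exact ⟨_, h.star g e n b hb, by rw [Regex.code, List.zipIdx_cons, List.foldr_cons, he]; rfl⟩
  | plus g e ih =>
    obtain ⟨b, hb, he⟩ := ih (n + 1) st
    exact ⟨_, h.plus g e n b hb, by rw [Regex.code, List.zipIdx_cons, List.foldr_cons, he]; rfl⟩
  | rep g m d e ih =>
    obtain ⟨b, hb, he⟩ := ih (n + 1) st
    exact ⟨_, h.rep g m d e n b hb,
      by rw [Regex.code, List.zipIdx_cons, List.foldr_cons, he]; rfl⟩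

lemma FoldRules.foldCode {β : Type*} {f : List ℕ × ℕ → List β → β} {P : Regex k → ℕ → β → Prop}
    (h : FoldRules f P) (d : β) (e : Regex k) : P e 0 (foldCode d f e.code) := by
  obtain ⟨b, hb, he⟩ := h.foldr e 0 []
  rw [StrSL.foldCode, he]
  exact hb

/-! ### Words of regular languages -/

/-- The word of numbers given by a word over `Fin k`. -/
def enc (w : List (Fin k)) : List ℕ := w.map Fin.val

lemma enc_injective : Function.Injective (enc (k := k)) :=
  List.map_injective_iff.2 Fin.val_injective

/-- The words of length at most `L` of a concatenation. -/
def catLang (L : ℕ) (A B : List (List ℕ)) : List (List ℕ) :=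
  (A.flatMap fun u => B.map fun v => u ++ v).filter fun w => leB w.length L

/-- The words of length at most `L` of an iteration. -/
def starLang (L : ℕ) (A : List (List ℕ)) : List (List ℕ) :=
  (fun X => [] :: catLang L A X)^[L] [[]]

/-- The rules for computing the words of length at most `L` of the language of an expression. -/
def langStep (L : ℕ) (s : List ℕ × ℕ) (b : List (List (List ℕ))) : List (List ℕ) :=
  bif eqB (s.1.getD 0 0) 0 then []
  else bif eqB (s.1.getD 0 0) 1 then [[]]
  else bif eqB (s.1.getD 0 0) 2 then [[s.1.getD 1 0]].filter fun w => leB w.length L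
  else bif eqB (s.1.getD 0 0) 3 then b.getD 0 []
  else bif eqB (s.1.getD 0 0) 4 then b.getD 0 [] ++ b.getD 1 []
  else bif eqB (s.1.getD 0 0) 5 then catLang L (b.getD 0 []) (b.getD 1 [])
  else bif eqB (s.1.getD 0 0) 6 then [] :: b.getD 0 []
  else bif eqB (s.1.getD 0 0) 7 then starLang L (b.getD 0 [])
  else bif eqB (s.1.getD 0 0) 8 then catLang L (b.getD 0 []) (starLang L (b.getD 0 []))
  else catLang L ((fun X => catLang L (b.getD 0 []) X)^[s.1.getD 2 0] [[]])
    ((fun X => catLang L ([] :: b.getD 0 []) X)^[s.1.getD 3 0 - s.1.getD 2 0] [[]])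

/-- Whether the word `w` is in the language of the expression with the code `c`. -/
def langB (c : List (List ℕ)) (w : List ℕ) : Bool :=
  -- Membership of `w` depends only on words of at most its length.
  (foldCode [] (langStep w.length) c).any fun v => eqB v w

/-- `A` consists of the words of length at most `L` of the language `l`. -/
def IsPart (L : ℕ) (l : Language (Fin k)) (A : List (List ℕ)) : Prop :=
  ∀ w, w ∈ A ↔ ∃ v ∈ l, v.length ≤ L ∧ enc v = w

section
variable {α : Type*} [Primcodable α]

@[fun_prop]
lemma catLang_pr {f : α → ℕ} {g h : α → List (List ℕ)} (hf : Primrec f) (hg : Primrec g)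
    (hh : Primrec h) : Primrec (fun x => catLang (f x) (g x) (h x)) := by
  unfold catLang; fun_prop

@[fun_prop]
lemma starLang_pr {f : α → ℕ} {g : α → List (List ℕ)} (hf : Primrec f) (hg : Primrec g) :
    Primrec (fun x => starLang (f x) (g x)) := by
  unfold starLang; fun_prop

@[fun_prop]
lemma langStep_pr {f : α → ℕ} {g : α → List ℕ × ℕ} {h : α → List (List (List ℕ))}
    (hf : Primrec f) (hg : Primrec g) (hh : Primrec h) :
    Primrec (fun x => langStep (f x) (g x) (h x)) := by
  unfold langStep; fun_prop

@[fun_prop]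
lemma langB_pr {f : α → List (List ℕ)} {g : α → List ℕ} (hf : Primrec f) (hg : Primrec g) :
    Primrec (fun x => langB (f x) (g x)) := by
  unfold langB; fun_prop

end

end StrSL

namespace StrSL

open PR
variable {k : ℕ}

@[simp]
lemma length_enc (w : List (Fin k)) : (enc w).length = w.length := List.length_map _

@[simp]
lemma enc_append (u v : List (Fin k)) : enc (u ++ v) = enc u ++ enc v := List.map_append

lemma IsPart.cat {L : ℕ} {l m : Language (Fin k)} {A B : List (List ℕ)} (hA : IsPart L l A)
    (hB : IsPart L m B) : IsPart L (l * m) (catLang L A B) := by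
  intro w
  simp only [catLang, List.mem_filter, List.mem_flatMap, List.mem_map, leB_iff, Language.mem_mul]
  constructor
  · rintro ⟨⟨u, hu, v, hv, rfl⟩, hw⟩
    obtain ⟨u', h1, -, rfl⟩ := (hA u).1 hu
    obtain ⟨v', h2, -, rfl⟩ := (hB v).1 hv
    exact ⟨u' ++ v', ⟨u', h1, v', h2, rfl⟩, by simpa [enc] using hw, by simp [enc]⟩
  · rintro ⟨_, ⟨u, hu, v, hv, rfl⟩, hw, rfl⟩
    rw [List.length_append] at hw
    exact ⟨⟨enc u, (hA _).2 ⟨u, hu, by omega, rfl⟩, enc v, (hB _).2 ⟨v, hv, by omega, rfl⟩,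
      by simp [enc]⟩, by simpa [enc] using hw⟩

lemma IsPart.one (L : ℕ) : IsPart L (1 : Language (Fin k)) [[]] := by
  intro w
  simp [Language.mem_one, enc, eq_comm]

lemma IsPart.add_one {L : ℕ} {l : Language (Fin k)} {A : List (List ℕ)} (hA : IsPart L l A) :
    IsPart L (l + 1) ([] :: A) := by
  intro w
  rw [List.mem_cons, hA w]
  simp only [Language.mem_add, Language.mem_one, or_and_right, exists_or]
  rw [or_comm]
  simp [enc, eq_comm]

lemma IsPart.iterate {L : ℕ} {l : Language (Fin k)} {A : List (List ℕ)} (hA : IsPart L l A)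
    (n : ℕ) : IsPart L (l ^ n) ((fun X => catLang L A X)^[n] [[]]) := by
  induction n with
  | zero => rw [pow_zero]; exact IsPart.one L
  | succ n ih => rw [Function.iterate_succ_apply', pow_succ']; exact hA.cat ih

/-- A word of length at most `L` in the star is a product of at most `L` nonempty factors, so `L`
rounds reach all of them. -/
lemma IsPart.star {L : ℕ} {l : Language (Fin k)} {A : List (List ℕ)} (hA : IsPart L l A) :
    IsPart L (KStar.kstar l) (starLang L A) := by
  have h1 : ∀ n w, w ∈ (fun X => [] :: catLang L A X)^[n] [[]] →
      ∃ v ∈ KStar.kstar l, v.length ≤ L ∧ enc v = w := by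
    have hnil : ([] : List (Fin k)) ∈ KStar.kstar l := Language.nil_mem_kstar l
    intro n
    induction n with
    | zero =>
      intro w hw
      obtain rfl := List.mem_singleton.1 hw
      exact ⟨[], hnil, by simp, rfl⟩
    | succ n ih =>
      intro w hw
      rw [Function.iterate_succ_apply', List.mem_cons] at hw
      rcases hw with rfl | hw
      · exact ⟨[], hnil, by simp, rfl⟩
      · simp only [catLang, List.mem_filter, List.mem_flatMap, List.mem_map, leB_iff] at hw
        obtain ⟨⟨u, hu, v, hv, rfl⟩, hw⟩ := hw
        obtain ⟨u', h1, -, rfl⟩ := (hA u).1 hu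
        obtain ⟨v', h2, -, rfl⟩ := ih v hv
        refine ⟨u' ++ v', ?_, by simpa [enc] using hw, by simp [enc]⟩
        obtain ⟨S, rfl, hS⟩ := Language.mem_kstar.1 h2
        exact Language.mem_kstar.2 ⟨u' :: S, rfl, List.forall_mem_cons.2 ⟨h1, hS⟩⟩
  have h2 : ∀ (S : List (List (Fin k))) n, (∀ y ∈ S, y ∈ l) → S.length ≤ n →
      S.flatten.length ≤ L → enc S.flatten ∈ (fun X => [] :: catLang L A X)^[n] [[]] := by
    intro S
    induction S with
    | nil =>
      intro n _ _ _
      cases n with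
      | zero => simp [enc]
      | succ n => rw [Function.iterate_succ_apply']; simp [enc]
    | cons y S ih =>
      intro n h1 h2 h3
      rw [List.forall_mem_cons] at h1
      rw [List.flatten_cons, List.length_append] at h3
      obtain ⟨n, rfl⟩ := Nat.exists_eq_succ_of_ne_zero (n := n) (by simp at h2; omega)
      rw [Function.iterate_succ_apply']
      refine List.mem_cons_of_mem _ ?_
      simp only [catLang, List.mem_filter, List.mem_flatMap, List.mem_map, leB_iff]
      exact ⟨⟨enc y, (hA _).2 ⟨y, h1.1, by omega, rfl⟩, _,
        ih n h1.2 (by simpa using h2) (by omega), by simp [enc]⟩, by simpa only [length_enc, List.flatten_cons, List.length_append] using h3⟩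
  intro w
  refine ⟨h1 L w, ?_⟩
  rintro ⟨v, hv, hL, rfl⟩
  rw [Language.kstar_def_nonempty] at hv
  obtain ⟨S, rfl, hS⟩ := hv
  refine h2 S L (fun y hy => (hS y hy).1) (le_trans ?_ hL) hL
  clear hL
  induction S with
  | nil => simp
  | cons y S ih =>
    rw [List.forall_mem_cons] at hS
    have := List.length_pos_of_ne_nil hS.1.2
    have := ih hS.2
    simp at this ⊢
    omega

lemma foldRules_langStep (L : ℕ) :
    FoldRules (k := k) (langStep L) (fun e _ b => IsPart L e.lang b) where
  empty n w := by
    simp [langStep, Regex.lang, eqB]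
  eps n := by simpa [langStep, eqB, Regex.lang] using IsPart.one L
  letter a n w := by
    simp only [langStep, eqB, Regex.lang]
    constructor
    · intro h
      simp at h
      exact ⟨[a], rfl, by simpa [h.1] using h.2, by simp [enc, h.1]⟩
    · rintro ⟨v, hv, hL, rfl⟩
      obtain rfl : v = [a] := hv
      simpa [enc] using hL
  group e n b h := by simpa [langStep, eqB, Regex.lang] using h
  alt e₁ e₂ n b₁ b₂ h₁ h₂ w := by
    simp [langStep, eqB, h₁ w, h₂ w, Regex.lang, Language.mem_add, or_and_right, exists_or]
  seq e₁ e₂ n b₁ b₂ h₁ h₂ := by simpa [langStep, eqB, Regex.lang] using h₁.cat h₂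
  opt g e n b h := by simpa [langStep, eqB, Regex.lang] using h.add_one
  star g e n b h := by simpa [langStep, eqB, Regex.lang] using h.star
  plus g e n b h := by simpa [langStep, eqB, Regex.lang] using h.cat h.star
  rep g m d e n b h := by
    rw [Regex.lang_rep]
    simpa [langStep, eqB] using (h.iterate m).cat (h.add_one.iterate d)

lemma langB_iff {e : Regex k} {w : List (Fin k)} : langB e.code (enc w) = true ↔ w ∈ e.lang := by
  have h := (foldRules_langStep (enc w).length).foldCode [] e
  rw [langB, List.any_eq_true]
  constructor
  · rintro ⟨v, hv, hvw⟩
    obtain ⟨u, hu, -, rfl⟩ := (h v).1 hv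
    rwa [← enc_injective (eqB_iff.1 hvw)]
  · exact fun hw => ⟨enc w, (h _).2 ⟨w, hw, by simp [enc], rfl⟩, eqB_self _⟩

/-! ### Bounds -/

/-- The rules for computing `Regex.langBound`. -/
def boundStep (s : List ℕ × ℕ) (b : List ℕ) : ℕ :=
  bif eqB (s.1.getD 0 0) 0 then 1
  else bif eqB (s.1.getD 0 0) 1 then 4
  else bif eqB (s.1.getD 0 0) 2 then 27
  else bif eqB (s.1.getD 0 0) 3 then b.getD 0 0
  else bif eqB (s.1.getD 0 0) 4 then b.getD 0 0 * b.getD 1 0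
  else bif eqB (s.1.getD 0 0) 5 then seqBound (b.getD 0 0) (b.getD 1 0)
  else bif eqB (s.1.getD 0 0) 6 then b.getD 0 0 * 4
  else bif eqB (s.1.getD 0 0) 7 then starBound (b.getD 0 0)
  else bif eqB (s.1.getD 0 0) 8 then seqBound (b.getD 0 0) (starBound (b.getD 0 0))
  else seqBound ((fun n => seqBound (b.getD 0 0) n)^[s.1.getD 2 0] 4)
    ((fun n => seqBound (b.getD 0 0 * 4) n)^[s.1.getD 3 0 - s.1.getD 2 0] 4)

lemma foldRules_boundStep : FoldRules (k := k) boundStep (fun e _ b => b = e.langBound) where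
  empty n := rfl
  eps n := rfl
  letter a n := rfl
  group e n b h := by subst h; rfl
  alt e₁ e₂ n b₁ b₂ h₁ h₂ := by subst h₁ h₂; rfl
  seq e₁ e₂ n b₁ b₂ h₁ h₂ := by subst h₁ h₂; rfl
  opt g e n b h := by subst h; rfl
  star g e n b h := by subst h; rfl
  plus g e n b h := by subst h; rfl
  rep g m d e n b h := by
    subst h
    simp only [boundStep, List.getD_cons_zero, List.getD_cons_succ, Nat.add_sub_cancel_left]
    rfl

section
variable {α : Type*} [Primcodable α]

@[fun_prop]
lemma seqBound_pr {f g : α → ℕ} (hf : Primrec f) (hg : Primrec g) :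
    Primrec (fun x => seqBound (f x) (g x)) := by unfold seqBound; fun_prop

@[fun_prop]
lemma starBound_pr {f : α → ℕ} (hf : Primrec f) :
    Primrec (fun x => starBound (f x)) := by unfold starBound; fun_prop

@[fun_prop]
lemma boundStep_pr {f : α → List ℕ × ℕ} {g : α → List ℕ} (hf : Primrec f) (hg : Primrec g) :
    Primrec (fun x => boundStep (f x) (g x)) := by unfold boundStep; fun_prop

@[fun_prop]
lemma restCount_pr {f : α → ℕ} (hf : Primrec f) :
    Primrec (fun x => restCount (f x)) := by unfold restCount; fun_prop

@[fun_prop]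
lemma profileBound_pr {f g h i : α → ℕ} (hf : Primrec f) (hg : Primrec g) (hh : Primrec h)
    (hi : Primrec i) : Primrec (fun x => PSST.profileBound (f x) (g x) (h x) (i x)) := by
  unfold PSST.profileBound PSST.profileCount; fun_prop

end

end StrSL

namespace StrSL

open PR
variable {k : ℕ}

/-! ### Tables of transducers -/

/-- The label `ε` is written as `0` and the letter `a` as `a + 1`; the same code is used for the
symbols of the values of string variables. -/
def lab (a : Option (Fin k)) : ℕ := a.elim 0 fun a => a.val + 1

/-- A variable `y` in an assignment is written as `(0, y)`, and other symbols as `(1, ·)`. -/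
def tok : ℕ ⊕ Option (Fin k) → ℕ × ℕ := Sum.elim (fun y => (0, y)) fun c => (1, lab c)

/-- An assignment of the variables below a bound. -/
abbrev AsgTab : Type := List (List (ℕ × ℕ))

/-- A transition: its label, its target and its assignment. -/
abbrev MoveTab : Type := ℕ × List ℕ × AsgTab

/-- The row of a state: the state, whether it is in the two sets of final states, and its
transitions. -/
abbrev RowTab : Type := List ℕ × Bool × Bool × List MoveTab

/-- A transducer: its initial state and the rows of its states. -/
abbrev Tab : Type := List ℕ × List RowTab

def encAsg (V : ℕ) (A : Asg k) : AsgTab := (List.range V).map fun x => (A x).map tok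

def encMove (V : ℕ) (T : PSST k) (s : T.Q → List ℕ) (q : T.Q) (t : Option (Fin k) × T.Q) :
    MoveTab := (lab t.1, s t.2, encAsg V (T.E q t.1 t.2))

def rowOf (V : ℕ) (T : PSST k) (s : T.Q → List ℕ) (q : T.Q) : RowTab :=
  (s q, T.fin1 q, T.fin2 q, (T.moves q).map (encMove V T s q))

/-- `t` is a table of the transducer `T`, with assignments of the variables below `V`. -/
def Rep (V : ℕ) (t : Tab) (T : PSST k) : Prop :=
  ∃ s : T.Q → List ℕ, Function.Injective s ∧ t.1 = s T.start ∧
    ∃ qs : List T.Q, (∀ q, q ∈ qs) ∧ t.2 = qs.map (rowOf V T s)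

/-- The table supplies a computable bound for the number of states, as needed in the bounds for the
congruences. -/
lemma Rep.card_le {V : ℕ} {t : Tab} {T : PSST k} (h : Rep V t T) :
    Nat.card T.Q ≤ t.2.length := by
  obtain ⟨s, -, -, qs, hq, ht⟩ := h
  rw [ht, List.length_map]
  let _ := Fintype.ofFinite T.Q
  rw [Nat.card_eq_fintype_card, ← Finset.card_univ]
  refine (Finset.card_le_card fun q _ => ?_).trans (List.toFinset_card_le qs)
  simpa using hq q

def keepTab (V : ℕ) : AsgTab := (List.range V).map fun x => [(0, x)]

def nullTab (V lo hi : ℕ) : AsgTab :=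
  (List.range V).map fun x => bif leB lo x && !leB hi x then [(1, 0)] else [(0, x)]

lemma encAsg_nullify (V lo hi : ℕ) : encAsg V (Asg.nullify k lo hi) = nullTab V lo hi := by
  refine List.map_congr_left fun x _ => ?_
  unfold Asg.nullify
  by_cases h : lo ≤ x ∧ x < hi
  · rw [if_pos h]
    simp [leB, h.1, not_le.2 h.2, tok, lab]
  · rw [if_neg h]
    rw [not_and, not_lt] at h
    by_cases h1 : lo ≤ x
    · simp [leB, h1, h h1, tok]
    · simp [leB, h1, tok]

def tagMove (c : List ℕ) (m : MoveTab) : MoveTab := (m.1, c ++ m.2.1, m.2.2)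

def tagMoves (c : List ℕ) (l : List MoveTab) : List MoveTab := l.map fun m => tagMove c m

/-- The letter transitions. -/
def lettersTab (l : List MoveTab) : List MoveTab := l.filter fun m => !eqB m.1 0

def orderTab (g : Bool) (p q : MoveTab) : List MoveTab := bif g then [p, q] else [q, p]

lemma map_order {α : Type} (g : Bool) (p q : α) (f : α → MoveTab) :
    (order g p q).map f = orderTab g (f p) (f q) := by cases g <;> rfl

def emptyTab : Tab := ([0], [([0], false, false, [])])

def epsTab (V : ℕ) : Tab :=
  ([0], [([0], false, false, [(0, [1], keepTab V)]), ([1], true, false, [])])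

def letterTab (V a : ℕ) : Tab :=
  ([0], [([0], false, false, [(0, [1], keepTab V)]),
    ([1], false, false, [(a + 1, [2], keepTab V)]), ([2], false, true, [])])

def altTab (V : ℕ) (t₁ t₂ : Tab) : Tab :=
  ([0], ([0], false, false, [(0, [1] ++ t₁.1, keepTab V), (0, [2] ++ t₂.1, keepTab V)]) ::
    ((t₁.2.map fun r => ([1] ++ r.1, r.2.1, r.2.2.1, tagMoves [1] r.2.2.2)) ++
      t₂.2.map fun r => ([2] ++ r.1, r.2.1, r.2.2.1, tagMoves [2] r.2.2.2)))

def concatTab (V lo hi : ℕ) (t₁ t₂ : Tab) : Tab :=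
  ([1] ++ t₁.1,
    (t₁.2.map fun r => ([1] ++ r.1, false, false,
      bif r.2.1 then (0, [2] ++ t₂.1, nullTab V lo hi) :: tagMoves [1] (lettersTab r.2.2.2)
      else bif r.2.2.1 then (0, [3] ++ t₂.1, nullTab V lo hi) :: tagMoves [1] (lettersTab r.2.2.2)
      else tagMoves [1] r.2.2.2)) ++
    ((t₂.2.map fun r => ([2] ++ r.1, r.2.1, r.2.2.1, tagMoves [2] r.2.2.2)) ++
      t₂.2.map fun r => ([3] ++ r.1, false, r.2.1 || r.2.2.1, tagMoves [3] r.2.2.2)))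

def initTab (V : ℕ) (t : Tab) : Tab :=
  ([0], ([0], false, false, [(0, [1] ++ t.1, keepTab V)]) ::
    t.2.map fun r => ([1] ++ r.1, r.2.1, r.2.2.1, tagMoves [1] r.2.2.2))

def optTab (V : ℕ) (g : Bool) (t : Tab) : Tab :=
  ([0], ([0], false, false, orderTab g (0, [2] ++ t.1, keepTab V) (0, [1], keepTab V)) ::
    ([1], true, false, []) ::
    t.2.map fun r => ([2] ++ r.1, false, r.2.2.1, tagMoves [2] r.2.2.2))

def starTab (V : ℕ) (g : Bool) (lo hi : ℕ) (t : Tab) : Tab :=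
  ([0], ([0], false, false, orderTab g (0, [3] ++ t.1, keepTab V) (0, [1], keepTab V)) ::
    ([1], true, false, []) :: ([2], false, true, []) ::
    t.2.map fun r => ([3] ++ r.1, false, false,
      bif r.2.1 then (0, [3] ++ t.1, nullTab V lo hi) ::
        (lettersTab r.2.2.2).map fun m => (m.1, [3] ++ m.2.1, nullTab V lo hi)
      else bif r.2.2.1 then orderTab g (0, [3] ++ t.1, nullTab V lo hi) (0, [2], keepTab V) ++
        (lettersTab r.2.2.2).map fun m => (m.1, [3] ++ m.2.1, nullTab V lo hi)
      else tagMoves [3] r.2.2.2))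

def powTab (V lo hi : ℕ) (t : Tab) (n : ℕ) : Tab := (fun X => concatTab V lo hi X t)^[n] t

def upToTab (V : ℕ) (g : Bool) (lo hi n : ℕ) (t : Tab) : Tab :=
  ([2, 0] ++ t.1, ([0], true, false, []) :: ([1], false, true, []) ::
    (List.range (n + 1)).flatMap fun i => t.2.map fun r => ([2, i] ++ r.1, false, false,
      bif r.2.2.1 then
        (bif leB (i + 2) (n + 1) then
          orderTab g (0, [2, i + 1] ++ t.1, nullTab V lo hi) (0, [1], keepTab V)
        else [(0, [1], keepTab V)]) ++ tagMoves [2, i] (lettersTab r.2.2.2)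
      else bif eqB i 0 && eqB r.1 t.1 then
        (bif g then tagMoves [2, i] r.2.2.2 ++ [(0, [0], keepTab V)]
        else (0, [0], keepTab V) :: tagMoves [2, i] r.2.2.2)
      else tagMoves [2, i] r.2.2.2))

def repTab (V : ℕ) (g : Bool) (lo hi m d : ℕ) (t : Tab) : Tab :=
  -- The predecessors appear because `powTab` with argument `n` has `n + 1` factors and `upToTab`
  -- has `n + 1` copies.
  bif eqB m 0 then bif eqB d 0 then epsTab V else upToTab V g lo hi (d - 1) t
  else bif eqB d 0 then powTab V lo hi t (m - 1)
  else concatTab V lo hi (powTab V lo hi t (m - 1)) (upToTab V g lo hi (d - 1) t)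

def trackTab (V n : ℕ) (t : Tab) : Tab :=
  (t.1, t.2.map fun r => (r.1, r.2.1, r.2.2.1, r.2.2.2.map fun m => (m.1, m.2.1,
    (List.range V).map fun x => bif eqB x n then bif eqB r.1 t.1 then []
        else (0, n) :: bif eqB m.1 0 then [] else [(1, m.1)]
      else m.2.2.getD x [])))

def copyTab (V n : ℕ) (t : Tab) : Tab :=
  (t.1, t.2.map fun r => (r.1, r.2.1, r.2.2.1, r.2.2.2.map fun m => (m.1, m.2.1,
    (List.range V).map fun x => bif eqB x n then m.2.2.getD (n + 1) [] else m.2.2.getD x [])))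

section moves

variable {V : ℕ} {T T' : PSST k}

/-- The letter transitions out of `q`. -/
def PSST.letters (T : PSST k) (q : T.Q) : List (Option (Fin k) × T.Q) :=
  (List.finRange k).flatMap fun a => (T.δ q a).map fun p => (some a, p)

lemma rowOf_eq {s : T.Q → List ℕ} {q : T.Q} {r : RowTab} (h1 : s q = r.1)
    (h2 : T.fin1 q = r.2.1) (h3 : T.fin2 q = r.2.2.1)
    (h4 : (T.moves q).map (encMove V T s q) = r.2.2.2) : rowOf V T s q = r := by
  rw [rowOf, h1, h2, h3, h4]

lemma moves_eps {q : T.Q} (hδ : ∀ a, T.δ q a = []) (f : Option (Fin k) × T.Q → MoveTab) :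
    (T.moves q).map f = ((T.τ q).1 ++ (T.τ q).2).map fun p => f (none, p) := by
  have h : ((List.finRange k).flatMap fun a => (T.δ q a).map
      fun p => ((some a : Option (Fin k)), p)) = [] := by
    rw [List.flatMap_eq_nil_iff]
    intro a _
    rw [hδ, List.map_nil]
  rw [PSST.moves, h, List.nil_append, ← List.map_append, List.map_map]
  rfl

lemma lettersTab_eq (s : T.Q → List ℕ) (q : T.Q) :
    lettersTab ((T.moves q).map (encMove V T s q)) = (T.letters q).map (encMove V T s q) := by
  have h1 : ∀ l : List T.Q, ((l.map fun p => ((none : Option (Fin k)), p)).map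
      (encMove V T s q)).filter (fun m => !eqB m.1 0) = [] := fun l => by
    rw [List.filter_eq_nil_iff]
    simp [encMove, lab]
  have h2 : ((T.letters q).map (encMove V T s q)).filter (fun m => !eqB m.1 0) =
      (T.letters q).map (encMove V T s q) := by
    rw [List.filter_eq_self]
    intro m hm
    obtain ⟨t, ht, rfl⟩ := List.mem_map.1 hm
    obtain ⟨a, -, ht⟩ := List.mem_flatMap.1 ht
    obtain ⟨p, -, rfl⟩ := List.mem_map.1 ht
    simp [encMove, lab, eqB]
  rw [lettersTab, PSST.moves, List.map_append, List.map_append, List.filter_append,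
    List.filter_append, h1, h1, List.append_nil, List.nil_append]
  exact h2

variable {s : T.Q → List ℕ} {s' : T'.Q → List ℕ} {f : T.Q → T'.Q} {q : T.Q} {c : List ℕ}

lemma letters_map (hδ : ∀ a, T'.δ (f q) a = (T.δ q a).map f) :
    T'.letters (f q) = (T.letters q).map fun t => (t.1, f t.2) := by
  simp only [PSST.letters, List.map_flatMap, hδ, List.map_map]
  rfl

lemma encMove_tag (hs : ∀ q, s' (f q) = c ++ s q)
    (hE : ∀ a q', T'.E (f q) a (f q') = T.E q a q') (l : List (Option (Fin k) × T.Q)) :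
    (l.map fun t => (t.1, f t.2)).map (encMove V T' s' (f q)) =
      tagMoves c (l.map (encMove V T s q)) := by
  rw [tagMoves, List.map_map, List.map_map]
  refine List.map_congr_left fun t _ => ?_
  simp only [Function.comp_apply, encMove, tagMove, hs, hE]

lemma moves_map (hδ : ∀ a, T'.δ (f q) a = (T.δ q a).map f)
    (hτ : T'.τ (f q) = ((T.τ q).1.map f, (T.τ q).2.map f)) :
    T'.moves (f q) = (T.moves q).map fun t => (t.1, f t.2) := by
  have h := letters_map hδ
  simp only [PSST.letters] at h
  rw [PSST.moves, h, hτ, PSST.moves]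
  simp only [List.map_append, List.map_map]
  rfl

/-- For states at which `T'` contains an unchanged copy of `T`. The states of a copy are named by
putting a tag `c` in front of their names. -/
lemma moves_tag (hs : ∀ q, s' (f q) = c ++ s q) (hδ : ∀ a, T'.δ (f q) a = (T.δ q a).map f)
    (hτ : T'.τ (f q) = ((T.τ q).1.map f, (T.τ q).2.map f))
    (hE : ∀ a q', T'.E (f q) a (f q') = T.E q a q') :
    (T'.moves (f q)).map (encMove V T' s' (f q)) =
      tagMoves c ((T.moves q).map (encMove V T s q)) := by
  rw [moves_map hδ hτ, encMove_tag hs hE]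

lemma moves_new (hδ : ∀ a, T'.δ (f q) a = (T.δ q a).map f) {l : List T'.Q}
    (hτ : T'.τ (f q) = (l, [])) (g : Option (Fin k) × T'.Q → MoveTab) :
    (T'.moves (f q)).map g = (l.map fun p => g (none, p)) ++
      ((T.letters q).map fun t => (t.1, f t.2)).map g := by
  rw [← letters_map hδ, PSST.moves, hτ, PSST.letters]
  simp only [List.map_nil, List.append_nil, List.map_append, List.map_map]
  rfl

/-- For final states of a component: the construction replaces their `ε`-transitions by `l` and
keeps the letter transitions, now with lower priority than all of `l`. -/
lemma moves_tag_new (hs : ∀ q, s' (f q) = c ++ s q)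
    (hδ : ∀ a, T'.δ (f q) a = (T.δ q a).map f) {l : List T'.Q} (hτ : T'.τ (f q) = (l, []))
    (hE : ∀ a q', T'.E (f q) a (f q') = T.E q a q') :
    (T'.moves (f q)).map (encMove V T' s' (f q)) =
      (l.map fun p => encMove V T' s' (f q) (none, p)) ++
        tagMoves c (lettersTab ((T.moves q).map (encMove V T s q))) := by
  rw [moves_new hδ hτ, encMove_tag hs hE, lettersTab_eq]

/-- The variant for the star, where all transitions from a final state into the component have the
same assignment. -/
lemma moves_const_new (hs : ∀ q, s' (f q) = c ++ s q)
    (hδ : ∀ a, T'.δ (f q) a = (T.δ q a).map f) {l : List T'.Q} (hτ : T'.τ (f q) = (l, []))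
    {A : AsgTab} (hE : ∀ a q', encAsg V (T'.E (f q) a (f q')) = A) :
    (T'.moves (f q)).map (encMove V T' s' (f q)) =
      (l.map fun p => encMove V T' s' (f q) (none, p)) ++
        (lettersTab ((T.moves q).map (encMove V T s q))).map fun m => (m.1, c ++ m.2.1, A) := by
  rw [moves_new hδ hτ, lettersTab_eq, List.map_map, List.map_map]
  refine congrArg _ (List.map_congr_left fun t _ => ?_)
  simp only [Function.comp_apply, encMove, hs, hE]

/-- For the start of the first copy in `upTo`: in the greedy case the exit is the last choice. The
lazy case, where it is the first choice, is `moves_tag_cons`. -/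
lemma moves_tag_concat (hs : ∀ q, s' (f q) = c ++ s q)
    (hδ : ∀ a, T'.δ (f q) a = (T.δ q a).map f) {p : T'.Q}
    (hτ : T'.τ (f q) = ((T.τ q).1.map f, (T.τ q).2.map f ++ [p]))
    (hE : ∀ a q', T'.E (f q) a (f q') = T.E q a q') :
    (T'.moves (f q)).map (encMove V T' s' (f q)) =
      tagMoves c ((T.moves q).map (encMove V T s q)) ++ [encMove V T' s' (f q) (none, p)] := by
  have h := letters_map hδ
  simp only [PSST.letters] at h
  rw [← encMove_tag hs hE, PSST.moves, h, hτ, PSST.moves]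
  simp [List.map_append, List.map_map, Function.comp_def]

lemma moves_tag_cons (hs : ∀ q, s' (f q) = c ++ s q)
    (hδ : ∀ a, T'.δ (f q) a = (T.δ q a).map f) {p : T'.Q}
    (hτ : T'.τ (f q) = (p :: (T.τ q).1.map f, (T.τ q).2.map f))
    (hE : ∀ a q', T'.E (f q) a (f q') = T.E q a q') :
    (T'.moves (f q)).map (encMove V T' s' (f q)) =
      encMove V T' s' (f q) (none, p) :: tagMoves c ((T.moves q).map (encMove V T s q)) := by
  have h := letters_map hδ
  simp only [PSST.letters] at h
  rw [← encMove_tag hs hE, PSST.moves, h, hτ, PSST.moves]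
  simp [List.map_append, List.map_map, Function.comp_def]

end moves

lemma map_rows {V : ℕ} {T T' : PSST k} {s : T.Q → List ℕ} {s' : T'.Q → List ℕ} (f : T.Q → T'.Q)
    {F : RowTab → RowTab} {rows : List RowTab} {qs : List T.Q} (h : rows = qs.map (rowOf V T s))
    (hF : ∀ q, rowOf V T' s' (f q) = F (rowOf V T s q)) :
    rows.map F = (qs.map f).map (rowOf V T' s') := by
  rw [h, List.map_map, List.map_map]
  exact List.map_congr_left fun q _ => (hF q).symm

lemma flatMap_single {α β : Type*} [DecidableEq α] {l : List α} (hl : l.Nodup) {a : α}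
    (ha : a ∈ l) {f : α → β} : (l.flatMap fun b => if b = a then [f b] else []) = [f a] := by
  induction l with
  | nil => simp at ha
  | cons b l ih =>
    rw [List.nodup_cons] at hl
    rw [List.flatMap_cons]
    by_cases hb : b = a
    · subst hb
      rw [if_pos rfl, List.flatMap_eq_nil_iff.2, List.append_nil]
      intro c hc
      rw [if_neg]
      rintro rfl
      exact hl.1 hc
    · rw [if_neg hb, List.nil_append, ih hl.2 ((List.mem_cons.1 ha).resolve_left (Ne.symm hb))]

namespace Rep

variable {V : ℕ}

lemma empty : Rep V emptyTab (PSST.emptyCore k) :=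
  ⟨fun _ => [0], fun _ _ _ => rfl, rfl, [()], fun _ => List.mem_singleton.2 rfl,
    congrArg (fun r => [r]) (rowOf_eq rfl rfl rfl (moves_eps (fun _ => rfl) _)).symm⟩

lemma eps : Rep V (epsTab V) (PSST.epsCore k) := by
  unfold PSST.epsCore
  refine ⟨fun q : Bool => [q.toNat], fun p q h => ?_, rfl, [false, true], fun q => ?_, ?_⟩
  · exact toNat_bool_inj (List.cons.inj h).1
  · cases q
    · exact List.mem_cons_self
    · exact List.mem_cons_of_mem _ List.mem_cons_self
  · exact congrArg₂ (fun r r' => [r, r'])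
      (rowOf_eq rfl rfl rfl (moves_eps (fun _ => rfl) _)).symm
      (rowOf_eq rfl rfl rfl (moves_eps (fun _ => rfl) _)).symm

lemma letter (a : Fin k) : Rep V (letterTab V a) (PSST.letterCore a) := by
  refine ⟨fun q : Fin 3 => [q.val], fun p q h => ?_, rfl, ([0, 1, 2] : List (Fin 3)),
    fun q => ?_, ?_⟩
  · exact Fin.val_injective (List.cons.inj h).1
  · change q ∈ ([0, 1, 2] : List (Fin 3))
    exact (by decide : ∀ q : Fin 3, q ∈ [0, 1, 2]) q
  · refine congrArg₂ List.cons (rowOf_eq rfl rfl rfl (moves_eps (fun _ => rfl) _)).symm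
      (congrArg₂ List.cons (rowOf_eq rfl rfl rfl ?_).symm
      (congrArg (fun r => [r]) (rowOf_eq rfl rfl rfl (moves_eps (fun _ => rfl) _)).symm))
    have h : (PSST.letterCore a).moves (1 : Fin 3) = [(some a, (2 : Fin 3))] := by
      refine (List.append_nil _).trans ((flatMap_single (f := fun b => ((some b, (2 : Fin 3)) :
        Option (Fin k) × Fin 3)) (List.nodup_finRange k) (List.mem_finRange a)).symm.trans ?_).symm
      refine List.flatMap_congr fun b _ => ?_
      by_cases hb : b = a
      · rw [if_pos hb]
        exact congrArg (List.map _) (if_pos ⟨rfl, hb⟩ :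
          (if (1 : Fin 3) = 1 ∧ b = a then [(2 : Fin 3)] else []) = [2]).symm
      · rw [if_neg hb]
        exact congrArg (List.map _) (if_neg fun h => hb h.2 :
          (if (1 : Fin 3) = 1 ∧ b = a then [(2 : Fin 3)] else []) = []).symm
    exact congrArg (List.map _) h

lemma alt {t₁ t₂ : Tab} {T₁ T₂ : PSST k} (h₁ : Rep V t₁ T₁) (h₂ : Rep V t₂ T₂) :
    Rep V (altTab V t₁ t₂) (PSST.altCore T₁ T₂) := by
  obtain ⟨s₁, hi₁, hs₁, qs₁, hq₁, hr₁⟩ := h₁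
  obtain ⟨s₂, hi₂, hs₂, qs₂, hq₂, hr₂⟩ := h₂
  rw [altTab, hs₁, hs₂]
  refine ⟨fun q : Option (T₁.Q ⊕ T₂.Q) => q.elim [0] (Sum.elim (fun q => [1] ++ s₁ q)
    fun q => [2] ++ s₂ q), ?_, rfl, none :: (qs₁.map (fun q => some (.inl q)) ++
      qs₂.map fun q => some (.inr q)), ?_, ?_⟩
  · rintro (_ | p | p) (_ | q | q) h <;>
      first
      | rfl
      | (simp at h; done)
      | exact congrArg (fun q => some (Sum.inl q)) (hi₁ (List.cons.inj h).2)
      | exact congrArg (fun q => some (Sum.inr q)) (hi₂ (List.cons.inj h).2)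
  · rintro (_ | q | q)
    · exact List.mem_cons_self
    · exact List.mem_cons_of_mem _ (List.mem_append_left _ (List.mem_map_of_mem (hq₁ q)))
    · exact List.mem_cons_of_mem _ (List.mem_append_right _ (List.mem_map_of_mem (hq₂ q)))
  · refine (congrArg₂ List.cons (rowOf_eq rfl rfl rfl (moves_eps (fun _ => rfl) _)).symm
      ((congrArg₂ (· ++ ·) (map_rows _ hr₁ fun q => ?_) (map_rows _ hr₂ fun q => ?_)).trans
        List.map_append.symm))
    · exact rowOf_eq rfl rfl rfl (moves_tag (T := T₁) (T' := PSST.altCore T₁ T₂)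
        (f := fun q => some (.inl q)) (fun _ => rfl) (fun _ => rfl) rfl fun _ _ => rfl)
    · exact rowOf_eq rfl rfl rfl (moves_tag (T := T₂) (T' := PSST.altCore T₁ T₂)
        (f := fun q => some (.inr q)) (fun _ => rfl) (fun _ => rfl) rfl fun _ _ => rfl)

lemma init {t : Tab} {T : PSST k} (h : Rep V t T) : Rep V (initTab V t) (PSST.initCore T) := by
  obtain ⟨s, hi, hs, qs, hq, hr⟩ := h
  rw [initTab, hs]
  refine ⟨fun q : Option T.Q => q.elim [0] fun q => [1] ++ s q, ?_, rfl,
    none :: qs.map (fun q => some q), ?_, ?_⟩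
  · rintro (_ | p) (_ | q) h <;>
      first
      | rfl
      | (simp at h; done)
      | exact congrArg some (hi (List.cons.inj h).2)
  · rintro (_ | q)
    · exact List.mem_cons_self
    · exact List.mem_cons_of_mem _ (List.mem_map_of_mem (hq q))
  · refine (congrArg₂ List.cons (rowOf_eq rfl rfl rfl (moves_eps (fun _ => rfl) _)).symm
      (map_rows _ hr fun q => ?_))
    exact rowOf_eq rfl rfl rfl (moves_tag (T := T) (T' := PSST.initCore T)
        (f := fun q => some q) (fun _ => rfl) (fun _ => rfl) rfl fun _ _ => rfl)

lemma opt {t : Tab} {T : PSST k} (g : Bool) (h : Rep V t T) :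
    Rep V (optTab V g t) (PSST.optCore g T) := by
  obtain ⟨s, hi, hs, qs, hq, hr⟩ := h
  rw [optTab, hs]
  refine ⟨fun q : T.Q ⊕ Bool => q.elim (fun q => [2] ++ s q) fun b => [b.toNat], ?_, rfl,
    .inr false :: .inr true :: qs.map (fun q => .inl q), ?_, ?_⟩
  · rintro (p | _ | _) (q | _ | _) h <;>
      first
      | rfl
      | (simp at h; done)
      | exact congrArg Sum.inl (hi (List.cons.inj h).2)
  · rintro (q | _ | _)
    · exact List.mem_cons_of_mem _ (List.mem_cons_of_mem _ (List.mem_map_of_mem (hq q)))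
    · exact List.mem_cons_self
    · exact List.mem_cons_of_mem _ List.mem_cons_self
  · refine congrArg₂ List.cons (rowOf_eq rfl rfl rfl ((moves_eps (fun _ => rfl) _).trans ?_)).symm
      (congrArg₂ List.cons (rowOf_eq rfl rfl rfl (moves_eps (fun _ => rfl) _)).symm
      (map_rows _ hr fun q => ?_))
    · exact (congrArg (List.map _) (List.append_nil _)).trans (map_order _ _ _ _)
    · exact rowOf_eq rfl rfl rfl (moves_tag (T := T) (T' := PSST.optCore g T)
        (f := fun q => .inl q) (fun _ => rfl) (fun _ => rfl) rfl fun _ _ => rfl)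

lemma concat {t₁ t₂ : Tab} {T₁ T₂ : PSST k} (lo hi : ℕ) (h₁ : Rep V t₁ T₁) (h₂ : Rep V t₂ T₂) :
    Rep V (concatTab V lo hi t₁ t₂) (PSST.concat T₁ T₂ lo hi) := by
  obtain ⟨s₁, hi₁, hs₁, qs₁, hq₁, hr₁⟩ := h₁
  obtain ⟨s₂, hi₂, hs₂, qs₂, hq₂, hr₂⟩ := h₂
  rw [concatTab, hs₁, hs₂]
  refine ⟨fun q : T₁.Q ⊕ (T₂.Q ⊕ T₂.Q) => q.elim (fun q => [1] ++ s₁ q)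
    (Sum.elim (fun q => [2] ++ s₂ q) fun q => [3] ++ s₂ q), ?_, rfl,
    qs₁.map (fun q => .inl q) ++
      (qs₂.map (fun q => .inr (.inl q)) ++ qs₂.map fun q => .inr (.inr q)), ?_, ?_⟩
  · rintro (p | p | p) (q | q | q) h <;>
      first
      | (simp at h; done)
      | exact congrArg Sum.inl (hi₁ (List.cons.inj h).2)
      | exact congrArg (fun q => Sum.inr (Sum.inl q)) (hi₂ (List.cons.inj h).2)
      | exact congrArg (fun q => Sum.inr (Sum.inr q)) (hi₂ (List.cons.inj h).2)
  · rintro (q | q | q)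
    · exact List.mem_append_left _ (List.mem_map_of_mem (hq₁ q))
    · exact List.mem_append_right _ (List.mem_append_left _ (List.mem_map_of_mem (hq₂ q)))
    · exact List.mem_append_right _ (List.mem_append_right _ (List.mem_map_of_mem (hq₂ q)))
  · refine ((congrArg₂ (· ++ ·) (map_rows _ hr₁ fun q => ?_)
      ((congrArg₂ (· ++ ·) (map_rows _ hr₂ fun q => ?_) (map_rows _ hr₂ fun q => ?_)).trans
        List.map_append.symm)).trans List.map_append.symm)
    · refine rowOf_eq rfl rfl rfl ?_
      have h := encAsg_nullify (k := k) V lo hi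
      cases h1 : T₁.fin1 q with
      | true =>
        simp only [rowOf, h1, cond_true]
        refine (moves_tag_new (T := T₁) (T' := PSST.concat T₁ T₂ lo hi) (f := fun q => .inl q)
          (s := s₁) (c := [1]) (l := [.inr (.inl T₂.start)]) (fun _ => rfl) (fun _ => rfl)
          (if_pos h1) fun _ _ => rfl).trans ?_
        rw [← h]
        rfl
      | false =>
        cases h2 : T₁.fin2 q with
        | true =>
          simp only [rowOf, h1, h2, cond_true, cond_false]
          refine (moves_tag_new (T := T₁) (T' := PSST.concat T₁ T₂ lo hi) (f := fun q => .inl q)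
            (s := s₁) (c := [1]) (l := [.inr (.inr T₂.start)]) (fun _ => rfl) (fun _ => rfl)
            ((if_neg (by simp [h1])).trans (if_pos h2)) fun _ _ => rfl).trans ?_
          rw [← h]
          rfl
        | false =>
          simp only [rowOf, h1, h2, cond_false]
          exact moves_tag (T := T₁) (T' := PSST.concat T₁ T₂ lo hi) (f := fun q => .inl q)
            (fun _ => rfl) (fun _ => rfl) ((if_neg (by simp [h1])).trans (if_neg (by simp [h2])))
            fun _ _ => rfl
    · exact rowOf_eq rfl rfl rfl (moves_tag (T := T₂) (T' := PSST.concat T₁ T₂ lo hi)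
        (f := fun q => .inr (.inl q)) (fun _ => rfl) (fun _ => rfl) rfl fun _ _ => rfl)
    · exact rowOf_eq rfl rfl rfl (moves_tag (T := T₂) (T' := PSST.concat T₁ T₂ lo hi)
        (f := fun q => .inr (.inr q)) (fun _ => rfl) (fun _ => rfl) rfl fun _ _ => rfl)

lemma pow {t : Tab} {T : PSST k} (lo hi : ℕ) (h : Rep V t T) (n : ℕ) :
    Rep V (powTab V lo hi t n) (T.pow lo hi n) := by
  induction n with
  | zero => exact h
  | succ n ih =>
    rw [powTab, Function.iterate_succ_apply']
    exact ih.concat lo hi h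

lemma star {t : Tab} {T : PSST k} (g : Bool) (lo hi : ℕ) (h : Rep V t T) :
    Rep V (starTab V g lo hi t) (PSST.starCore g T lo hi) := by
  obtain ⟨s, hi', hs, qs, hq, hr⟩ := h
  rw [starTab, hs]
  refine ⟨fun q : T.Q ⊕ Fin 3 => q.elim (fun q => [3] ++ s q) fun i => [i.val], ?_, rfl,
    .inr (0 : Fin 3) :: .inr (1 : Fin 3) :: .inr (2 : Fin 3) :: qs.map (fun q => .inl q), ?_, ?_⟩
  · rintro (p | i) (q | j) h
    · exact congrArg Sum.inl (hi' (List.cons.inj h).2)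
    · have := (List.cons.inj h).1
      omega
    · have := (List.cons.inj h).1
      omega
    · exact congrArg Sum.inr (Fin.val_injective (List.cons.inj h).1)
  · rintro (q | i)
    · exact List.mem_cons_of_mem _ (List.mem_cons_of_mem _ (List.mem_cons_of_mem _
        (List.mem_map_of_mem (hq q))))
    · obtain rfl | rfl | rfl := (by decide : ∀ i : Fin 3, i = 0 ∨ i = 1 ∨ i = 2) i
      · exact List.mem_cons_self
      · exact List.mem_cons_of_mem _ List.mem_cons_self
      · exact List.mem_cons_of_mem _ (List.mem_cons_of_mem _ List.mem_cons_self)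
  · refine congrArg₂ List.cons (rowOf_eq rfl rfl rfl ((moves_eps (fun _ => rfl) _).trans ?_)).symm
      (congrArg₂ List.cons (rowOf_eq rfl rfl rfl (moves_eps (fun _ => rfl) _)).symm
      (congrArg₂ List.cons (rowOf_eq rfl rfl rfl (moves_eps (fun _ => rfl) _)).symm
      (map_rows _ hr fun q => rowOf_eq rfl rfl rfl ?_)))
    · exact (congrArg (List.map _) (List.append_nil _)).trans (map_order _ _ _ _)
    · have h := encAsg_nullify (k := k) V lo hi
      cases h1 : T.fin1 q with
      | true =>
        simp only [rowOf, h1, cond_true]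
        have hE : ∀ a q', encAsg V ((PSST.starCore g T lo hi).E (.inl q) a (.inl q')) =
          nullTab V lo hi := fun a q' => (congrArg (encAsg V) (if_pos (by simp [h1]))).trans h
        refine (moves_const_new (T := T) (T' := PSST.starCore g T lo hi) (f := fun q => .inl q)
          (s := s) (c := [3]) (l := [.inl T.start]) (fun _ => rfl) (fun _ => rfl)
          (if_pos h1) hE).trans ?_
        exact congrArg₂ List.cons (congrArg (fun A => (0, [3] ++ s T.start, A)) (hE _ _)) rfl
      | false =>
        cases h2 : T.fin2 q with
        | true =>
          simp only [rowOf, h1, h2, cond_true, cond_false]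
          have hE : ∀ a q', encAsg V ((PSST.starCore g T lo hi).E (.inl q) a (.inl q')) =
            nullTab V lo hi := fun a q' => (congrArg (encAsg V) (if_pos (by simp [h2]))).trans h
          refine (moves_const_new (T := T) (T' := PSST.starCore g T lo hi) (f := fun q => .inl q)
            (s := s) (c := [3]) (l := order g (.inl T.start) (.inr (2 : Fin 3))) (fun _ => rfl)
            (fun _ => rfl) ((if_neg (by simp [h1])).trans (if_pos h2)) hE).trans ?_
          refine congrArg₂ (· ++ ·) ((map_order _ _ _ _).trans ?_) rfl
          exact congrArg (fun A => orderTab g (0, [3] ++ s T.start, A) (0, [2], keepTab V))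
            (hE _ _)
        | false =>
          simp only [rowOf, h1, h2, cond_false]
          exact moves_tag (T := T) (T' := PSST.starCore g T lo hi) (f := fun q => .inl q)
            (fun _ => rfl) (fun _ => rfl) ((if_neg (by simp [h1])).trans (if_neg (by simp [h2])))
            fun _ _ => if_neg (by simp [h1, h2])

lemma upTo {t : Tab} {T : PSST k} (g : Bool) (lo hi n : ℕ) (h : Rep V t T) :
    Rep V (upToTab V g lo hi n t) (PSST.upTo g T lo hi n) := by
  obtain ⟨s, hi', hs, qs, hq, hr⟩ := h
  rw [upToTab, hs]
  refine ⟨fun q : (Fin (n + 1) × T.Q) ⊕ Bool => q.elim (fun q => [2, q.1.val] ++ s q.2)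
      fun b => [b.toNat], ?_, rfl, .inr false :: .inr true ::
      (List.finRange (n + 1)).flatMap fun i => qs.map fun q => .inl (i, q), ?_, ?_⟩
  · rintro (⟨i, p⟩ | _ | _) (⟨j, q⟩ | _ | _) h <;>
      first
      | rfl
      | (simp at h; done)
      | exact congrArg Sum.inl (Prod.ext (Fin.val_injective (List.cons.inj (List.cons.inj h).2).1)
          (hi' (List.cons.inj (List.cons.inj h).2).2))
  · rintro (⟨i, q⟩ | _ | _)
    · exact List.mem_cons_of_mem _ (List.mem_cons_of_mem _ (List.mem_flatMap.2
        ⟨i, List.mem_finRange i, List.mem_map_of_mem (hq q)⟩))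
    · exact List.mem_cons_self
    · exact List.mem_cons_of_mem _ List.mem_cons_self
  · refine congrArg₂ List.cons (rowOf_eq rfl rfl rfl (moves_eps (fun _ => rfl) _)).symm
      (congrArg₂ List.cons (rowOf_eq rfl rfl rfl (moves_eps (fun _ => rfl) _)).symm ?_)
    refine Eq.trans ?_ List.map_flatMap.symm
    rw [← List.map_coe_finRange_eq_range, List.flatMap_map]
    refine List.flatMap_congr fun i _ => map_rows _ hr fun q => rowOf_eq rfl rfl rfl ?_
    have h := encAsg_nullify (k := k) V lo hi
    have hE : ∀ q a q', (PSST.upTo g T lo hi n).E (.inl (i, q)) a (.inl (i, q')) = T.E q a q' :=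
      fun _ _ _ => if_pos rfl
    cases h2 : T.fin2 q with
    | true =>
      simp only [rowOf, h2, cond_true]
      refine (moves_tag_new (T := T) (T' := PSST.upTo g T lo hi n) (f := fun q => .inl (i, q))
          (s := s) (c := [2, i.val]) (fun _ => rfl) (fun _ => rfl) (if_pos h2) (hE q)).trans ?_
      refine congrArg₂ (· ++ ·) ?_ rfl
      by_cases hi : i.val + 1 < n + 1
      · rw [dif_pos hi, leB, decide_eq_true (show i.val + 2 ≤ n + 1 from hi), cond_true]
        refine (map_order _ _ _ _).trans ?_
        refine congrArg (fun A => orderTab g (0, [2, i.val + 1] ++ s T.start, A)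
          (0, [1], keepTab V)) ?_
        refine (congrArg (encAsg V) (if_neg fun hh => ?_)).trans h
        have := congrArg Fin.val hh
        simp at this
      · rw [dif_neg hi, leB, decide_eq_false (show ¬ i.val + 2 ≤ n + 1 from hi), cond_false]
        rfl
    | false =>
      simp only [rowOf, h2, cond_false]
      by_cases h3 : i = 0 ∧ q = T.start
      · obtain ⟨rfl, rfl⟩ := h3
        have hτ : (PSST.upTo g T lo hi n).τ (.inl (0, T.start)) = _ :=
          (if_neg (by simp [h2])).trans (if_pos ⟨rfl, rfl⟩)
        rw [Fin.val_zero, eqB_self, eqB_self, Bool.and_true, cond_true]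
        cases g with
        | true =>
          exact moves_tag_concat (T := T) (T' := PSST.upTo true T lo hi n)
            (f := fun q => .inl ((0 : Fin (n + 1)), q)) (fun _ => rfl) (fun _ => rfl)
            (hτ.trans (if_pos rfl)) (hE _)
        | false =>
          exact moves_tag_cons (T := T) (T' := PSST.upTo false T lo hi n)
            (f := fun q => .inl ((0 : Fin (n + 1)), q)) (fun _ => rfl) (fun _ => rfl)
            (hτ.trans (if_neg (by simp))) (hE _)
      -- Names are injective, so comparing names decides whether `q` is the initial state.
      · have h4 : (eqB i.val 0 && eqB (s q) (s T.start)) = false := by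
          rw [← Bool.not_eq_true, Bool.and_eq_true, eqB_iff, eqB_iff]
          exact fun hh => h3 ⟨Fin.val_injective hh.1, hi' hh.2⟩
        rw [h4, cond_false]
        exact moves_tag (T := T) (T' := PSST.upTo g T lo hi n) (f := fun q => .inl (i, q))
            (fun _ => rfl) (fun _ => rfl) ((if_neg (by simp [h2])).trans (if_neg h3)) (hE q)

end Rep

end StrSL

namespace StrSL

open PR
variable {k : ℕ}

lemma getD_map_range {α : Type*} {V x : ℕ} (hx : x < V) (f : ℕ → α) (d : α) :
    ((List.range V).map f).getD x d = f x := by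
  simp [List.getD_eq_getElem?_getD, hx]

namespace Rep

variable {V : ℕ}

lemma rep {t : Tab} {T : PSST k} (g : Bool) (lo hi m d : ℕ) (h : Rep V t T) :
    Rep V (repTab V g lo hi m d t) (PSST.repCore g T lo hi m d) := by
  rcases m with _ | m <;> rcases d with _ | d
  · exact Rep.eps
  · exact h.upTo g lo hi d
  · exact h.pow lo hi m
  · exact (h.pow lo hi m).concat lo hi (h.upTo g lo hi d)

lemma track {t : Tab} {T : PSST k} (n : ℕ) (h : Rep V t T) :
    Rep V (trackTab V n t) (T.track n) := by
  obtain ⟨s, hi, hs, qs, hq, hr⟩ := h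
  rw [trackTab, hs]
  refine ⟨s, hi, rfl, qs, hq, ?_⟩
  have hF := map_rows (V := V) (T := T) (T' := T.track n) (s := s) (s' := s) (fun q => q)
    (F := fun r => (r.1, r.2.1, r.2.2.1, r.2.2.2.map fun m => (m.1, m.2.1,
      (List.range V).map fun x => bif eqB x n then bif eqB r.1 (s T.start) then []
        else (0, n) :: bif eqB m.1 0 then [] else [(1, m.1)]
      else m.2.2.getD x []))) hr fun q => rowOf_eq rfl rfl rfl ?_
  · exact hF.trans (congrArg _ (List.map_id qs))
  · refine Eq.trans ?_ List.map_map.symm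
    refine List.map_congr_left fun m _ => ?_
    refine congrArg (fun A => (lab m.1, s m.2, A)) (List.map_congr_left fun x hx => ?_)
    refine Eq.trans ?_ (congrArg (fun l => bif eqB x n then bif eqB (s q) (s T.start) then []
        else (0, n) :: bif eqB (lab m.1) 0 then [] else [(1, lab m.1)]
      else l) (getD_map_range (List.mem_range.1 hx) (fun x => (T.E q m.1 m.2 x).map tok) []).symm)
    by_cases hxn : x = n
    · rw [hxn, eqB_self, cond_true]
      refine (congrArg (List.map tok) (if_pos rfl)).trans ?_
      by_cases hqs : q = T.start
      · rw [if_pos hqs, hqs, eqB_self]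
        rfl
      · rw [if_neg hqs, eqB, decide_eq_false fun h => hqs (hi h), cond_false]
        obtain ⟨_ | a, q'⟩ := m <;> rfl
    · rw [eqB, decide_eq_false hxn, cond_false]
      exact congrArg (List.map tok) (if_neg hxn)

/-- The entry of `n + 1` is looked up in the table, so this variable must lie below `V`. -/
lemma copyVar {t : Tab} {T : PSST k} {n : ℕ} (hn : n + 1 < V) (h : Rep V t T) :
    Rep V (copyTab V n t) (T.copyVar n) := by
  obtain ⟨s, hi, hs, qs, hq, hr⟩ := h
  rw [copyTab, hs]
  refine ⟨s, hi, rfl, qs, hq, ?_⟩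
  have hF := map_rows (V := V) (T := T) (T' := T.copyVar n) (s := s) (s' := s) (fun q => q)
    (F := fun r => (r.1, r.2.1, r.2.2.1, r.2.2.2.map fun m => (m.1, m.2.1,
      (List.range V).map fun x => bif eqB x n then m.2.2.getD (n + 1) [] else m.2.2.getD x [])))
    hr fun q => rowOf_eq rfl rfl rfl ?_
  · exact hF.trans (congrArg _ (List.map_id qs))
  · refine Eq.trans ?_ List.map_map.symm
    refine List.map_congr_left fun m _ => ?_
    refine congrArg (fun A => (lab m.1, s m.2, A)) (List.map_congr_left fun x hx => ?_)
    refine Eq.trans ?_ (congrArg₂ (fun l l' => bif eqB x n then l' else l)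
      (getD_map_range (List.mem_range.1 hx) (fun x => (T.E q m.1 m.2 x).map tok) []).symm
      (getD_map_range hn (fun x => (T.E q m.1 m.2 x).map tok) []).symm)
    by_cases hxn : x = n
    · rw [hxn, eqB_self, cond_true]
      exact congrArg (List.map tok) (if_pos rfl)
    · rw [eqB, decide_eq_false hxn, cond_false]
      exact congrArg (List.map tok) (if_neg hxn)

end Rep

/-- The rules for computing the size and the table of the transducer of an expression. -/
def tabStep (V : ℕ) (s : List ℕ × ℕ) (b : List (ℕ × Tab)) : ℕ × Tab :=
  bif eqB (s.1.getD 0 0) 0 then (1, trackTab V s.2 emptyTab)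
  else bif eqB (s.1.getD 0 0) 1 then (1, trackTab V s.2 (epsTab V))
  else bif eqB (s.1.getD 0 0) 2 then (1, trackTab V s.2 (letterTab V (s.1.getD 1 0)))
  else bif eqB (s.1.getD 0 0) 3 then
    ((b.getD 0 (0, [], [])).1 + 1, copyTab V s.2 (b.getD 0 (0, [], [])).2)
  else bif eqB (s.1.getD 0 0) 4 then
    ((b.getD 0 (0, [], [])).1 + (b.getD 1 (0, [], [])).1 + 1,
      trackTab V s.2 (altTab V (b.getD 0 (0, [], [])).2 (b.getD 1 (0, [], [])).2))
  else bif eqB (s.1.getD 0 0) 5 then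
    ((b.getD 0 (0, [], [])).1 + (b.getD 1 (0, [], [])).1 + 1,
      trackTab V s.2 (initTab V (concatTab V (s.2 + 1 + (b.getD 0 (0, [], [])).1)
        (s.2 + 1 + (b.getD 0 (0, [], [])).1 + (b.getD 1 (0, [], [])).1)
        (b.getD 0 (0, [], [])).2 (b.getD 1 (0, [], [])).2)))
  else ((b.getD 0 (0, [], [])).1 + 1, trackTab V s.2
    (bif eqB (s.1.getD 0 0) 6 then optTab V (eqB (s.1.getD 1 0) 1) (b.getD 0 (0, [], [])).2
    else bif eqB (s.1.getD 0 0) 7 then starTab V (eqB (s.1.getD 1 0) 1) (s.2 + 1)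
      (s.2 + 1 + (b.getD 0 (0, [], [])).1) (b.getD 0 (0, [], [])).2
    else bif eqB (s.1.getD 0 0) 8 then initTab V (concatTab V (s.2 + 1)
      (s.2 + 1 + (b.getD 0 (0, [], [])).1) (b.getD 0 (0, [], [])).2
      (starTab V (eqB (s.1.getD 1 0) 1) (s.2 + 1)
        (s.2 + 1 + (b.getD 0 (0, [], [])).1) (b.getD 0 (0, [], [])).2))
    else initTab V (repTab V (eqB (s.1.getD 1 0) 1) (s.2 + 1)
      (s.2 + 1 + (b.getD 0 (0, [], [])).1) (s.1.getD 2 0) (s.1.getD 3 0 - s.1.getD 2 0)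
      (b.getD 0 (0, [], [])).2)))

/-- The table of the transducer of the expression with the code `c`. -/
def tabOf (c : List (List ℕ)) : Tab := (foldCode (0, [], []) (tabStep c.length) c).2

lemma eqB_toNat (g : Bool) : eqB g.toNat 1 = g := by cases g <;> rfl

/-- The sizes are computed along with the tables because they determine the intervals of variables.
The number `V` is fixed in advance for the whole expression, and `n + e.size ≤ V` ensures that no
variable of `e` is missing in the tables. -/
lemma foldRules_tabStep (V : ℕ) : FoldRules (k := k) (tabStep V)
    (fun e n b => b.1 = e.size ∧ (n + e.size ≤ V → Rep V b.2 (e.toPSST n))) where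
  empty n := ⟨rfl, fun _ => Rep.empty.track n⟩
  eps n := ⟨rfl, fun _ => Rep.eps.track n⟩
  letter a n := ⟨rfl, fun _ => (Rep.letter a).track n⟩
  group e n b h := by
    refine ⟨congrArg (· + 1) h.1, fun hV => ?_⟩
    rw [Regex.size] at hV
    have := e.size_pos
    exact (h.2 (by omega)).copyVar (by omega)
  alt e₁ e₂ n b₁ b₂ h₁ h₂ := by
    obtain ⟨_, t₁⟩ := b₁
    obtain ⟨_, t₂⟩ := b₂
    obtain ⟨rfl, h₁⟩ := h₁
    obtain ⟨rfl, h₂⟩ := h₂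
    refine ⟨rfl, fun hV => ?_⟩
    rw [Regex.size] at hV
    exact ((h₁ (by omega)).alt (h₂ (by omega))).track n
  seq e₁ e₂ n b₁ b₂ h₁ h₂ := by
    obtain ⟨_, t₁⟩ := b₁
    obtain ⟨_, t₂⟩ := b₂
    obtain ⟨rfl, h₁⟩ := h₁
    obtain ⟨rfl, h₂⟩ := h₂
    refine ⟨rfl, fun hV => ?_⟩
    rw [Regex.size] at hV
    exact ((h₁ (by omega)).concat _ _ (h₂ (by omega))).init.track n
  opt g e n b h := by
    obtain ⟨_, t⟩ := b
    obtain ⟨rfl, h⟩ := h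
    refine ⟨rfl, fun hV => ?_⟩
    rw [Regex.size] at hV
    have := ((h (by omega)).opt (eqB g.toNat 1)).track n
    rw [eqB_toNat] at this
    simp only [tabStep, List.getD_cons_zero, List.getD_cons_succ, eqB_toNat]
    exact this
  star g e n b h := by
    obtain ⟨_, t⟩ := b
    obtain ⟨rfl, h⟩ := h
    refine ⟨rfl, fun hV => ?_⟩
    rw [Regex.size] at hV
    have := ((h (by omega)).star (eqB g.toNat 1) (n + 1) (n + 1 + e.size)).track n
    rw [eqB_toNat] at this
    simp only [tabStep, List.getD_cons_zero, List.getD_cons_succ, eqB_toNat]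
    exact this
  plus g e n b h := by
    obtain ⟨_, t⟩ := b
    obtain ⟨rfl, h⟩ := h
    refine ⟨rfl, fun hV => ?_⟩
    rw [Regex.size] at hV
    have := ((h (by omega)).concat (n + 1) (n + 1 + e.size)
      ((h (by omega)).star (eqB g.toNat 1) (n + 1) (n + 1 + e.size))).init.track n
    rw [eqB_toNat] at this
    simp only [tabStep, List.getD_cons_zero, List.getD_cons_succ, eqB_toNat]
    exact this
  rep g m d e n b h := by
    obtain ⟨_, t⟩ := b
    obtain ⟨rfl, h⟩ := h
    refine ⟨rfl, fun hV => ?_⟩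
    rw [Regex.size] at hV
    have := ((h (by omega)).rep (eqB g.toNat 1) (n + 1) (n + 1 + e.size) m (m + d - m)).init.track n
    rw [eqB_toNat, Nat.add_sub_cancel_left] at this
    have h' : m + d - m = d := by omega
    simp only [tabStep, List.getD_cons_zero, List.getD_cons_succ, eqB_toNat, h']
    exact this

lemma rep_tabOf (e : Regex k) : Rep e.code.length (tabOf e.code) (e.toPSST 0) :=
  ((foldRules_tabStep e.code.length).foldCode (0, [], []) e).2
    (by rw [Nat.zero_add, Regex.length_code])

section
variable {α : Type*} [Primcodable α]

@[fun_prop]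
lemma keepTab_pr {f : α → ℕ} (hf : Primrec f) : Primrec (fun x => keepTab (f x)) := by
  unfold keepTab; fun_prop

@[fun_prop]
lemma nullTab_pr {f g h : α → ℕ} (hf : Primrec f) (hg : Primrec g) (hh : Primrec h) :
    Primrec (fun x => nullTab (f x) (g x) (h x)) := by unfold nullTab; fun_prop

@[fun_prop]
lemma tagMoves_pr {f : α → List ℕ} {g : α → List MoveTab} (hf : Primrec f) (hg : Primrec g) :
    Primrec (fun x => tagMoves (f x) (g x)) := by unfold tagMoves tagMove; fun_prop

@[fun_prop]
lemma lettersTab_pr {f : α → List MoveTab} (hf : Primrec f) :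
    Primrec (fun x => lettersTab (f x)) := by unfold lettersTab; fun_prop

@[fun_prop]
lemma orderTab_pr {f : α → Bool} {g h : α → MoveTab} (hf : Primrec f) (hg : Primrec g)
    (hh : Primrec h) : Primrec (fun x => orderTab (f x) (g x) (h x)) := by
  unfold orderTab; fun_prop

@[fun_prop]
lemma epsTab_pr {f : α → ℕ} (hf : Primrec f) : Primrec (fun x => epsTab (f x)) := by
  unfold epsTab; fun_prop

@[fun_prop]
lemma letterTab_pr {f g : α → ℕ} (hf : Primrec f) (hg : Primrec g) :
    Primrec (fun x => letterTab (f x) (g x)) := by unfold letterTab; fun_prop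

@[fun_prop]
lemma altTab_pr {f : α → ℕ} {g h : α → Tab} (hf : Primrec f) (hg : Primrec g)
    (hh : Primrec h) : Primrec (fun x => altTab (f x) (g x) (h x)) := by
  unfold altTab; fun_prop

@[fun_prop]
lemma concatTab_pr {f lo hi : α → ℕ} {g h : α → Tab} (hf : Primrec f) (hlo : Primrec lo)
    (hhi : Primrec hi) (hg : Primrec g) (hh : Primrec h) :
    Primrec (fun x => concatTab (f x) (lo x) (hi x) (g x) (h x)) := by
  unfold concatTab; fun_prop

@[fun_prop]
lemma initTab_pr {f : α → ℕ} {g : α → Tab} (hf : Primrec f) (hg : Primrec g) :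
    Primrec (fun x => initTab (f x) (g x)) := by unfold initTab; fun_prop

@[fun_prop]
lemma optTab_pr {f : α → ℕ} {b : α → Bool} {g : α → Tab} (hf : Primrec f) (hb : Primrec b)
    (hg : Primrec g) : Primrec (fun x => optTab (f x) (b x) (g x)) := by unfold optTab; fun_prop

@[fun_prop]
lemma starTab_pr {f lo hi : α → ℕ} {b : α → Bool} {g : α → Tab} (hf : Primrec f)
    (hb : Primrec b) (hlo : Primrec lo) (hhi : Primrec hi) (hg : Primrec g) :
    Primrec (fun x => starTab (f x) (b x) (lo x) (hi x) (g x)) := by unfold starTab; fun_prop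

@[fun_prop]
lemma powTab_pr {f lo hi n : α → ℕ} {g : α → Tab} (hf : Primrec f) (hlo : Primrec lo)
    (hhi : Primrec hi) (hg : Primrec g) (hn : Primrec n) :
    Primrec (fun x => powTab (f x) (lo x) (hi x) (g x) (n x)) := by unfold powTab; fun_prop

@[fun_prop]
lemma upToTab_pr {f lo hi n : α → ℕ} {b : α → Bool} {g : α → Tab} (hf : Primrec f)
    (hb : Primrec b) (hlo : Primrec lo) (hhi : Primrec hi) (hn : Primrec n) (hg : Primrec g) :
    Primrec (fun x => upToTab (f x) (b x) (lo x) (hi x) (n x) (g x)) := by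
  unfold upToTab; fun_prop

@[fun_prop]
lemma repTab_pr {f lo hi m d : α → ℕ} {b : α → Bool} {g : α → Tab} (hf : Primrec f)
    (hb : Primrec b) (hlo : Primrec lo) (hhi : Primrec hi) (hm : Primrec m) (hd : Primrec d)
    (hg : Primrec g) :
    Primrec (fun x => repTab (f x) (b x) (lo x) (hi x) (m x) (d x) (g x)) := by
  unfold repTab; fun_prop

@[fun_prop]
lemma trackTab_pr {f n : α → ℕ} {g : α → Tab} (hf : Primrec f) (hn : Primrec n)
    (hg : Primrec g) : Primrec (fun x => trackTab (f x) (n x) (g x)) := by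
  unfold trackTab; fun_prop

@[fun_prop]
lemma copyTab_pr {f n : α → ℕ} {g : α → Tab} (hf : Primrec f) (hn : Primrec n)
    (hg : Primrec g) : Primrec (fun x => copyTab (f x) (n x) (g x)) := by
  unfold copyTab; fun_prop

@[fun_prop]
lemma tabStep_pr {f : α → ℕ} {g : α → List ℕ × ℕ} {h : α → List (ℕ × Tab)} (hf : Primrec f)
    (hg : Primrec g) (hh : Primrec h) : Primrec (fun x => tabStep (f x) (g x) (h x)) := by
  unfold tabStep; fun_prop

@[fun_prop]
lemma tabOf_pr {f : α → List (List ℕ)} (hf : Primrec f) : Primrec (fun x => tabOf (f x)) := by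
  unfold tabOf; fun_prop

end

end StrSL

namespace StrSL

open PR
variable {k : ℕ}

/-! ### Running transducers -/

def rowAt (t : Tab) (s : List ℕ) : RowTab :=
  (t.2.filter fun r => eqB r.1 s).getD 0 ([], false, false, [])

def applyTab (A : AsgTab) (vals : List (List ℕ)) : List (List ℕ) :=
  A.map fun l => l.flatMap fun c => bif eqB c.1 0 then vals.getD c.2 [] else [c.2]

/-- A node of the search for runs: whether a letter has been read or the run is finished, the
state, the `ε`-transitions taken since the last letter, and the values of the variables. -/
abbrev Node : Type := Bool × List ℕ × List (List ℕ × List ℕ) × List (List ℕ)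

def expand (t : Tab) (a : ℕ) (nd : Node) : List Node :=
  bif nd.1 then [nd] else
    ((rowAt t nd.2.1).2.2.2.flatMap fun m =>
      bif eqB m.1 0 then
        bif nd.2.2.1.any (fun p => eqB p (nd.2.1, m.2.1)) then []
        else [(false, m.2.1, (nd.2.1, m.2.1) :: nd.2.2.1, applyTab m.2.2 nd.2.2.2)]
      else bif eqB m.1 a then [(true, m.2.1, [], applyTab m.2.2 nd.2.2.2)] else []) ++
    bif eqB a 0 && ((rowAt t nd.2.1).2.1 || (rowAt t nd.2.1).2.2.1) then
      [(true, nd.2.1, [], nd.2.2.2)] else []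

def leaves (t : Tab) (a : ℕ) (nd : Node) : List Node :=
  -- Without repetitions at most the square of the number of states many `ε`-transitions are
  -- possible; one more round reads the letter or stops.
  (fun l => l.flatMap fun nd => expand t a nd)^[t.2.length ^ 2 + 1] [nd]

def phase (t : Tab) (a : ℕ) (nds : List Node) : List Node :=
  nds.flatMap fun nd => leaves t a (false, nd.2.1, [], nd.2.2.2)

/-- The values of the variables below `V` after the accepting run on a word. -/
def runTab (V : ℕ) (t : Tab) (w : List ℕ) : Option (List (List ℕ)) :=
  (phase t 0 (w.foldl (fun nds a => phase t (a + 1) nds)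
    -- The value `[0]` is the encoded symbol `null`.
    [(false, t.1, [], (List.range V).map fun _ => [0])])).head?.map fun nd => nd.2.2.2

section
variable {α : Type*} [Primcodable α]

@[fun_prop]
lemma rowAt_pr {f : α → Tab} {g : α → List ℕ} (hf : Primrec f) (hg : Primrec g) :
    Primrec (fun x => rowAt (f x) (g x)) := by unfold rowAt; fun_prop

@[fun_prop]
lemma applyTab_pr {f : α → AsgTab} {g : α → List (List ℕ)} (hf : Primrec f) (hg : Primrec g) :
    Primrec (fun x => applyTab (f x) (g x)) := by unfold applyTab; fun_prop

@[fun_prop]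
lemma expand_pr {f : α → Tab} {g : α → ℕ} {h : α → Node} (hf : Primrec f) (hg : Primrec g)
    (hh : Primrec h) : Primrec (fun x => expand (f x) (g x) (h x)) := by unfold expand; fun_prop

@[fun_prop]
lemma leaves_pr {f : α → Tab} {g : α → ℕ} {h : α → Node} (hf : Primrec f) (hg : Primrec g)
    (hh : Primrec h) : Primrec (fun x => leaves (f x) (g x) (h x)) := by unfold leaves; fun_prop

@[fun_prop]
lemma phase_pr {f : α → Tab} {g : α → ℕ} {h : α → List Node} (hf : Primrec f) (hg : Primrec g)
    (hh : Primrec h) : Primrec (fun x => phase (f x) (g x) (h x)) := by unfold phase; fun_prop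

@[fun_prop]
lemma runTab_pr {f : α → ℕ} {g : α → Tab} {h : α → List ℕ} (hf : Primrec f) (hg : Primrec g)
    (hh : Primrec h) : Primrec (fun x => runTab (f x) (g x) (h x)) := by unfold runTab; fun_prop

end

def encVals (V : ℕ) (η : ℕ → Val k) : List (List ℕ) := (List.range V).map fun x => (η x).map lab

/-- Only the values of the variables below `V` are stored; by `Within` an assignment of such a
variable refers to no others, so the default value of the lookup is never used. -/
lemma applyTab_enc {V : ℕ} {A : Asg k} (hA : A.Within 0 V) (η : ℕ → Val k) :
    applyTab (encAsg V A) (encVals V η) = encVals V (A.upd η) := by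
  rw [applyTab, encAsg, List.map_map]
  refine List.map_congr_left fun x hx => ?_
  rw [Function.comp_apply, List.flatMap_map, Asg.upd, List.map_flatMap]
  refine List.flatMap_congr fun c hc => ?_
  rcases c with y | c
  · have hy := ((hA x).2 ⟨Nat.zero_le _, List.mem_range.1 hx⟩ y hc).2
    simp only [tok, Sum.elim_inl, eqB_self, cond_true]
    exact getD_map_range hy _ _
  · rfl

lemma lab_inj {a b : Option (Fin k)} : lab a = lab b ↔ a = b := by
  cases a <;> cases b <;> simp [lab, Fin.ext_iff]

lemma eqB_eq {α β : Type*} [DecidableEq α] [DecidableEq β] {a b : α} {c d : β}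
    (h : a = b ↔ c = d) : eqB a b = decide (c = d) := by
  rw [eqB]
  exact decide_eq_decide.2 h

lemma flatMap_iterate {α : Type*} (f : α → List α) (n : ℕ) (l : List α) :
    (fun l => l.flatMap f)^[n] l = l.flatMap fun x => (fun l => l.flatMap f)^[n] [x] := by
  induction n generalizing l with
  | zero => simp
  | succ n ih =>
    rw [Function.iterate_succ_apply, ih, List.flatMap_assoc]
    refine List.flatMap_congr fun x _ => ?_
    rw [Function.iterate_succ_apply, List.flatMap_singleton, ← ih]

section run

variable {V : ℕ} {t : Tab} {T : PSST k} {s : T.Q → List ℕ} {qs : List T.Q}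

lemma rowAt_eq (hs : Function.Injective s) (hq : ∀ q, q ∈ qs)
    (ht : t.2 = qs.map (rowOf V T s)) (q : T.Q) : rowAt t (s q) = rowOf V T s q := by
  have h1 : ∀ r ∈ t.2.filter (fun r => eqB r.1 (s q)), r = rowOf V T s q := by
    intro r hr
    rw [List.mem_filter, ht, List.mem_map] at hr
    obtain ⟨⟨p, -, rfl⟩, hr⟩ := hr
    rw [hs (eqB_iff.1 hr : s p = s q)]
  have h2 : rowOf V T s q ∈ t.2.filter (fun r => eqB r.1 (s q)) := by
    rw [List.mem_filter, ht]
    exact ⟨List.mem_map_of_mem (hq q), eqB_self _⟩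
  rw [rowAt]
  cases h : t.2.filter (fun r => eqB r.1 (s q)) with
  | nil => rw [h] at h2; simp at h2
  | cons r l => exact h1 r (h ▸ List.mem_cons_self)

/-- The encoding of a node. -/
def encNode (V : ℕ) (s : T.Q → List ℕ) (b : Bool) (q : T.Q) (used : List (T.Q × T.Q))
    (η : ℕ → Val k) : Node := (b, s q, used.map fun p => (s p.1, s p.2), encVals V η)

lemma expand_eq (hs : Function.Injective s) (hq : ∀ q, q ∈ qs)
    (ht : t.2 = qs.map (rowOf V T s)) (hT : T.Within 0 V) (a : Option (Fin k)) (q : T.Q)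
    (used : List (T.Q × T.Q)) (η : ℕ → Val k) :
    expand t (lab a) (encNode V s false q used η) = ((T.moves q).flatMap fun m =>
      if m.1 = none then if (q, m.2) ∈ used then []
        else [encNode V s false m.2 ((q, m.2) :: used) ((T.E q m.1 m.2).upd η)]
      else if m.1 = a then [encNode V s true m.2 [] ((T.E q m.1 m.2).upd η)] else []) ++
      if a = none ∧ T.fin q = true then [encNode V s true q [] η] else [] := by
  simp only [expand, encNode, cond_false, rowAt_eq hs hq ht]
  refine congrArg₂ (· ++ ·) ?_ ?_
  · rw [rowOf, List.flatMap_map]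
    refine List.flatMap_congr fun m _ => ?_
    simp only [encMove, applyTab_enc (hT q m.1 m.2)]
    have h1 : eqB (lab m.1) 0 = decide (m.1 = none) := eqB_eq (lab_inj (b := none))
    have h2 : eqB (lab m.1) (lab a) = decide (m.1 = a) := eqB_eq lab_inj
    have h3 : ((used.map fun p => (s p.1, s p.2)).any fun p => eqB p (s q, s m.2)) =
        decide ((q, m.2) ∈ used) := by
      rw [Bool.eq_iff_iff, List.any_eq_true, decide_eq_true_iff]
      constructor
      · rintro ⟨p, hp, he⟩
        obtain ⟨p, hp', rfl⟩ := List.mem_map.1 hp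
        have he := Prod.mk.inj (eqB_iff.1 he)
        rwa [← hs he.1, ← hs he.2]
      · exact fun h => ⟨_, List.mem_map_of_mem h, eqB_self _⟩
    rw [h1, h2, h3, Bool.cond_decide, Bool.cond_decide, Bool.cond_decide]
    rfl
  · have h1 : eqB (lab a) 0 = decide (a = none) := eqB_eq (lab_inj (b := none))
    rw [h1, rowOf]
    by_cases h2 : a = none <;> cases h3 : T.fin q <;> simp only [PSST.fin] at h3 <;>
      simp [h2, h3]

/-- Each round replaces every unfinished node, in its place, by its successors in the order of
priority, and keeps finished nodes. The search thus proceeds in breadth but lists the results in the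
order of `eps`, and it is complete when the number of rounds exceeds the measure of `eps`. -/
lemma leaves_eq (hs : Function.Injective s) (hq : ∀ q, q ∈ qs)
    (ht : t.2 = qs.map (rowOf V T s)) (hT : T.Within 0 V) (a : Option (Fin k)) (q : T.Q)
    (used : List (T.Q × T.Q)) : ∀ (η : ℕ → Val k) (n : ℕ), T.unused used < n →
    (fun l => l.flatMap fun nd => expand t (lab a) nd)^[n] [encNode V s false q used η] =
      (T.eps a q used).map fun f => encNode V s true (T.last q f) [] (T.eval η q f) := by
  have hdone : ∀ n q η, (fun l => l.flatMap fun nd => expand t (lab a) nd)^[n]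
      [encNode V s true q [] η] = [encNode V s true q [] η] := by
    intro n q η
    induction n with
    | zero => rfl
    | succ n ih => rw [Function.iterate_succ_apply, List.flatMap_singleton]; exact ih
  refine PSST.eps_induction (P := fun q used => ∀ (η : ℕ → Val k) (n : ℕ), T.unused used < n →
    (fun l => l.flatMap fun nd => expand t (lab a) nd)^[n] [encNode V s false q used η] =
      (T.eps a q used).map fun f => encNode V s true (T.last q f) [] (T.eval η q f)) ?_ q used
  intro q used ih η n hn
  obtain ⟨n, rfl⟩ := Nat.exists_eq_succ_of_ne_zero (by omega : n ≠ 0)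
  rw [Function.iterate_succ_apply, List.flatMap_singleton, flatMap_iterate,
    expand_eq hs hq ht hT, PSST.eps, List.flatMap_append, List.map_append, List.flatMap_assoc,
    List.map_flatMap]
  refine congrArg₂ (· ++ ·) (List.flatMap_congr fun m _ => ?_) ?_
  · split_ifs with h1 h2 h3
    · rfl
    · rw [List.flatMap_singleton, ih m.2 h2 _ n (by have := T.unused_cons_lt h2; omega),
        List.map_map]
      rfl
    · rw [List.flatMap_singleton, hdone]
      rfl
    · rfl
  · split_ifs
    · rw [List.flatMap_singleton, hdone]
      rfl
    · rfl

lemma phase_eq (hs : Function.Injective s) (hq : ∀ q, q ∈ qs)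
    (ht : t.2 = qs.map (rowOf V T s)) (hT : T.Within 0 V) (a : Option (Fin k)) (b : Bool) (q : T.Q)
    (used : List (T.Q × T.Q)) (η : ℕ → Val k) : phase t (lab a) [encNode V s b q used η] =
      (T.eps a q []).map fun f => encNode V s true (T.last q f) [] (T.eval η q f) := by
  rw [phase, List.flatMap_singleton]
  refine leaves_eq hs hq ht hT a q [] η _ ?_
  have h1 := T.unused_le []
  have h2 := Rep.card_le (V := V) (t := (s T.start, t.2)) (T := T) ⟨s, hs, rfl, qs, hq, ht⟩
  have h3 := Nat.pow_le_pow_left h2 2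
  simp only at h3
  omega

lemma phase_flatMap (a : ℕ) (nds : List Node) :
    phase t a nds = nds.flatMap fun nd => phase t a [nd] := by
  simp only [phase, List.flatMap_singleton]

lemma foldl_phase_flatMap (w : List ℕ) (nds : List Node) :
    phase t 0 (w.foldl (fun nds a => phase t (a + 1) nds) nds) = nds.flatMap fun nd =>
      phase t 0 (w.foldl (fun nds a => phase t (a + 1) nds) [nd]) := by
  induction w generalizing nds with
  | nil => exact phase_flatMap 0 nds
  | cons a w ih =>
    rw [List.foldl_cons, ih, phase_flatMap (a + 1), List.flatMap_assoc]
    exact List.flatMap_congr fun nd _ => (ih _).symm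

/-- All candidates are advanced letter by letter, without discarding those that cannot be completed.
By `foldl_phase_flatMap` the nodes can be treated separately, which gives the recursion of `accs`.
-/
lemma foldl_phase_eq (hs : Function.Injective s) (hq : ∀ q, q ∈ qs)
    (ht : t.2 = qs.map (rowOf V T s)) (hT : T.Within 0 V) (w : List (Fin k)) (b : Bool) (q : T.Q)
    (used : List (T.Q × T.Q)) (η : ℕ → Val k) :
    phase t 0 ((enc w).foldl (fun nds a => phase t (a + 1) nds) [encNode V s b q used η]) =
      (T.accs q w).map fun r => encNode V s true (T.last q r) [] (T.eval η q r) := by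
  induction w generalizing b q used η with
  | nil => exact phase_eq hs hq ht hT none b q used η
  | cons a w ih =>
    have h := phase_eq hs hq ht hT (some a) b q used η
    change phase t (a.val + 1) _ = _ at h
    rw [enc, List.map_cons, List.foldl_cons, h, foldl_phase_flatMap, List.flatMap_map,
      PSST.accs, List.map_flatMap]
    refine List.flatMap_congr fun f _ => ?_
    rw [List.map_map]
    refine (ih true (T.last q f) [] _).trans (List.map_congr_left fun r _ => ?_)
    rw [Function.comp_apply, PSST.last_append, PSST.eval_append]

end run

/-- The values of the variables of an expression after the accepting run. -/
def runCode (c : List (List ℕ)) (w : List ℕ) : Option (List (List ℕ)) :=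
  runTab c.length (tabOf c) w

@[fun_prop]
lemma runCode_pr {α : Type*} [Primcodable α] {f : α → List (List ℕ)} {g : α → List ℕ}
    (hf : Primrec f) (hg : Primrec g) : Primrec (fun x => runCode (f x) (g x)) := by
  unfold runCode; fun_prop

lemma runCode_eq (e : Regex k) (w : List (Fin k)) :
    runCode e.code (enc w) = (e.finalRun w).map fun r =>
      encVals e.code.length ((e.toPSST 0).eval (fun _ => [none]) (e.toPSST 0).start r) := by
  obtain ⟨s, hs, h1, qs, hq, ht⟩ := rep_tabOf e
  have hT := e.within_size
  rw [← Regex.length_code] at hT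
  have h := foldl_phase_eq hs hq ht hT w false (e.toPSST 0).start [] fun _ => [none]
  rw [runCode, runTab, h1, Regex.finalRun]
  refine (congrArg (fun l : List Node => l.head?.map fun nd => nd.2.2.2) h).trans ?_
  rw [List.head?_map, Option.map_map]
  rfl

end StrSL

namespace StrSL

open PR
variable {k : ℕ}

/-! ### String functions on codes -/

def groupsCode (c : List (List ℕ)) : List ℕ :=
  ((c.zipIdx 0).filter fun s => eqB s.1 [3]).map fun s => s.2

/-- Groups are the only expressions that begin with the symbol `[3]`, and the position of a symbol
is its preorder number. -/
lemma groups_zipIdx (e : Regex k) (n : ℕ) :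
    ((e.code.zipIdx n).filter fun s => eqB s.1 [3]).map (fun s => s.2) = e.groups n := by
  induction e generalizing n <;>
    simp_all [Regex.code, Regex.groups, List.zipIdx_append, Regex.length_code, eqB]

lemma groupsCode_eq (e : Regex k) : groupsCode e.code = e.groups 0 := groups_zipIdx e 0

def wordCode (v : List ℕ) : Option (List ℕ) :=
  bif v.any (fun a => eqB a 0) then none else some (v.map fun a => a - 1)

lemma wordCode_eq (v : Val k) : wordCode (v.map lab) = v.toWord.map enc := by
  induction v with
  | nil => rfl
  | cons a v ih =>
    rcases a with _ | a
    · rfl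
    · rw [Val.toWord, Option.map_map]
      have h : ∀ o : Option (List (Fin k)), o.map (enc ∘ fun w => a :: w) =
          (o.map enc).map fun w => a.val :: w := fun o => by cases o <;> rfl
      rw [h, ← ih]
      simp only [wordCode, List.map_cons, List.any_cons]
      cases h : (v.map lab).any fun a => eqB a 0 <;> simp [lab, eqB]

def captCode (c : List (List ℕ)) (vals : List (List ℕ)) (i : ℕ) : Option (List ℕ) :=
  (groupsCode c)[i]?.bind fun x => wordCode (vals.getD x [])

lemma captCode_eq (e : Regex k) (r : List (Option (Fin k) × (e.toPSST 0).Q)) (i : ℕ) :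
    captCode e.code (encVals e.code.length ((e.toPSST 0).eval (fun _ => [none])
      (e.toPSST 0).start r)) i = (e.capt r i).map enc := by
  rw [captCode, Regex.capt, groupsCode_eq]
  cases h : (e.groups 0)[i]? with
  | none => rfl
  | some x =>
    have hx := Regex.lt_of_mem_groups (List.mem_of_getElem? h)
    rw [Nat.zero_add, ← Regex.length_code] at hx
    rw [Option.bind_some, Option.bind_some, ← wordCode_eq, encVals, getD_map_range hx]

def extCode (i : ℕ) (c : List (List ℕ)) (w : List ℕ) : Option (List ℕ) :=
  (runCode c w).bind fun vals => bif eqB i 0 then some w else captCode c vals (i - 1)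

lemma extCode_eq (i : ℕ) (e : Regex k) (w : List (Fin k)) :
    extCode i e.code (enc w) = (e.ext i w).map enc := by
  rw [extCode, runCode_eq, Regex.ext]
  cases e.finalRun w with
  | none => rfl
  | some r =>
    rw [Option.map_some, Option.bind_some, Option.bind_some, captCode_eq, eqB, Bool.cond_decide]
    split_ifs <;> rfl

def anyCode (k : ℕ) : List (List ℕ) :=
  bif eqB k 0 then [[0]]
  else ((List.range (k - 1)).map fun _ => [4]) ++ (List.range k).map fun a => [2, a]

/-- In prefix notation, a sum that is nested to the left has all its operators in front. -/
lemma code_foldl_alt (l : List (Fin k)) (e : Regex k) :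
    (l.foldl (fun e b => Regex.alt e (.letter b)) e).code =
      List.replicate l.length [4] ++ (e.code ++ l.map fun a => [2, a.val]) := by
  induction l generalizing e with
  | nil => simp
  | cons a l ih =>
    rw [List.foldl_cons, ih, List.length_cons, List.replicate_succ']
    simp [Regex.code]

lemma anyCode_eq (k : ℕ) : anyCode k = (Regex.any k).code := by
  have h1 : (List.range k).map (fun a => [2, a]) = (List.finRange k).map fun a => [2, a.val] := by
    rw [← List.map_coe_finRange_eq_range, List.map_map]
    rfl
  have h2 := List.length_finRange (n := k)
  rw [anyCode, Regex.any, h1]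
  cases h : List.finRange k with
  | nil =>
    rw [h, List.length_nil] at h2
    subst h2
    rfl
  | cons a l =>
    rw [h, List.length_cons] at h2
    have h3 : eqB k 0 = false := by simp only [eqB, decide_eq_false_iff_not]; omega
    rw [h3, cond_false, show k - 1 = l.length by omega]
    simp only [code_foldl_alt]
    simp [Regex.code]

def searchCode (k : ℕ) (c : List (List ℕ)) : List (List ℕ) :=
  [5] :: [5] :: [3] :: [7, 0] :: (anyCode k ++ [3] :: (c ++ [7, 1] :: anyCode k))

lemma searchCode_eq (pat : Regex k) : searchCode k pat.code = pat.search.code := by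
  simp [searchCode, Regex.search, Regex.code, anyCode_eq]

/-- The text before the first match, the match, the text behind it, and the captures. -/
def firstCode (k : ℕ) (c : List (List ℕ)) (x : List ℕ) :
    Option (List ℕ × List ℕ × List ℕ × List (Option (List ℕ))) :=
  (runCode (searchCode k c) x).map fun vals =>
    ((captCode (searchCode k c) vals 0).getD [], (captCode (searchCode k c) vals 1).getD [],
      -- The text before the match and the match form a prefix of `x` by `Regex.splits_of_finalRun`;
      -- so the rest is found without observing where the run enters the last component.
      x.drop (((captCode (searchCode k c) vals 0).getD []).length +
        ((captCode (searchCode k c) vals 1).getD []).length),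
      (List.range (groupsCode (searchCode k c)).length).map fun i =>
        captCode (searchCode k c) vals (i + 1))

/-- `m` is the encoding of `m'`. -/
structure EncMatch (m : List ℕ × List ℕ × List ℕ × List (Option (List ℕ)))
    (m' : List (Fin k) × List (Fin k) × List (Fin k) × (ℕ → Option (List (Fin k)))) : Prop where
  pre : m.1 = enc m'.1
  mat : m.2.1 = enc m'.2.1
  post : m.2.2.1 = enc m'.2.2.1
  capt : ∀ i, m.2.2.2.getD i none = (m'.2.2.2 i).map enc

lemma firstCode_eq (pat : Regex k) (x : List (Fin k)) :
    (pat.firstMatch x = none ∧ firstCode k pat.code (enc x) = none) ∨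
      ∃ m m', pat.firstMatch x = some m' ∧ firstCode k pat.code (enc x) = some m ∧
        EncMatch m m' := by
  rw [firstCode, searchCode_eq, runCode_eq, Regex.firstMatch]
  cases h : pat.search.finalRun x with
  | none => exact Or.inl ⟨rfl, rfl⟩
  | some r =>
    refine Or.inr ⟨_, _, rfl, rfl, ?_⟩
    obtain ⟨pre, v, h1, h2, h3⟩ := Regex.splits_of_finalRun h
    constructor
    · simp only [captCode_eq, h1]
      rfl
    · simp only [captCode_eq, h2]
      rfl
    · simp only [captCode_eq, h1, h2, Option.map_some, Option.getD_some, length_enc]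
      conv_lhs => rw [h3]
      rw [enc_append, enc_append, List.drop_left' (by simp)]
    · intro i
      simp only [captCode_eq]
      by_cases hi : i < (groupsCode pat.search.code).length
      · exact getD_map_range hi _ _
      · rw [List.getD_eq_default _ _ (by simpa using hi), Regex.capt, ← groupsCode_eq,
          List.getElem?_eq_none (by omega)]
        rfl

def instCode (rep : List (List ℕ)) (capts : List (Option (List ℕ))) (pre post : List ℕ) :
    List ℕ :=
  rep.flatMap fun s => bif eqB (s.getD 0 0) 10 then [s.getD 1 0]
    else bif eqB (s.getD 0 0) 11 then (capts.getD (s.getD 1 0) none).getD []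
    else bif eqB (s.getD 0 0) 12 then pre else bif eqB (s.getD 0 0) 13 then post else []

lemma instCode_eq (rep : List (RepSym k)) {capts : List (Option (List ℕ))}
    {c : ℕ → Option (List (Fin k))} (hc : ∀ i, capts.getD i none = (c i).map enc)
    (pre post : List (Fin k)) :
    instCode (repCode rep) capts (enc pre) (enc post) = enc (instRep rep c pre post) := by
  rw [instCode, repCode, List.flatMap_append, List.flatMap_map]
  refine (List.append_nil _).trans ?_
  refine Eq.trans ?_ List.map_flatMap.symm
  refine List.flatMap_congr fun s _ => ?_
  cases s with
  | letter a => rfl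
  | ref i =>
    refine (congrArg (fun o => Option.getD o []) (hc i)).trans ?_
    rw [RepSym.value]
    cases c i <;> rfl
  | before => rfl
  | after => rfl

def replCode (k : ℕ) (c rep : List (List ℕ)) (x : List ℕ) : List ℕ :=
  (firstCode k c x).elim x fun m => m.1 ++ instCode rep m.2.2.2 m.1 m.2.2.1 ++ m.2.2.1

lemma replCode_eq (pat : Regex k) (rep : List (RepSym k)) (x : List (Fin k)) :
    replCode k pat.code (repCode rep) (enc x) = enc (pat.repl rep x) := by
  rw [replCode, Regex.repl]
  rcases firstCode_eq pat x with ⟨h1, h2⟩ | ⟨m, m', h1, h2, h⟩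
  · rw [h1, h2]
    rfl
  · rw [h1, h2, Option.elim_some, Option.elim_some, h.pre, h.post, instCode_eq rep h.capt]
    simp

/-- One step of replacing all matches. The state consists of a flag for the end, the part of the
input that has been read, the rest of the input, and the output. -/
def stepAll (k : ℕ) (c rep : List (List ℕ)) (st : Bool × List ℕ × List ℕ × List ℕ) :
    Bool × List ℕ × List ℕ × List ℕ :=
  bif st.1 then st else (firstCode k c st.2.2.1).elim (true, [], [], st.2.2.2 ++ st.2.2.1) fun m =>
    bif eqB m.2.1 [] then
      bif eqB m.2.2.1 [] then
        (true, [], [], st.2.2.2 ++ (m.1 ++ instCode rep m.2.2.2 (st.2.1 ++ m.1) m.2.2.1))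
      else (false, st.2.1 ++ m.1 ++ m.2.2.1.take 1, m.2.2.1.drop 1,
        st.2.2.2 ++ (m.1 ++ instCode rep m.2.2.2 (st.2.1 ++ m.1) m.2.2.1) ++ m.2.2.1.take 1)
    else (false, st.2.1 ++ m.1 ++ m.2.1, m.2.2.1,
      st.2.2.2 ++ (m.1 ++ instCode rep m.2.2.2 (st.2.1 ++ m.1) m.2.2.1))

def allCode (k : ℕ) (c rep : List (List ℕ)) (x : List ℕ) : List ℕ :=
  ((fun st => stepAll k c rep st)^[x.length + 1] (false, [], x, [])).2.2.2

@[simp]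
lemma enc_eq_nil {w : List (Fin k)} : enc w = [] ↔ w = [] := List.map_eq_nil_iff

/-- The output produced so far is an accumulator and must be arbitrary in the induction; once the
flag is set, further rounds change nothing. -/
lemma iterate_stepAll (pat : Regex k) (rep : List (RepSym k)) (n : ℕ) (u x : List (Fin k))
    (out : List ℕ) : ((fun st => stepAll k pat.code (repCode rep) st)^[n]
      (false, enc u, enc x, out)).2.2.2 = out ++ enc (pat.replIter rep n u x) := by
  have hdone : ∀ n out, ((fun st => stepAll k pat.code (repCode rep) st)^[n]
      (true, [], [], out)).2.2.2 = out := by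
    intro n out
    induction n with
    | zero => rfl
    | succ n ih => rw [Function.iterate_succ_apply]; exact ih
  induction n generalizing u x out with
  | zero => exact (List.append_nil _).symm
  | succ n ih =>
    have hdone := hdone n
    rw [Function.iterate_succ_apply, Regex.replIter]
    generalize (fun st => stepAll k pat.code (repCode rep) st)^[n] = F at ih hdone ⊢
    simp only [stepAll, cond_false]
    rcases firstCode_eq pat x with ⟨h1, h2⟩ | ⟨m, m', h1, h2, h⟩
    · rw [h1, h2, Option.elim_none, Option.elim_none, hdone]
    · rw [h1, h2, Option.elim_some, Option.elim_some, h.pre, h.post, h.mat, ← enc_append,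
        instCode_eq rep h.capt, ← enc_append, eqB_eq enc_eq_nil, eqB_eq enc_eq_nil,
        Bool.cond_decide, Bool.cond_decide]
      have ht : (enc m'.2.2.1).take 1 = enc (m'.2.2.1.take 1) := List.map_take.symm
      have hd : (enc m'.2.2.1).drop 1 = enc (m'.2.2.1.drop 1) := List.map_drop.symm
      by_cases hv : m'.2.1 = []
      · rw [if_pos hv, if_pos hv]
        by_cases hp : m'.2.2.1 = []
        · rw [if_pos hp, if_pos hp, hdone, List.append_nil]
        · rw [if_neg hp, if_neg hp, ht, hd, ← enc_append, ih]
          simp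
      · rw [if_neg hv, if_neg hv, ← enc_append, ih]
        simp

lemma allCode_eq (pat : Regex k) (rep : List (RepSym k)) (x : List (Fin k)) :
    allCode k pat.code (repCode rep) (enc x) = enc (pat.replFrom rep [] x) := by
  rw [allCode, length_enc, Regex.replFrom]
  exact iterate_stepAll pat rep _ [] x []

section
variable {α : Type*} [Primcodable α]

@[fun_prop]
lemma groupsCode_pr {f : α → List (List ℕ)} (hf : Primrec f) :
    Primrec (fun x => groupsCode (f x)) := by unfold groupsCode; fun_prop

@[fun_prop]
lemma wordCode_pr {f : α → List ℕ} (hf : Primrec f) : Primrec (fun x => wordCode (f x)) := by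
  unfold wordCode; fun_prop

@[fun_prop]
lemma captCode_pr {f g : α → List (List ℕ)} {h : α → ℕ} (hf : Primrec f) (hg : Primrec g)
    (hh : Primrec h) : Primrec (fun x => captCode (f x) (g x) (h x)) := by
  unfold captCode; fun_prop

@[fun_prop]
lemma extCode_pr {f : α → ℕ} {g : α → List (List ℕ)} {h : α → List ℕ} (hf : Primrec f)
    (hg : Primrec g) (hh : Primrec h) : Primrec (fun x => extCode (f x) (g x) (h x)) := by
  unfold extCode; fun_prop

@[fun_prop]
lemma searchCode_pr {f : α → ℕ} {g : α → List (List ℕ)} (hf : Primrec f) (hg : Primrec g) :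
    Primrec (fun x => searchCode (f x) (g x)) := by unfold searchCode anyCode; fun_prop

@[fun_prop]
lemma firstCode_pr {f : α → ℕ} {g : α → List (List ℕ)} {h : α → List ℕ} (hf : Primrec f)
    (hg : Primrec g) (hh : Primrec h) : Primrec (fun x => firstCode (f x) (g x) (h x)) := by
  unfold firstCode; fun_prop

@[fun_prop]
lemma instCode_pr {f : α → List (List ℕ)} {g : α → List (Option (List ℕ))} {h i : α → List ℕ}
    (hf : Primrec f) (hg : Primrec g) (hh : Primrec h) (hi : Primrec i) :
    Primrec (fun x => instCode (f x) (g x) (h x) (i x)) := by unfold instCode; fun_prop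

@[fun_prop]
lemma replCode_pr {f : α → ℕ} {g h : α → List (List ℕ)} {i : α → List ℕ} (hf : Primrec f)
    (hg : Primrec g) (hh : Primrec h) (hi : Primrec i) :
    Primrec (fun x => replCode (f x) (g x) (h x) (i x)) := by unfold replCode; fun_prop

@[fun_prop]
lemma stepAll_pr {f : α → ℕ} {g h : α → List (List ℕ)} {i : α → Bool × List ℕ × List ℕ × List ℕ}
    (hf : Primrec f) (hg : Primrec g) (hh : Primrec h) (hi : Primrec i) :
    Primrec (fun x => stepAll (f x) (g x) (h x) (i x)) := by unfold stepAll; fun_prop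

@[fun_prop]
lemma allCode_pr {f : α → ℕ} {g h : α → List (List ℕ)} {i : α → List ℕ} (hf : Primrec f)
    (hg : Primrec g) (hh : Primrec h) (hi : Primrec i) :
    Primrec (fun x => allCode (f x) (g x) (h x) (i x)) := by unfold allCode; fun_prop

end

end StrSL

namespace StrSL

open PR
variable {k : ℕ}

/-! ### Parsing -/

/-- An equation or a membership constraint: the symbol with which its code begins, and the codes
of the regular expressions and the replacement string that occur in it. -/
abbrev Atom : Type := List ℕ × List (List (List ℕ))

def eqnAtom : ℕ × Term k → Atom
  | (x, .var y) => ([15, x, y], [])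
  | (x, .concat y z) => ([16, x, y, z], [])
  | (x, .extract i e y) => ([17, x, i, y], [e.code])
  | (x, .replace pat rep y) => ([18, x, y], [repCode rep, pat.code])
  | (x, .replaceAll pat rep y) => ([19, x, y], [repCode rep, pat.code])

def memAtom (m : ℕ × Regex k) : Atom := ([20, m.1], [m.2.code])

def Formula.atoms : Formula k → List Atom
  | .eqn x t => [eqnAtom (x, t)]
  | .mem x e => [memAtom (x, e)]
  | .and φ ψ => φ.atoms ++ ψ.atoms
  | .or φ ψ => φ.atoms ++ ψ.atoms
  | .not φ => φ.atoms

/-- The kinds of the constituents of an object whose code begins with `s`, and its own kind. The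
kinds are `0` for regular expressions, `1` for replacement strings, and `2` for formulas without
negations and disjunctions. -/
def sig (k : ℕ) (s : List ℕ) : Option (List ℕ × ℕ) :=
  -- Comparing `s` with a list made of its own entries checks its length. The test `!leB k a` says
  -- `a < k`, so only letters of the alphabet are admitted.
  bif eqB s [0] || (eqB s [1] || eqB s [2, s.getD 1 0] && !leB k (s.getD 1 0)) then some ([], 0)
  else bif eqB s [3] || ((eqB s [6, s.getD 1 0] || (eqB s [7, s.getD 1 0] ||
    eqB s [8, s.getD 1 0])) && leB (s.getD 1 0) 1) then some ([0], 0)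
  else bif eqB s [9, s.getD 1 0, s.getD 2 0, s.getD 3 0] && (leB (s.getD 1 0) 1 &&
    leB (s.getD 2 0) (s.getD 3 0)) then some ([0], 0)
  else bif eqB s [4] || eqB s [5] then some ([0, 0], 0)
  else bif eqB s [14] then some ([], 1)
  else bif eqB s [10, s.getD 1 0] && !leB k (s.getD 1 0) then some ([1], 1)
  else bif eqB s [11, s.getD 1 0] || (eqB s [12] || eqB s [13]) then some ([1], 1)
  else bif eqB s [15, s.getD 1 0, s.getD 2 0] ||
    eqB s [16, s.getD 1 0, s.getD 2 0, s.getD 3 0] then some ([], 2)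
  else bif eqB s [17, s.getD 1 0, s.getD 2 0, s.getD 3 0] || eqB s [20, s.getD 1 0] then
    some ([0], 2)
  else bif eqB s [18, s.getD 1 0, s.getD 2 0] || eqB s [19, s.getD 1 0, s.getD 2 0] then
    some ([1, 0], 2)
  else bif eqB s [21] then some ([2, 2], 2) else none

/-- The relation computed by `sig`. -/
inductive Sig (k : ℕ) : List ℕ → List ℕ → ℕ → Prop
  | empty : Sig k [0] [] 0
  | eps : Sig k [1] [] 0
  | letter (a : Fin k) : Sig k [2, a.val] [] 0
  | group : Sig k [3] [0] 0
  | alt : Sig k [4] [0, 0] 0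
  | seq : Sig k [5] [0, 0] 0
  | opt (g : Bool) : Sig k [6, g.toNat] [0] 0
  | star (g : Bool) : Sig k [7, g.toNat] [0] 0
  | plus (g : Bool) : Sig k [8, g.toNat] [0] 0
  | rep (g : Bool) (m d : ℕ) : Sig k [9, g.toNat, m, m + d] [0] 0
  | repLetter (a : Fin k) : Sig k [10, a.val] [1] 1
  | ref (i : ℕ) : Sig k [11, i] [1] 1
  | before : Sig k [12] [1] 1
  | after : Sig k [13] [1] 1
  | repEnd : Sig k [14] [] 1
  | var (x y : ℕ) : Sig k [15, x, y] [] 2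
  | concat (x y z : ℕ) : Sig k [16, x, y, z] [] 2
  | extract (x i y : ℕ) : Sig k [17, x, i, y] [0] 2
  | replace (x y : ℕ) : Sig k [18, x, y] [1, 0] 2
  | replaceAll (x y : ℕ) : Sig k [19, x, y] [1, 0] 2
  | mem (x : ℕ) : Sig k [20, x] [0] 2
  | and : Sig k [21] [2, 2] 2

lemma sig_of_Sig {s ks : List ℕ} {κ : ℕ} (h : Sig k s ks κ) : sig k s = some (ks, κ) := by
  cases h with
  | letter a => simp [sig, eqB, leB, not_le.2 a.2]
  | repLetter a => simp [sig, eqB, leB, not_le.2 a.2]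
  | opt g => cases g <;> simp [sig, eqB, leB]
  | star g => cases g <;> simp [sig, eqB, leB]
  | plus g => cases g <;> simp [sig, eqB, leB]
  | rep g m d => cases g <;> simp [sig, eqB, leB]
  | _ => simp [sig, eqB, leB]

lemma exists_toNat {n : ℕ} (h : n ≤ 1) : ∃ g : Bool, g.toNat = n := by
  obtain rfl | rfl : n = 0 ∨ n = 1 := by omega
  · exact ⟨false, rfl⟩
  · exact ⟨true, rfl⟩

lemma cond_eq_some {α : Type*} {b : Bool} {x : α} {y : Option α} {z : α}
    (h : (bif b then some x else y) = some z) : (b = true ∧ x = z) ∨ y = some z := by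
  cases b
  · exact Or.inr h
  · exact Or.inl ⟨rfl, Option.some.inj h⟩

lemma Sig_of_sig {s ks : List ℕ} {κ : ℕ} (h : sig k s = some (ks, κ)) : Sig k s ks κ := by
  unfold sig at h
  generalize s.getD 1 0 = a at h
  generalize s.getD 2 0 = b at h
  generalize s.getD 3 0 = c at h
  have hlt : ∀ {a : ℕ}, (!leB k a) = true → a < k := fun {a} h => by
    rw [Bool.not_eq_true', ← Bool.not_eq_true, leB_iff] at h
    omega
  rcases cond_eq_some h with ⟨h1, h2⟩ | h
  · obtain ⟨rfl, rfl⟩ := Prod.mk.inj h2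
    simp only [Bool.or_eq_true, Bool.and_eq_true, eqB_iff] at h1
    obtain rfl | rfl | ⟨rfl, h3⟩ := h1
    · exact .empty
    · exact .eps
    · exact .letter ⟨a, hlt h3⟩
  rcases cond_eq_some h with ⟨h1, h2⟩ | h
  · obtain ⟨rfl, rfl⟩ := Prod.mk.inj h2
    simp only [Bool.or_eq_true, Bool.and_eq_true, eqB_iff, leB_iff] at h1
    obtain rfl | ⟨h2, h⟩ := h1
    · exact .group
    · obtain ⟨g, rfl⟩ := exists_toNat h
      obtain rfl | rfl | rfl := h2
      · exact .opt g
      · exact .star g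
      · exact .plus g
  rcases cond_eq_some h with ⟨h1, h2⟩ | h
  · obtain ⟨rfl, rfl⟩ := Prod.mk.inj h2
    simp only [Bool.and_eq_true, eqB_iff, leB_iff] at h1
    obtain ⟨rfl, h3, h4⟩ := h1
    obtain ⟨g, rfl⟩ := exists_toNat h3
    obtain ⟨d, rfl⟩ := Nat.exists_eq_add_of_le h4
    exact .rep g b d
  rcases cond_eq_some h with ⟨h1, h2⟩ | h
  · obtain ⟨rfl, rfl⟩ := Prod.mk.inj h2
    simp only [Bool.or_eq_true, eqB_iff] at h1
    obtain rfl | rfl := h1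
    · exact .alt
    · exact .seq
  rcases cond_eq_some h with ⟨h1, h2⟩ | h
  · obtain ⟨rfl, rfl⟩ := Prod.mk.inj h2
    obtain rfl := eqB_iff.1 h1
    exact .repEnd
  rcases cond_eq_some h with ⟨h1, h2⟩ | h
  · obtain ⟨rfl, rfl⟩ := Prod.mk.inj h2
    simp only [Bool.and_eq_true, eqB_iff] at h1
    obtain ⟨rfl, h3⟩ := h1
    exact .repLetter ⟨a, hlt h3⟩
  rcases cond_eq_some h with ⟨h1, h2⟩ | h
  · obtain ⟨rfl, rfl⟩ := Prod.mk.inj h2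
    simp only [Bool.or_eq_true, eqB_iff] at h1
    obtain rfl | rfl | rfl := h1
    · exact .ref a
    · exact .before
    · exact .after
  rcases cond_eq_some h with ⟨h1, h2⟩ | h
  · obtain ⟨rfl, rfl⟩ := Prod.mk.inj h2
    simp only [Bool.or_eq_true, eqB_iff] at h1
    obtain rfl | rfl := h1
    · exact .var a b
    · exact .concat a b c
  rcases cond_eq_some h with ⟨h1, h2⟩ | h
  · obtain ⟨rfl, rfl⟩ := Prod.mk.inj h2
    simp only [Bool.or_eq_true, eqB_iff] at h1
    obtain rfl | rfl := h1
    · exact .extract a b c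
    · exact .mem a
  rcases cond_eq_some h with ⟨h1, h2⟩ | h
  · obtain ⟨rfl, rfl⟩ := Prod.mk.inj h2
    simp only [Bool.or_eq_true, eqB_iff] at h1
    obtain rfl | rfl := h1
    · exact .replace a b
    · exact .replaceAll a b
  rcases cond_eq_some h with ⟨h1, h2⟩ | h
  · obtain ⟨rfl, rfl⟩ := Prod.mk.inj h2
    obtain rfl := eqB_iff.1 h1
    exact .and
  · simp at h

/-- A parsed object: its kind, its code, and its atoms if it is a formula. -/
abbrev Item : Type := ℕ × List (List ℕ) × List Atom

def newItem (s : List ℕ) (κ : ℕ) (l : List Item) : Item :=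
  (κ, s :: l.flatMap (fun i => i.2.1),
    -- A conjunction collects the atoms of its parts; any other symbol is treated as a new atom,
    -- which is meaningful only for equations and membership constraints.
    bif eqB s [21] then l.flatMap fun i => i.2.2 else [(s, l.map fun i => i.2.1)])

def parseStep (k : ℕ) (s : List ℕ) (st : List Item) : Option (List Item) :=
  (sig k s).bind fun p => bif eqB ((st.take p.1.length).map fun i => i.1) p.1 then
    some (newItem s p.2 (st.take p.1.length) :: st.drop p.1.length) else none

def parse (k : ℕ) (c : List (List ℕ)) : Option (List Item) :=
  c.foldr (fun s o => o.bind fun st => parseStep k s st) (some [])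

section
variable {α : Type*} [Primcodable α]

@[fun_prop]
lemma sig_pr {f : α → ℕ} {g : α → List ℕ} (hf : Primrec f) (hg : Primrec g) :
    Primrec (fun x => sig (f x) (g x)) := by unfold sig; fun_prop

@[fun_prop]
lemma parse_pr {f : α → ℕ} {g : α → List (List ℕ)} (hf : Primrec f) (hg : Primrec g) :
    Primrec (fun x => parse (f x) (g x)) := by unfold parse parseStep newItem; fun_prop

end

lemma parseStep_eq_some {s : List ℕ} {st st' : List Item} :
    parseStep k s st = some st' ↔ ∃ l r κ, st = l ++ r ∧ Sig k s (l.map fun i => i.1) κ ∧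
      st' = newItem s κ l :: r := by
  rw [parseStep, Option.bind_eq_some_iff]
  constructor
  · rintro ⟨⟨ks, κ⟩, h1, h2⟩
    rcases cond_eq_some h2 with ⟨h3, h2⟩ | h2
    · refine ⟨st.take ks.length, st.drop ks.length, κ, (List.take_append_drop _ _).symm, ?_,
        h2.symm⟩
      rw [eqB_iff.1 h3]
      exact Sig_of_sig h1
    · simp at h2
  · rintro ⟨l, r, κ, rfl, h1, rfl⟩
    refine ⟨_, sig_of_Sig h1, ?_⟩
    have h2 : (l.map fun i => i.1).length = l.length := List.length_map _
    simp only [h2, List.take_left, List.drop_left, eqB_self, cond_true]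

/-- The parsed object is what it claims to be. -/
def Good (k : ℕ) (i : Item) : Prop :=
  (i.1 = 0 → ∃ e : Regex k, e.code = i.2.1) ∧
  (i.1 = 1 → ∃ r : List (RepSym k), repCode r = i.2.1) ∧
  (i.1 = 2 → ∃ φ : Formula k, φ.Conjunctive ∧ φ.code = i.2.1 ∧ φ.atoms = i.2.2)

/-- Each signature corresponds to one constructor, applied to the objects given by the constituents.
Disjunction and negation have no signature, so parsed formulas are conjunctive. -/
lemma good_newItem {s : List ℕ} {κ : ℕ} {l : List Item} (h : Sig k s (l.map fun i => i.1) κ)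
    (hl : ∀ i ∈ l, Good k i) : Good k (newItem s κ l) := by
  have hr : ∀ (e : Regex k) s l at', e.code = s :: l → Good k (0, s :: l, at') :=
    fun e s l at' he => ⟨fun _ => ⟨e, he⟩, fun h => absurd h (by simp), fun h => absurd h (by simp)⟩
  have hp : ∀ (r : List (RepSym k)) s l at', repCode r = s :: l → Good k (1, s :: l, at') :=
    fun r s l at' he => ⟨fun h => absurd h (by simp), fun _ => ⟨r, he⟩, fun h => absurd h (by simp)⟩
  have hf : ∀ (φ : Formula k) s l at', φ.Conjunctive → φ.code = s :: l → φ.atoms = at' →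
      Good k (2, s :: l, at') := fun φ s l at' h1 h2 h3 =>
    ⟨fun h => absurd h (by simp), fun h => absurd h (by simp), fun _ => ⟨φ, h1, h2, h3⟩⟩
  generalize hks : l.map (fun i => i.1) = ks at h
  have h0 : ks = [] → l = [] := fun h => by rwa [h, List.map_eq_nil_iff] at hks
  have h1 : ∀ κ, ks = [κ] → ∃ i, l = [i] ∧ i.1 = κ ∧ Good k i := fun κ h => by
    subst h
    obtain ⟨i, rfl, hi⟩ := List.map_eq_singleton_iff.1 hks
    exact ⟨i, rfl, hi, hl i (by simp)⟩
  have h2 : ∀ κ κ', ks = [κ, κ'] → ∃ i j, l = [i, j] ∧ i.1 = κ ∧ j.1 = κ' ∧ Good k i ∧ Good k j :=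
    fun κ κ' h => by
      subst h
      obtain ⟨i, l', rfl, hi, hl'⟩ := List.map_eq_cons_iff.1 hks
      obtain ⟨j, rfl, hj⟩ := List.map_eq_singleton_iff.1 hl'
      exact ⟨i, j, rfl, hi, hj, hl i (by simp), hl j (by simp)⟩
  have hre : ∀ {i : Item}, i.1 = 0 → Good k i → ∃ e : Regex k, e.code = i.2.1 :=
    fun h h' => h'.1 h
  cases h with
  | empty => obtain rfl := h0 rfl; exact hr .empty _ _ _ rfl
  | eps => obtain rfl := h0 rfl; exact hr .eps _ _ _ rfl
  | letter a => obtain rfl := h0 rfl; exact hr (.letter a) _ _ _ rfl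
  | group =>
    obtain ⟨i, rfl, hi, hg⟩ := h1 _ rfl
    obtain ⟨e, he⟩ := hg.1 hi
    exact hr (.group e) _ _ _ (by simp [Regex.code, he])
  | alt =>
    obtain ⟨i, j, rfl, hi, hj, hg, hg'⟩ := h2 _ _ rfl
    obtain ⟨e, he⟩ := hg.1 hi
    obtain ⟨e', he'⟩ := hg'.1 hj
    exact hr (.alt e e') _ _ _ (by simp [Regex.code, he, he'])
  | seq =>
    obtain ⟨i, j, rfl, hi, hj, hg, hg'⟩ := h2 _ _ rfl
    obtain ⟨e, he⟩ := hg.1 hi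
    obtain ⟨e', he'⟩ := hg'.1 hj
    exact hr (.seq e e') _ _ _ (by simp [Regex.code, he, he'])
  | opt g =>
    obtain ⟨i, rfl, hi, hg⟩ := h1 _ rfl
    obtain ⟨e, he⟩ := hg.1 hi
    exact hr (.opt g e) _ _ _ (by simp [Regex.code, he])
  | star g =>
    obtain ⟨i, rfl, hi, hg⟩ := h1 _ rfl
    obtain ⟨e, he⟩ := hg.1 hi
    exact hr (.star g e) _ _ _ (by simp [Regex.code, he])
  | plus g =>
    obtain ⟨i, rfl, hi, hg⟩ := h1 _ rfl
    obtain ⟨e, he⟩ := hg.1 hi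
    exact hr (.plus g e) _ _ _ (by simp [Regex.code, he])
  | rep g m d =>
    obtain ⟨i, rfl, hi, hg⟩ := h1 _ rfl
    obtain ⟨e, he⟩ := hg.1 hi
    exact hr (.rep g m d e) _ _ _ (by simp [Regex.code, he])
  | repLetter a =>
    obtain ⟨i, rfl, hi, hg⟩ := h1 _ rfl
    obtain ⟨r, he⟩ := hg.2.1 hi
    exact hp (.letter a :: r) _ _ _ (by simp [← he, repCode, RepSym.code])
  | ref j =>
    obtain ⟨i, rfl, hi, hg⟩ := h1 _ rfl
    obtain ⟨r, he⟩ := hg.2.1 hi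
    exact hp (.ref j :: r) _ _ _ (by simp [← he, repCode, RepSym.code])
  | before =>
    obtain ⟨i, rfl, hi, hg⟩ := h1 _ rfl
    obtain ⟨r, he⟩ := hg.2.1 hi
    exact hp (.before :: r) _ _ _ (by simp [← he, repCode, RepSym.code])
  | after =>
    obtain ⟨i, rfl, hi, hg⟩ := h1 _ rfl
    obtain ⟨r, he⟩ := hg.2.1 hi
    exact hp (.after :: r) _ _ _ (by simp [← he, repCode, RepSym.code])
  | repEnd => obtain rfl := h0 rfl; exact hp [] _ _ _ rfl
  | var x y => obtain rfl := h0 rfl; exact hf (.eqn x (.var y)) _ _ _ trivial rfl rfl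
  | concat x y z => obtain rfl := h0 rfl; exact hf (.eqn x (.concat y z)) _ _ _ trivial rfl rfl
  | extract x n y =>
    obtain ⟨i, rfl, hi, hg⟩ := h1 _ rfl
    obtain ⟨e, he⟩ := hg.1 hi
    exact hf (.eqn x (.extract n e y)) _ _ _ trivial (by simp [Formula.code, he])
      (by simp [Formula.atoms, eqnAtom, he, eqB])
  | replace x y =>
    obtain ⟨i, j, rfl, hi, hj, hg, hg'⟩ := h2 _ _ rfl
    obtain ⟨r, hr'⟩ := hg.2.1 hi
    obtain ⟨e, he⟩ := hg'.1 hj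
    exact hf (.eqn x (.replace e r y)) _ _ _ trivial (by simp [Formula.code, he, hr'])
      (by simp [Formula.atoms, eqnAtom, he, hr', eqB])
  | replaceAll x y =>
    obtain ⟨i, j, rfl, hi, hj, hg, hg'⟩ := h2 _ _ rfl
    obtain ⟨r, hr'⟩ := hg.2.1 hi
    obtain ⟨e, he⟩ := hg'.1 hj
    exact hf (.eqn x (.replaceAll e r y)) _ _ _ trivial (by simp [Formula.code, he, hr'])
      (by simp [Formula.atoms, eqnAtom, he, hr', eqB])
  | mem x =>
    obtain ⟨i, rfl, hi, hg⟩ := h1 _ rfl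
    obtain ⟨e, he⟩ := hg.1 hi
    exact hf (.mem x e) _ _ _ trivial (by simp [Formula.code, he])
      (by simp [Formula.atoms, memAtom, he, eqB])
  | and =>
    obtain ⟨i, j, rfl, hi, hj, hg, hg'⟩ := h2 _ _ rfl
    obtain ⟨φ, hφ, h3, h4⟩ := hg.2.2 hi
    obtain ⟨ψ, hψ, h5, h6⟩ := hg'.2.2 hj
    exact hf (.and φ ψ) _ _ _ ⟨hφ, hψ⟩ (by simp [Formula.code, h3, h5])
      (by simp [Formula.atoms, h4, h6, eqB])

lemma parse_cons (s : List ℕ) (c : List (List ℕ)) :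
    parse k (s :: c) = (parse k c).bind fun st => parseStep k s st := rfl

/-- Throughout the parsing, the codes on the stack make up exactly the part of the input that has
been read. -/
lemma parse_sound {c : List (List ℕ)} {st : List Item} (h : parse k c = some st) :
    c = st.flatMap (fun i => i.2.1) ∧ ∀ i ∈ st, Good k i := by
  induction c generalizing st with
  | nil =>
    obtain rfl : [] = st := Option.some.inj h
    exact ⟨rfl, by simp⟩
  | cons s c ih =>
    rw [parse_cons, Option.bind_eq_some_iff] at h
    obtain ⟨st', h1, h2⟩ := h
    obtain ⟨l, r, κ, rfl, h3, rfl⟩ := parseStep_eq_some.1 h2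
    obtain ⟨rfl, h5⟩ := ih h1
    rw [List.forall_mem_append] at h5
    refine ⟨?_, List.forall_mem_cons.2 ⟨good_newItem h3 h5.1, h5.2⟩⟩
    simp [newItem]

lemma parse_step {s : List ℕ} {c : List (List ℕ)} {l st : List Item} {κ : ℕ}
    (h : parse k c = some (l ++ st)) (hs : Sig k s (l.map fun i => i.1) κ) :
    parse k (s :: c) = some (newItem s κ l :: st) := by
  rw [parse_cons, h, Option.bind_some]
  exact parseStep_eq_some.2 ⟨l, st, κ, rfl, hs, rfl⟩

lemma exists_item {s : List ℕ} {c d : List (List ℕ)} {l st : List Item} {κ : ℕ}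
    (h : parse k (s :: c) = some (newItem s κ l :: st)) (hd : s :: l.flatMap (fun i => i.2.1) = d) :
    ∃ at', parse k (s :: c) = some ((κ, d, at') :: st) := ⟨_, by rw [h, ← hd]; rfl⟩

/-- Completeness holds on top of any stack, which is what the constructors with two constituents
need. The third component carries no information for expressions, so it is left unspecified. -/
lemma parse_regex (e : Regex k) {c : List (List ℕ)} {st : List Item} (h : parse k c = some st) :
    ∃ at', parse k (e.code ++ c) = some ((0, e.code, at') :: st) := by
  induction e generalizing c st with
  | empty => exact ⟨_, parse_step (l := []) h .empty⟩
  | eps => exact ⟨_, parse_step (l := []) h .eps⟩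
  | letter a => exact ⟨_, parse_step (l := []) h (.letter a)⟩
  | group e ih =>
    obtain ⟨a, ha⟩ := ih h
    exact exists_item (parse_step (l := [_]) ha .group) (congrArg _ (List.flatMap_singleton _ _))
  | alt e e' ih ih' =>
    obtain ⟨a', ha'⟩ := ih' h
    obtain ⟨a, ha⟩ := ih ha'
    rw [Regex.code, List.cons_append, List.append_assoc]
    exact exists_item (parse_step (l := [_, _]) ha .alt) (by simp)
  | seq e e' ih ih' =>
    obtain ⟨a', ha'⟩ := ih' h
    obtain ⟨a, ha⟩ := ih ha'
    rw [Regex.code, List.cons_append, List.append_assoc]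
    exact exists_item (parse_step (l := [_, _]) ha .seq) (by simp)
  | opt g e ih =>
    obtain ⟨a, ha⟩ := ih h
    exact exists_item (parse_step (l := [_]) ha (.opt g)) (congrArg _ (List.flatMap_singleton _ _))
  | star g e ih =>
    obtain ⟨a, ha⟩ := ih h
    exact exists_item (parse_step (l := [_]) ha (.star g)) (congrArg _ (List.flatMap_singleton _ _))
  | plus g e ih =>
    obtain ⟨a, ha⟩ := ih h
    exact exists_item (parse_step (l := [_]) ha (.plus g)) (congrArg _ (List.flatMap_singleton _ _))
  | rep g m d e ih =>
    obtain ⟨a, ha⟩ := ih h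
    exact exists_item (parse_step (l := [_]) ha (.rep g m d)) (congrArg _ (List.flatMap_singleton _ _))

lemma parse_rep (r : List (RepSym k)) {c : List (List ℕ)} {st : List Item}
    (h : parse k c = some st) :
    ∃ at', parse k (repCode r ++ c) = some ((1, repCode r, at') :: st) := by
  induction r with
  | nil => exact ⟨_, parse_step (l := []) h .repEnd⟩
  | cons s r ih =>
    obtain ⟨a, ha⟩ := ih
    have hs : Sig k s.code [1] 1 := by
      cases s with
      | letter a => exact .repLetter a
      | ref i => exact .ref i
      | before => exact .before
      | after => exact .after
    exact exists_item (parse_step (l := [_]) ha hs) (congrArg _ (List.flatMap_singleton _ _))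

lemma parse_formula (φ : Formula k) (hφ : φ.Conjunctive) {c : List (List ℕ)} {st : List Item}
    (h : parse k c = some st) : parse k (φ.code ++ c) = some ((2, φ.code, φ.atoms) :: st) := by
  induction φ generalizing c st with
  | eqn x t =>
    cases t with
    | var y => exact parse_step (l := []) h (.var x y)
    | concat y z => exact parse_step (l := []) h (.concat x y z)
    | extract i e y =>
      obtain ⟨a, ha⟩ := parse_regex e h
      refine (parse_step (l := [_]) ha (.extract x i y)).trans ?_
      simp [newItem, eqB, Formula.code, Formula.atoms, eqnAtom]
    | replace e r y =>
      obtain ⟨a, ha⟩ := parse_regex e h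
      obtain ⟨a', ha'⟩ := parse_rep r ha
      rw [Formula.code, List.cons_append, List.append_assoc]
      refine (parse_step (l := [_, _]) ha' (.replace x y)).trans ?_
      simp [newItem, eqB, Formula.atoms, eqnAtom]
    | replaceAll e r y =>
      obtain ⟨a, ha⟩ := parse_regex e h
      obtain ⟨a', ha'⟩ := parse_rep r ha
      rw [Formula.code, List.cons_append, List.append_assoc]
      refine (parse_step (l := [_, _]) ha' (.replaceAll x y)).trans ?_
      simp [newItem, eqB, Formula.atoms, eqnAtom]
  | mem x e =>
    obtain ⟨a, ha⟩ := parse_regex e h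
    refine (parse_step (l := [_]) ha (.mem x)).trans ?_
    simp [newItem, eqB, Formula.code, Formula.atoms, memAtom]
  | and φ ψ ih ih' =>
    have ha := ih hφ.1 (ih' hφ.2 h)
    rw [Formula.code, List.cons_append, List.append_assoc]
    refine (parse_step (l := [_, _]) ha .and).trans ?_
    simp [newItem, eqB, Formula.atoms]
  | or => exact hφ.elim
  | not => exact hφ.elim

end StrSL

namespace StrSL

open PR
variable {k : ℕ}

/-! ### The decision procedure -/

def valCode (k : ℕ) (a : Atom) (σ : List (List ℕ)) : Option (List ℕ) :=
  bif eqB (a.1.getD 0 0) 15 then some (σ.getD (a.1.getD 2 0) [])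
  else bif eqB (a.1.getD 0 0) 16 then
    some (σ.getD (a.1.getD 2 0) [] ++ σ.getD (a.1.getD 3 0) [])
  else bif eqB (a.1.getD 0 0) 17 then
    extCode (a.1.getD 2 0) (a.2.getD 0 []) (σ.getD (a.1.getD 3 0) [])
  else bif eqB (a.1.getD 0 0) 18 then
    some (replCode k (a.2.getD 1 []) (a.2.getD 0 []) (σ.getD (a.1.getD 2 0) []))
  else some (allCode k (a.2.getD 1 []) (a.2.getD 0 []) (σ.getD (a.1.getD 2 0) []))

def execCode (k : ℕ) (l : List Atom) (σ : List (List ℕ)) : Option (List (List ℕ)) :=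
  l.foldl (fun o a => o.bind fun σ => (valCode k a σ).map fun w => σ.set (a.1.getD 1 0) w)
    (some σ)

def matchBound (c : List (List ℕ)) (N M : ℕ) : ℕ :=
  N * PSST.profileBound N c.length (tabOf c).2.length M

/-- Bounds as in `Term.Bounded`. -/
def boundCode (k : ℕ) (a : Atom) (N : ℕ) : ℕ :=
  bif eqB (a.1.getD 0 0) 17 then
    matchBound (a.2.getD 0 []) N N
  else bif leB 18 (a.1.getD 0 0) then
    matchBound (searchCode k (a.2.getD 1 [])) N (restCount N)
  else N

def memBoundCode (m : List Atom) : ℕ :=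
  m.foldr (fun a N => foldCode 0 boundStep (a.2.getD 0 []) * N) 4

def varsCode (a : Atom) : List ℕ :=
  bif eqB (a.1.getD 0 0) 16 then [a.1.getD 2 0, a.1.getD 3 0]
  else bif eqB (a.1.getD 0 0) 17 then [a.1.getD 3 0] else [a.1.getD 2 0]

def memB (n : ℕ) (l : List ℕ) : Bool := l.any fun y => eqB y n

def orderedB (l : List Atom) : Bool :=
  pairwiseB (fun p q => !eqB (p.1.getD 1 0) (q.1.getD 1 0) &&
    !memB (q.1.getD 1 0) (varsCode p)) l && l.all fun p => !memB (p.1.getD 1 0) (varsCode p)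

/-- Whether the equations in `l` and the membership constraints in `m` have a common solution that
is computed from words of length at most `B` for the variables below `M`. -/
def solveB (k M B : ℕ) (l m : List Atom) : Bool :=
  (listsEq (listsLE (List.range k) B) M).any fun σ => (execCode k l σ).elim false fun τ =>
    m.all fun a => langB (a.2.getD 0 []) (τ.getD (a.1.getD 1 0) [])

def decideB (k M : ℕ) (e m : List Atom) : Bool :=
  -- All candidates for a straight-line order are tried; repetitions are excluded by `orderedB`, so
  -- longer lists are not needed.
  (listsLE e e.length).any fun l => e.all (fun a => l.any fun b => eqB b a) &&
    (orderedB l && solveB k M (l.foldr (fun a N => boundCode k a N) (memBoundCode m)) l m)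

def decideFormula (k : ℕ) (c : List (List ℕ)) : Bool :=
  (parse k c).elim false fun st => eqB (st.map fun i => i.1) [2] &&
    -- The sum of all numbers in the code, plus one, exceeds every variable that occurs.
    decideB k (c.flatten.foldr (fun a b => a + b) 0 + 1)
      ((st.getD 0 (0, [], [])).2.2.filter fun a => !eqB (a.1.getD 0 0) 20)
      ((st.getD 0 (0, [], [])).2.2.filter fun a => eqB (a.1.getD 0 0) 20)

section
variable {α : Type*} [Primcodable α]

@[fun_prop]
lemma valCode_pr {f : α → ℕ} {g : α → Atom} {h : α → List (List ℕ)} (hf : Primrec f)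
    (hg : Primrec g) (hh : Primrec h) : Primrec (fun x => valCode (f x) (g x) (h x)) := by
  unfold valCode; fun_prop

@[fun_prop]
lemma execCode_pr {f : α → ℕ} {g : α → List Atom} {h : α → List (List ℕ)} (hf : Primrec f)
    (hg : Primrec g) (hh : Primrec h) : Primrec (fun x => execCode (f x) (g x) (h x)) := by
  unfold execCode; fun_prop

@[fun_prop]
lemma matchBound_pr {f : α → List (List ℕ)} {g h : α → ℕ} (hf : Primrec f)
    (hg : Primrec g) (hh : Primrec h) : Primrec (fun x => matchBound (f x) (g x) (h x)) := by
  have h1 : Primrec (fun x => (tabOf (f x)).2.length) :=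
    Primrec.list_length.comp (Primrec.snd.comp (tabOf_pr hf))
  have h2 : Primrec (fun x => (f x).length) := Primrec.list_length.comp hf
  have h3 := profileBound_pr hg h2 h1 hh
  unfold matchBound
  exact Primrec.nat_mul.comp hg h3

@[fun_prop]
lemma boundCode_pr {f : α → ℕ} {g : α → Atom} {h : α → ℕ} (hf : Primrec f)
    (hg : Primrec g) (hh : Primrec h) : Primrec (fun x => boundCode (f x) (g x) (h x)) := by
  unfold boundCode; fun_prop

@[fun_prop]
lemma memBoundCode_pr {f : α → List Atom} (hf : Primrec f) :
    Primrec (fun x => memBoundCode (f x)) := by unfold memBoundCode; fun_prop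

@[fun_prop]
lemma varsCode_pr {f : α → Atom} (hf : Primrec f) : Primrec (fun x => varsCode (f x)) := by
  unfold varsCode; fun_prop

@[fun_prop]
lemma memB_pr {f : α → ℕ} {g : α → List ℕ} (hf : Primrec f) (hg : Primrec g) :
    Primrec (fun x => memB (f x) (g x)) := by unfold memB; fun_prop

@[fun_prop]
lemma orderedB_pr {f : α → List Atom} (hf : Primrec f) : Primrec (fun x => orderedB (f x)) := by
  unfold orderedB pairwiseB; fun_prop

@[fun_prop]
lemma solveB_pr {f g h : α → ℕ} {l m : α → List Atom} (hf : Primrec f) (hg : Primrec g)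
    (hh : Primrec h) (hl : Primrec l) (hm : Primrec m) :
    Primrec (fun x => solveB (f x) (g x) (h x) (l x) (m x)) := by unfold solveB; fun_prop

@[fun_prop]
lemma decideB_pr {f g : α → ℕ} {e m : α → List Atom} (hf : Primrec f) (hg : Primrec g)
    (he : Primrec e) (hm : Primrec m) :
    Primrec (fun x => decideB (f x) (g x) (e x) (m x)) := by unfold decideB; fun_prop

lemma decideFormula_pr : Primrec (fun w : ℕ × List (List ℕ) => decideFormula w.1 w.2) := by
  unfold decideFormula; fun_prop

end

lemma code_eqnAtom (p : ℕ × Term k) :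
    (Formula.eqn p.1 p.2).code = (eqnAtom p).1 :: (eqnAtom p).2.flatten := by
  obtain ⟨x, t⟩ := p
  cases t <;> simp [Formula.code, eqnAtom]

/-- The prefix code makes atoms determine equations, so an ordering of the atoms is an ordering of
the equations. -/
lemma eqnAtom_injective : Function.Injective (eqnAtom (k := k)) := by
  intro p q h
  have hc : (Formula.eqn p.1 p.2).code ++ [] = (Formula.eqn q.1 q.2).code ++ [] := by
    rw [code_eqnAtom, code_eqnAtom, h]
  have := (Formula.code_append_inj _ _ _ _ hc).1
  simp only [Formula.eqn.injEq] at this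
  exact Prod.ext this.1 this.2

lemma head_eqnAtom (p : ℕ × Term k) : (eqnAtom p).1.getD 1 0 = p.1 := by
  obtain ⟨x, t⟩ := p
  cases t <;> rfl

lemma varsCode_eqnAtom (p : ℕ × Term k) : varsCode (eqnAtom p) = p.2.vars := by
  obtain ⟨x, t⟩ := p
  cases t <;> rfl

lemma memB_iff {n : ℕ} {l : List ℕ} : memB n l = true ↔ n ∈ l := by
  simp [memB]

lemma orderedB_iff (l : List (ℕ × Term k)) : orderedB (l.map eqnAtom) = true ↔ Ordered l := by
  rw [orderedB, Bool.and_eq_true, pairwiseB_iff, List.pairwise_map, List.all_eq_true,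
    List.forall_mem_map, Ordered]
  simp only [head_eqnAtom, varsCode_eqnAtom, Bool.and_eq_true, Bool.not_eq_true',
    ← Bool.not_eq_true, eqB_iff, memB_iff]

/-- In the computable bound, the number of states is replaced by the number of rows of the table and
the number of variables by the length of the code. -/
lemma bounded_boundCode (p : ℕ × Term k) :
    p.2.Bounded fun N => boundCode k (eqnAtom p) N := by
  obtain ⟨x, t⟩ := p
  cases t with
  | var y => exact Term.bounded_var y
  | concat y z => exact Term.bounded_concat y z
  | extract i e y =>
    have h := Term.bounded_extract i e y (rep_tabOf e).card_le
    rw [← Regex.length_code] at h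
    exact h
  | replace pat rep y =>
    have h := Term.bounded_replace pat rep y (rep_tabOf pat.search).card_le
    rw [← Regex.length_code, ← searchCode_eq] at h
    exact h
  | replaceAll pat rep y =>
    have h := Term.bounded_replaceAll pat rep y (rep_tabOf pat.search).card_le
    rw [← Regex.length_code, ← searchCode_eq] at h
    exact h

lemma memBoundCode_eq (ms : List (ℕ × Regex k)) : memBoundCode (ms.map memAtom) = memBound ms := by
  rw [memBoundCode, List.foldr_map, memBound]
  congr 1
  funext m N
  exact congrArg (· * N) (foldRules_boundStep.foldCode 0 m.2)

/-- The list encodes the assignment. -/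
def EncOf (l : List (List ℕ)) (σ : ℕ → List (Fin k)) : Prop := ∀ y, l.getD y [] = enc (σ y)

lemma valCode_eq {l : List (List ℕ)} {σ : ℕ → List (Fin k)} (h : EncOf l σ) (p : ℕ × Term k) :
    valCode k (eqnAtom p) l = (p.2.val σ).map enc := by
  obtain ⟨x, t⟩ := p
  cases t with
  | var y => exact congrArg some (h y)
  | concat y z =>
    refine congrArg some ((congrArg₂ (· ++ ·) (h y) (h z)).trans ?_)
    rw [← enc_append]
  | extract i e y => exact (congrArg (extCode i e.code) (h y)).trans (extCode_eq i e (σ y))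
  | replace pat rep y =>
    exact congrArg some ((congrArg (replCode k pat.code (repCode rep)) (h y)).trans
      (replCode_eq pat rep (σ y)))
  | replaceAll pat rep y =>
    exact congrArg some ((congrArg (allCode k pat.code (repCode rep)) (h y)).trans
      (allCode_eq pat rep (σ y)))

/-- Writing into a list has an effect only below its length, so all left-hand sides have to be below
`M`. -/
lemma execCode_eq {M : ℕ} (ps : List (ℕ × Term k)) (hps : ∀ p ∈ ps, p.1 < M) {l : List (List ℕ)}
    {σ : ℕ → List (Fin k)} (h : EncOf l σ) (hl : l.length = M) :
    (exec σ ps = none ∧ execCode k (ps.map eqnAtom) l = none) ∨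
      ∃ τ l', exec σ ps = some τ ∧ execCode k (ps.map eqnAtom) l = some l' ∧ EncOf l' τ := by
  induction ps generalizing l σ with
  | nil => exact Or.inr ⟨σ, l, rfl, rfl, h⟩
  | cons p ps ih =>
    rw [List.forall_mem_cons] at hps
    rw [exec, execCode, List.map_cons, List.foldl_cons, Option.bind_some, valCode_eq h,
      head_eqnAtom]
    cases p.2.val σ with
    | none =>
      refine Or.inl ⟨rfl, ?_⟩
      generalize ps.map eqnAtom = as
      induction as with
      | nil => rfl
      | cons a as ih => exact ih
    | some w =>
      refine ih hps.2 (l := l.set p.1 (enc w)) (fun y => ?_) (by rw [List.length_set, hl])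
      by_cases hy : y = p.1
      · subst hy
        rw [Function.update_self, List.getD_eq_getElem?_getD, List.getElem?_set_self (by omega)]
        rfl
      · rw [Function.update_of_ne hy, ← h y, List.getD_eq_getElem?_getD,
          List.getElem?_set_ne (Ne.symm hy), List.getD_eq_getElem?_getD]

lemma exists_enc {w : List ℕ} (h : ∀ a ∈ w, a < k) : ∃ v : List (Fin k), enc v = w := by
  induction w with
  | nil => exact ⟨[], rfl⟩
  | cons a w ih =>
    rw [List.forall_mem_cons] at h
    obtain ⟨v, rfl⟩ := ih h.2
    exact ⟨⟨a, h.1⟩ :: v, rfl⟩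

/-- Assignments that are empty from `M` on correspond to lists of length `M`, where `[]` is the
default value of the lookup. -/
lemma solveB_iff {M B : ℕ} {ps : List (ℕ × Term k)} {ms : List (ℕ × Regex k)}
    (hps : ∀ p ∈ ps, p.1 < M) : solveB k M B (ps.map eqnAtom) (ms.map memAtom) = true ↔
      ∃ σ τ : ℕ → List (Fin k), (∀ y, (σ y).length ≤ B) ∧ (∀ y, M ≤ y → σ y = []) ∧
        exec σ ps = some τ ∧ ∀ m ∈ ms, τ m.1 ∈ m.2.lang := by
  have key : ∀ (l : List (List ℕ)) (σ : ℕ → List (Fin k)), EncOf l σ → l.length = M →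
      (((execCode k (ps.map eqnAtom) l).elim false fun τ => (ms.map memAtom).all fun a =>
        langB (a.2.getD 0 []) (τ.getD (a.1.getD 1 0) [])) = true ↔
      ∃ τ, exec σ ps = some τ ∧ ∀ m ∈ ms, τ m.1 ∈ m.2.lang) := by
    intro l σ h hl
    rcases execCode_eq ps hps h hl with ⟨h1, h2⟩ | ⟨τ, l', h1, h2, h3⟩
    · simp [h1, h2]
    · rw [h1, h2, Option.elim_some, List.all_eq_true, List.forall_mem_map]
      have h4 : ∀ m : ℕ × Regex k, langB ((memAtom m).2.getD 0 [])
          (l'.getD ((memAtom m).1.getD 1 0) []) = true ↔ τ m.1 ∈ m.2.lang := fun m => by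
        have : l'.getD ((memAtom m).1.getD 1 0) [] = enc (τ m.1) := h3 m.1
        rw [this]
        exact langB_iff
      constructor
      · exact fun h => ⟨τ, rfl, fun m hm => (h4 m).1 (h m hm)⟩
      · rintro ⟨τ', h5, h6⟩
        obtain rfl := Option.some.inj h5
        exact fun m hm => (h4 m).2 (h6 m hm)
  rw [solveB, List.any_eq_true]
  simp only [mem_listsEq, mem_listsLE, List.mem_range]
  constructor
  · rintro ⟨l, ⟨hl, hw⟩, h⟩
    have h1 : ∀ y, ∃ v : List (Fin k), enc v = l.getD y [] ∧ v.length ≤ B ∧ (M ≤ y → v = []) := by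
      intro y
      by_cases hy : y < l.length
      · have hm : l.getD y [] ∈ l := by
          rw [List.getD_eq_getElem _ _ hy]
          exact List.getElem_mem hy
        obtain ⟨v, hv⟩ := exists_enc (hw _ hm).2
        refine ⟨v, hv, ?_, fun h => by omega⟩
        rw [← length_enc v, hv]
        exact (hw _ hm).1
      · exact ⟨[], (List.getD_eq_default _ _ (not_lt.1 hy)).symm, by simp, fun _ => rfl⟩
    choose σ h2 h3 h4 using h1
    obtain ⟨τ, h5⟩ := (key l σ (fun y => (h2 y).symm) hl).1 h
    exact ⟨σ, τ, h3, h4, h5⟩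
  · rintro ⟨σ, τ, h1, h2, h3⟩
    have hl : ((List.range M).map fun y => enc (σ y)).length = M := by simp
    refine ⟨(List.range M).map fun y => enc (σ y), ⟨hl, ?_⟩,
      (key _ σ (fun y => ?_) hl).2 ⟨τ, h3⟩⟩
    · rw [List.forall_mem_map]
      intro y _
      refine ⟨by rw [length_enc]; exact h1 y, ?_⟩
      rw [enc, List.forall_mem_map]
      exact fun a _ => a.2
    · by_cases hy : y < M
      · exact getD_map_range hy _ _
      · rw [List.getD_eq_default _ _ (by omega), h2 y (not_lt.1 hy)]
        rfl

lemma filter_atoms (φ : Formula k) :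
    (φ.atoms.filter fun a => !eqB (a.1.getD 0 0) 20) = φ.eqns.map eqnAtom ∧
      (φ.atoms.filter fun a => eqB (a.1.getD 0 0) 20) = φ.mems.map memAtom := by
  induction φ with
  | eqn x t => cases t <;> exact ⟨rfl, rfl⟩
  | mem x e => exact ⟨rfl, rfl⟩
  | and φ ψ ih ih' =>
    simp only [Formula.atoms, Formula.eqns, Formula.mems, List.filter_append, List.map_append, ih,
      ih', and_self]
  | or φ ψ ih ih' =>
    simp only [Formula.atoms, Formula.eqns, Formula.mems, List.filter_append, List.map_append, ih,
      ih', and_self]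
  | not φ ih => exact ih

lemma Formula.mem_code_of_eqns {φ : Formula k} {p : ℕ × Term k} (h : p ∈ φ.eqns) :
    (eqnAtom p).1 ∈ φ.code := by
  induction φ with
  | eqn x t =>
    obtain rfl := List.mem_singleton.1 h
    rw [code_eqnAtom (x, t)]
    exact List.mem_cons_self
  | mem x e => simp [eqns] at h
  | and φ ψ ih ih' =>
    rw [eqns, List.mem_append] at h
    rw [code, List.mem_cons, List.mem_append]
    exact Or.inr (h.imp ih ih')
  | or φ ψ ih ih' =>
    rw [eqns, List.mem_append] at h
    rw [code, List.mem_cons, List.mem_append]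
    exact Or.inr (h.imp ih ih')
  | not φ ih => exact List.mem_cons_of_mem _ (ih h)

lemma Formula.mem_code_of_mems {φ : Formula k} {m : ℕ × Regex k} (h : m ∈ φ.mems) :
    [20, m.1] ∈ φ.code := by
  induction φ with
  | eqn x t => simp [mems] at h
  | mem x e =>
    obtain rfl := List.mem_singleton.1 h
    exact List.mem_cons_self
  | and φ ψ ih ih' =>
    rw [mems, List.mem_append] at h
    rw [code, List.mem_cons, List.mem_append]
    exact Or.inr (h.imp ih ih')
  | or φ ψ ih ih' =>
    rw [mems, List.mem_append] at h
    rw [code, List.mem_cons, List.mem_append]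
    exact Or.inr (h.imp ih ih')
  | not φ ih => exact List.mem_cons_of_mem _ (ih h)

lemma lt_sum_flatten {c : List (List ℕ)} {s : List ℕ} {y : ℕ} (hs : s ∈ c) (hy : y ∈ s) :
    y < c.flatten.foldr (fun a b => a + b) 0 + 1 :=
  Nat.lt_succ_of_le (List.le_sum_of_mem (List.mem_flatten.2 ⟨s, hs, hy⟩))

lemma mem_eqnAtom (p : ℕ × Term k) : p.1 ∈ (eqnAtom p).1 ∧ ∀ y ∈ p.2.vars, y ∈ (eqnAtom p).1 := by
  obtain ⟨x, t⟩ := p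
  cases t <;> simp [eqnAtom, Term.vars]

lemma exists_map_eq {α β : Type*} {f : α → β} {l : List α} {l' : List β}
    (h : ∀ b ∈ l', b ∈ l.map f) : ∃ l'' : List α, l' = l''.map f ∧ ∀ a ∈ l'', a ∈ l := by
  induction l' with
  | nil => exact ⟨[], rfl, by simp⟩
  | cons b l' ih =>
    rw [List.forall_mem_cons] at h
    obtain ⟨a, ha, rfl⟩ := List.mem_map.1 h.1
    obtain ⟨l'', rfl, hl⟩ := ih h.2
    exact ⟨a :: l'', rfl, List.forall_mem_cons.2 ⟨ha, hl⟩⟩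

lemma Ordered.nodup {l : List (ℕ × Term k)} (h : Ordered l) : l.Nodup :=
  h.1.imp fun h' he => h'.1 (congrArg Prod.fst he)

/-- For each admissible order of the equations the bounded search is equivalent to satisfiability
(`hsat`), so it does not matter which order the procedure finds. -/
lemma decideB_iff {φ : Formula k} (hφ : φ.Conjunctive) :
    decideB k (φ.code.flatten.foldr (fun a b => a + b) 0 + 1)
      (φ.atoms.filter fun a => !eqB (a.1.getD 0 0) 20)
      (φ.atoms.filter fun a => eqB (a.1.getD 0 0) 20) = true ↔
    φ.StraightLine ∧ φ.Satisfiable := by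
  have hsat : ∀ l : List (ℕ × Term k), (∀ p, p ∈ l ↔ p ∈ φ.eqns) → Ordered l →
      (solveB k (φ.code.flatten.foldr (fun a b => a + b) 0 + 1)
        ((l.map eqnAtom).foldr (fun a N => boundCode k a N) (memBoundCode (φ.mems.map memAtom)))
        (l.map eqnAtom) (φ.mems.map memAtom) = true ↔ φ.Satisfiable) := by
    intro l hl ho
    have hlt : ∀ p ∈ l, p.1 < φ.code.flatten.foldr (fun a b => a + b) 0 + 1 ∧
        ∀ y ∈ p.2.vars, y < φ.code.flatten.foldr (fun a b => a + b) 0 + 1 := fun p hp =>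
      ⟨lt_sum_flatten (Formula.mem_code_of_eqns ((hl p).1 hp)) (mem_eqnAtom p).1,
        fun y hy => lt_sum_flatten (Formula.mem_code_of_eqns ((hl p).1 hp))
          ((mem_eqnAtom p).2 y hy)⟩
    have hlt' : ∀ m ∈ φ.mems, m.1 < φ.code.flatten.foldr (fun a b => a + b) 0 + 1 := fun m hm =>
      lt_sum_flatten (Formula.mem_code_of_mems hm) (by simp)
    rw [solveB_iff fun p hp => (hlt p hp).1, List.foldr_map, memBoundCode_eq,
      ← exists_solution_iff (b := fun p N => boundCode k (eqnAtom p) N)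
        (fun p _ => bounded_boundCode p) ho hlt hlt', Formula.Satisfiable]
    refine exists_congr fun σ => ?_
    rw [Formula.holds_iff hφ]
    simp only [hl]
  rw [(filter_atoms φ).1, (filter_atoms φ).2, decideB, List.any_eq_true]
  simp only [Bool.and_eq_true, mem_listsLE, List.all_eq_true, List.any_eq_true, eqB_iff,
    exists_eq_right]
  constructor
  · rintro ⟨l', ⟨-, h1⟩, h2, h3, h4⟩
    obtain ⟨l, rfl, hl⟩ := exists_map_eq h1
    have hl' : ∀ p, p ∈ l ↔ p ∈ φ.eqns := fun p => ⟨hl p, fun hp =>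
      (List.mem_map_of_injective eqnAtom_injective).1 (h2 _ (List.mem_map_of_mem hp))⟩
    rw [orderedB_iff] at h3
    exact ⟨⟨hφ, l, hl', h3.1, h3.2⟩, (hsat l hl' h3).1 h4⟩
  · rintro ⟨⟨-, l, hl, h1, h2⟩, hs⟩
    have ho : Ordered l := ⟨h1, h2⟩
    refine ⟨l.map eqnAtom, ⟨?_, ?_⟩, ?_, (orderedB_iff l).2 ho, (hsat l hl ho).2 hs⟩
    · rw [List.length_map, List.length_map]
      -- The left-hand sides are distinct, so the order has no repetitions and is not longer than
      -- the list of the equations of `φ`, in which some may be repeated.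
      exact (ho.nodup.subperm fun p hp => (hl p).1 hp).length_le
    · rw [List.forall_mem_map]
      exact fun p hp => List.mem_map_of_mem ((hl p).1 hp)
    · rw [List.forall_mem_map]
      exact fun p hp => List.mem_map_of_mem ((hl p).2 hp)

/-- The parser must leave exactly one object, and this must be a formula. Straight-line formulas are
conjunctive, so none is lost by parsing only conjunctive ones. -/
lemma decideFormula_iff (k : ℕ) (c : List (List ℕ)) : decideFormula k c = true ↔
    ∃ φ : Formula k, φ.code = c ∧ φ.StraightLine ∧ φ.Satisfiable := by
  constructor
  · intro h
    rw [decideFormula] at h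
    cases hp : parse k c with
    | none => simp [hp] at h
    | some st =>
      rw [hp, Option.elim_some, Bool.and_eq_true, eqB_iff] at h
      obtain ⟨h1, h2⟩ := h
      obtain ⟨i, rfl, hi⟩ := List.map_eq_singleton_iff.1 h1
      obtain ⟨rfl, hg⟩ := parse_sound hp
      obtain ⟨φ, hφ, h3, h4⟩ := (hg i (by simp)).2.2 hi
      rw [List.flatMap_singleton, List.getD_cons_zero, ← h3, ← h4, decideB_iff hφ] at h2
      exact ⟨φ, by rw [List.flatMap_singleton, h3], h2⟩
  · rintro ⟨φ, rfl, h⟩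
    have hp := parse_formula φ h.1.1 (c := []) (st := []) rfl
    rw [List.append_nil] at hp
    rw [decideFormula, hp, Option.elim_some, Bool.and_eq_true, List.getD_cons_zero,
      decideB_iff h.1.1]
    exact ⟨eqB_self _, h⟩

end StrSL

theorem theorem5p4 :
    ComputablePred (fun w : ℕ × List (List ℕ) =>
      ∃ φ : StrSL.Formula w.1, φ.code = w.2 ∧ φ.StraightLine ∧ φ.Satisfiable) := by
  refine PrimrecPred.computablePred ?_
  classical
  -- The predicate is even primitive recursive, since the search is bounded by a primitive recursive
  -- function of the code.
  refine ⟨inferInstance, StrSL.decideFormula_pr.of_eq fun w => ?_⟩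
  rw [Bool.eq_iff_iff, decide_eq_true_iff]
  exact StrSL.decideFormula_iff w.1 w.2
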